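/- **Setting.** Let $(M,g)$ be a smooth $n$-dimensional Riemannian manifold and $T^*_0M$ its nonzero cotangent bundle ($T^*M$ without the zero section). A chart $(x^1,\dots,x^n)$ of $M$ with domain $U$ induces the chart $(q^1,\dots,q^n,p_1,\dots,p_n)$ of $T^*M$ over $U$, where $q^i=x^i\circ\pi$ and a covector is $p_i\,dx^i$. Sums over repeated indices are understood. Write $g_{ij}$, $g^{ij}$, $\Gamma^k_{ij}$, $R^h_{kij}$ for the components of $g$, of its inverse, the Christoffel symbols and the curvature components of $g$ (with $R(\partial_i,\partial_j)\partial_k=R^h_{kij}\partial_h$, $R(X,Y)=[\dot\nabla_X,\dot\nabla_Y]-\dot\nabla_{[X,Y]}$), and put $$g^{0i}=p_hg^{hi},\quad \Gamma^0_{ih}=p_k\Gamma^k_{ih},\quad R^0_{kij}=p_hR^h_{kij},\quad t=\tfrac12 g^{ik}p_ip_k,\quad \frac{\delta}{\delta q^i}=\frac{\partial}{\partial q^i}+\Gamma^0_{ih}\frac{\partial}{\partial p_h},\quad Dp_i=dp_i-\Gamma^0_{ij}dq^j .$$ An $M$-tensor field of type $(r,s)$ on $T^*_0M$ is given by smooth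 components, with $r$ upper and $s$ lower indices, in each induced chart, which under a change of induced charts transform like the components of a tensor field of type $(r,s)$ on $M$. Let $c_1,c_2,d_1,d_2$ be smooth functions on $(0,\infty)$ with $c_1>0$, $c_2>0$, $c_1+2td_1>0$, $c_2+2td_2>0$ for all $t>0$, and let $G$ be the Riemannian metric $G=G^{(1)}_{ij}dq^idq^j+G_{(2)}^{ij}Dp_iDp_j$ on $T^*_0M$, where $$G^{(1)}_{ij}=c_1(t)g_{ij}+d_1(t)p_ip_j,\qquad G_{(2)}^{ij}=c_2(t)g^{ij}+d_2(t)g^{0i}g^{0j}.$$ Let $$H_{(1)}^{jk}=\frac1{c_1}g^{jk}-\frac{d_1}{c_1(c_1+2td_1)}g^{0j}g^{0k},\qquad H^{(2)}_{jk}=\frac1{c_2}g_{jk}-\frac{d_2}{c_2(c_2+2td_2)}p_jp_k$$ be the entries of the inverse matrices of $(G^{(1)}_{ij})$ and $(G_{(2)}^{ij})$. **Theorem 8.** (a) In the adapted local frame $(\frac{\delta}{\delta q^1},\dots,\frac{\delta}{\delta q^n},\frac{\partial}{\partial p_1},\dots,\frac{\partial}{\partial p_n})$ of every induced chart, the Levi-Civita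 connection $\nabla$ of $G$ is $$\nabla_{\frac{\partial}{\partial p_i}}\frac{\partial}{\partial p_j}=Q^{ij}_h\frac{\partial}{\partial p_h},\qquad \nabla_{\frac{\delta}{\delta q^i}}\frac{\partial}{\partial p_j}=-\Gamma^j_{ih}\frac{\partial}{\partial p_h}+P^{hj}_i\frac{\delta}{\delta q^h},$$ $$\nabla_{\frac{\partial}{\partial p_i}}\frac{\delta}{\delta q^j}=P^{hi}_j\frac{\delta}{\delta q^h},\qquad \nabla_{\frac{\delta}{\delta q^i}}\frac{\delta}{\delta q^j}=\Gamma^h_{ij}\frac{\delta}{\delta q^h}+S_{hij}\frac{\partial}{\partial p_h},$$ where $Q^{ij}_h$, $P^{hi}_j$, $S_{hij}$ are $M$-tensor fields on $T^*_0M$, of types $(2,1)$, $(2,1)$, $(0,3)$, defined by $$Q^{ij}_h=\tfrac12H^{(2)}_{hk}\Big(\frac{\partial G_{(2)}^{jk}}{\partial p_i}+\frac{\partial G_{(2)}^{ik}}{\partial p_j}-\frac{\partial G_{(2)}^{ij}}{\partial p_k}\Big),\quad P^{hi}_j=\tfrac12H_{(1)}^{hk}\Big(\frac{\partial G^{(1)}_{jk}}{\partial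 p_i}-G_{(2)}^{il}R^0_{ljk}\Big),\quad S_{hij}=-\tfrac12H^{(2)}_{hk}\frac{\partial G^{(1)}_{ij}}{\partial p_k}+\tfrac12R^0_{hij}.$$ (b) Suppose in addition that $(M,g)$ has constant sectional curvature $c>0$, let $A>0$ and let $\lambda$ be a smooth function on $(0,\infty)$ with $\lambda>0$, $2c-A^2t\lambda^2>0$ and $\lambda+2t\lambda'>0$ for all $t>0$, and take $$c_1=At\lambda^2,\quad c_2=\frac1{At},\quad d_1=\frac{c-A^2t\lambda^2}{At},\quad d_2=-\frac{c-A^2t[\lambda^2+2t\lambda'(\lambda+t\lambda')]}{At^2(2c-A^2t\lambda^2)} .$$ These functions satisfy the conditions imposed on $c_1,c_2,d_1,d_2$ above, and, with $\lambda,\lambda',\lambda''$ evaluated at $t$, $$\begin{aligned} Q^{ij}_h={}&\frac1{2t}g^{ij}p_h-\frac1{2t}(\delta^i_hg^{0j}+\delta^j_hg^{0i})+\frac{c\lambda+8ct\lambda'-2A^2t^2\lambda\lambda'(\lambda-t\lambda')+2t^2\lambda''(2c-A^2t\lambda^2)}{2t^2(2c-A^2t\lambda^2)(\lambda+2t\lambda')}g^{0i}g^{0j}p_h,\\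 P^{hi}_j={}&-\frac1{2t}g^{hi}p_j+\frac1{2t}\delta^i_jg^{0h}+\frac{\lambda+2t\lambda'}{2t\lambda}\delta^h_jg^{0i}-\frac{c(\lambda+2t\lambda')}{2t^2\lambda(2c-A^2t\lambda^2)}g^{0h}g^{0i}p_j,\\ S_{hij}={}&-\frac{\lambda(2c-A^2t\lambda^2)}{2(\lambda+2t\lambda')}g_{ij}p_h-\frac{2c-A^2t\lambda^2}{2}g_{hi}p_j+\frac{A^2t\lambda^2}{2}g_{hj}p_i+\frac{3c\lambda+2ct\lambda'-2A^2t\lambda^2(\lambda+t\lambda')}{2t(\lambda+2t\lambda')}p_hp_ip_j . \end{aligned}$$ -/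

import Mathlib

open Set Bundle Manifold
open scoped Manifold ContDiff Topology

noncomputable section

namespace CotangentLift

/-! ### Levi-Civita connections on an open subset of a manifold -/

/-- `IsLeviCivitaOn I s G nabla`: on the open subset `s` of the manifold `N`, `nabla` is a
connection on the tangent bundle which is torsion-free and for which the metric `G` is parallel.
Following the Mathlib convention, `nabla Y x (X x)` is the value of `∇_X Y` at `x`. -/
structure IsLeviCivitaOn {E : Type*} [NormedAddCommGroup E] [NormedSpace ℝ E]
    {H : Type*} [TopologicalSpace H] (I : ModelWithCorners ℝ E H)
    {N : Type*} [TopologicalSpace N] [ChartedSpace H N] [IsManifold I 1 N] (s : Set N)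
    (G : (x : N) → TangentSpace I x → TangentSpace I x → ℝ)
    (nabla : ((x : N) → TangentSpace I x) →
      ((x : N) → TangentSpace I x →L[ℝ] TangentSpace I x)) : Prop where
  isCovariantDerivativeOn :
    IsCovariantDerivativeOn (I := I) E (V := fun x : N => TangentSpace I x) nabla s
  torsion_free : ∀ (X Y : (x : N) → TangentSpace I x), ∀ x ∈ s,
    MDifferentiableAt I I.tangent (fun y => (⟨y, X y⟩ : TangentBundle I N)) x →
    MDifferentiableAt I I.tangent (fun y => (⟨y, Y y⟩ : TangentBundle I N)) x →
    nabla Y x (X x) - nabla X x (Y x) = VectorField.mlieBracket I X Y x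
  metric : ∀ (Y Z : (x : N) → TangentSpace I x), ∀ x ∈ s,
    MDifferentiableAt I I.tangent (fun y => (⟨y, Y y⟩ : TangentBundle I N)) x →
    MDifferentiableAt I I.tangent (fun y => (⟨y, Z y⟩ : TangentBundle I N)) x →
    ∀ v : TangentSpace I x,
      mfderiv I 𝓘(ℝ, ℝ) (fun y => G y (Y y) (Z y)) x v =
        G x (nabla Y x v) (Z x) + G x (Y x) (nabla Z x v)

/-! ### Local charts and the Riemannian metric of the base -/

/-- The model space of an `n`-dimensional manifold. -/
abbrev Coords (n : ℕ) : Type := EuclideanSpace ℝ (Fin n)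

/-- The coordinate space of the cotangent bundle: pairs `(q, p)`. -/
abbrev PhaseCoords (n : ℕ) : Type := Coords n × Coords n

/-- The `i`-th vector of the standard basis. -/
abbrev stdVec {n : ℕ} (i : Fin n) : Coords n := EuclideanSpace.single i (1 : ℝ)

/-- A local chart (the admissible ones are those in the maximal smooth atlas). -/
abbrev LocalChart (n : ℕ) (M : Type*) [TopologicalSpace M] : Type _ :=
  OpenPartialHomeomorph M (Coords n)

/-- The charts of the smooth structure of `M`. -/
abbrev smoothCharts (n : ℕ) (M : Type*) [TopologicalSpace M] [ChartedSpace (Coords n) M] :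
    Set (LocalChart n M) :=
  IsManifold.maximalAtlas (𝓡 n) ∞ M

/-- A smooth Riemannian metric on `M`. -/
abbrev RiemMetric (n : ℕ) (M : Type*) [TopologicalSpace M] [ChartedSpace (Coords n) M]
    [IsManifold (𝓡 n) ∞ M] : Type _ :=
  ContMDiffRiemannianMetric (𝓡 n) ∞ (Coords n) (fun x : M => TangentSpace (𝓡 n) x)

section Base

variable {n : ℕ} {M : Type*} [TopologicalSpace M] [ChartedSpace (Coords n) M]

/-- The coordinate vector field `∂/∂x^i` of the chart `φ`. -/
def coordVec (φ : LocalChart n M) (i : Fin n) (x : M) : TangentSpace (𝓡 n) x :=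
  VectorField.mpullback (𝓡 n) 𝓘(ℝ, Coords n) φ (fun _ => stdVec i) x

variable [IsManifold (𝓡 n) ∞ M]

/-- The components `g_{ij}` in the chart `φ`, as functions of the coordinates. -/
def gLow (g : RiemMetric n M) (φ : LocalChart n M) (i j : Fin n) (y : Coords n) : ℝ :=
  g.inner (φ.symm y) (coordVec φ i (φ.symm y)) (coordVec φ j (φ.symm y))

/-- The components `g^{ij}`: the entries of the inverse of the matrix `(g_{ij})`. -/
def gUp (g : RiemMetric n M) (φ : LocalChart n M) (i j : Fin n) (y : Coords n) : ℝ :=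
  (Matrix.of fun a b => gLow g φ a b y)⁻¹ i j

/-- The partial derivative `∂f/∂x^i` of a function of the coordinates. -/
def pderivX (i : Fin n) (f : Coords n → ℝ) (y : Coords n) : ℝ :=
  fderiv ℝ f y (stdVec i)

/-- The Christoffel symbol `Γ^k_{ij}` of `g` in the chart `φ`. -/
def christoffel (g : RiemMetric n M) (φ : LocalChart n M) (k i j : Fin n) (y : Coords n) : ℝ :=
  (1 / 2) * ∑ l, gUp g φ k l y *
    (pderivX i (gLow g φ j l) y + pderivX j (gLow g φ i l) y - pderivX l (gLow g φ i j) y)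

/-- The component `R^h_{kij}` of the curvature tensor of the Levi-Civita connection of `g`,
with the convention `R(∂_i, ∂_j) ∂_k = R^h_{kij} ∂_h`,
`R(X, Y) = [∇_X, ∇_Y] - ∇_{[X, Y]}`. -/
def curv (g : RiemMetric n M) (φ : LocalChart n M) (h k i j : Fin n) (y : Coords n) : ℝ :=
  pderivX i (christoffel g φ h j k) y - pderivX j (christoffel g φ h i k) y
    + ∑ l, (christoffel g φ h i l y * christoffel g φ l j k y
        - christoffel g φ h j l y * christoffel g φ l i k y)

/-- The sectional curvature of the plane spanned by the vectors with components `u`, `v`: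
`g(R(u, v) v, u) / (g(u, u) g(v, v) - g(u, v) ^ 2)`. -/
def sectionalCurv (g : RiemMetric n M) (φ : LocalChart n M) (y : Coords n) (u v : Fin n → ℝ) : ℝ :=
  (∑ h, ∑ k, ∑ i, ∑ j, ∑ l,
      gLow g φ h l y * curv g φ h k i j y * u i * v j * v k * u l) /
    ((∑ i, ∑ j, gLow g φ i j y * u i * u j) * (∑ i, ∑ j, gLow g φ i j y * v i * v j)
      - (∑ i, ∑ j, gLow g φ i j y * u i * v j) ^ 2)

/-- `(M, g)` has constant sectional curvature `c`. -/
def HasConstantSectionalCurvature (g : RiemMetric n M) (c : ℝ) : Prop :=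
  ∀ φ ∈ smoothCharts n M, ∀ y ∈ φ.target, ∀ u v : Fin n → ℝ,
    LinearIndependent ℝ ![u, v] → sectionalCurv g φ y u v = c

end Base

/-! ### The cotangent bundle and its induced charts -/

/-- The cotangent bundle `T*M`, with Mathlib's smooth structure (the bundle of continuous linear
maps from the tangent bundle to the trivial line bundle). -/
abbrev Cotangent (n : ℕ) (M : Type*) [TopologicalSpace M] [ChartedSpace (Coords n) M]
    [IsManifold (𝓡 n) ∞ M] : Type _ :=
  TotalSpace (Coords n →L[ℝ] ℝ)
    (fun x : M => TangentSpace (𝓡 n) x →L[ℝ] Bundle.Trivial M ℝ x)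

/-- The model with corners of `T*M`. -/
abbrev cotModel (n : ℕ) :
    ModelWithCorners ℝ (Coords n × (Coords n →L[ℝ] ℝ))
      (ModelProd (Coords n) (Coords n →L[ℝ] ℝ)) :=
  (𝓡 n).prod 𝓘(ℝ, Coords n →L[ℝ] ℝ)

section Cotangent

variable {n : ℕ} {M : Type*} [TopologicalSpace M] [ChartedSpace (Coords n) M]
  [IsManifold (𝓡 n) ∞ M]

/-- The nonzero cotangent bundle `T*₀M`, as an open subset of `T*M`. -/
def nonzeroCotangent (n : ℕ) (M : Type*) [TopologicalSpace M] [ChartedSpace (Coords n) M]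
    [IsManifold (𝓡 n) ∞ M] : Set (Cotangent n M) :=
  {ξ | ξ.snd ≠ 0}

/-- The chart `(q^1, …, q^n, p_1, …, p_n)` of `T*M` induced from the chart `φ` of `M`:
`q^i` is the `i`-th coordinate of the base point and `p_i` is the value of the
covector on `∂/∂x^i`. (Meaningful over the domain of `φ`.) -/
def inducedChart (φ : LocalChart n M) (ξ : Cotangent n M) : PhaseCoords n :=
  (φ ξ.proj, WithLp.toLp 2 fun i => (ξ.snd (coordVec φ i ξ.proj) : ℝ))

/-- The image of `T*₀M` in the induced chart. -/
def phaseDomain (φ : LocalChart n M) : Set (PhaseCoords n) :=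
  φ.target ×ˢ {p | p ≠ 0}

/-- The partial derivative `∂f/∂p_i` of a function of the coordinates `(q, p)`. -/
def pderivP (i : Fin n) (f : PhaseCoords n → ℝ) (z : PhaseCoords n) : ℝ :=
  fderiv ℝ f z (0, stdVec i)

/-- `g^{0i} = p_h g^{hi}`. -/
def gZero (g : RiemMetric n M) (φ : LocalChart n M) (i : Fin n) (z : PhaseCoords n) : ℝ :=
  ∑ h, z.2 h * gUp g φ h i z.1

/-- The energy density `t = (1/2) g^{ik} p_i p_k`. -/
def energy (g : RiemMetric n M) (φ : LocalChart n M) (z : PhaseCoords n) : ℝ :=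
  (1 / 2) * ∑ i, ∑ k, gUp g φ i k z.1 * z.2 i * z.2 k

/-- `Γ^0_{ih} = p_k Γ^k_{ih}`. -/
def christoffelZero (g : RiemMetric n M) (φ : LocalChart n M) (i h : Fin n)
    (z : PhaseCoords n) : ℝ :=
  ∑ k, z.2 k * christoffel g φ k i h z.1

/-- `R^0_{kij} = p_h R^h_{kij}`. -/
def curvZero (g : RiemMetric n M) (φ : LocalChart n M) (k i j : Fin n)
    (z : PhaseCoords n) : ℝ :=
  ∑ h, z.2 h * curv g φ h k i j z.1

/-- The vertical frame field `∂/∂p_i` of the induced chart. -/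
def frameP (φ : LocalChart n M) (i : Fin n) (ξ : Cotangent n M) : TangentSpace (cotModel n) ξ :=
  VectorField.mpullback (cotModel n) 𝓘(ℝ, PhaseCoords n) (inducedChart φ)
    (fun _ => ((0, stdVec i) : PhaseCoords n)) ξ

/-- The horizontal frame field `δ/δq^i = ∂/∂q^i + Γ^0_{ih} ∂/∂p_h`. -/
def frameQ (g : RiemMetric n M) (φ : LocalChart n M) (i : Fin n) (ξ : Cotangent n M) :
    TangentSpace (cotModel n) ξ :=
  VectorField.mpullback (cotModel n) 𝓘(ℝ, PhaseCoords n) (inducedChart φ)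
    (fun z => ((stdVec i, WithLp.toLp 2 fun h => christoffelZero g φ i h z) : PhaseCoords n)) ξ

/-! ### M-tensor fields -/

/-- The entry `∂y^i/∂x^a` at the point `x` of the Jacobian matrix of the change of
coordinates from `φ = (x^1, …, x^n)` to `ψ = (y^1, …, y^n)`. -/
def jacobian (φ ψ : LocalChart n M) (x : M) (i a : Fin n) : ℝ :=
  (fderiv ℝ (fun y => ψ (φ.symm y)) (φ x) (stdVec a)) i

/-- `IsMTensorField r s T`: the components `T φ I J` (upper indices `I`, lower indices `J`,
functions of the coordinates `(q, p)` of the chart induced from `φ`) are smooth and define an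
M-tensor field of type `(r, s)` on `T*₀M`: under a change of induced charts
they transform like the components of a tensor field of type `(r, s)` on `M`. -/
def IsMTensorField (r s : ℕ)
    (T : LocalChart n M → (Fin r → Fin n) → (Fin s → Fin n) → PhaseCoords n → ℝ) : Prop :=
  (∀ φ ∈ smoothCharts n M, ∀ I J, ContDiffOn ℝ ∞ (T φ I J) (phaseDomain φ)) ∧
  ∀ φ ∈ smoothCharts n M, ∀ ψ ∈ smoothCharts n M, ∀ ξ ∈ nonzeroCotangent n M,
    ξ.proj ∈ φ.source → ξ.proj ∈ ψ.source → ∀ I J,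
      T ψ I J (inducedChart ψ ξ) =
        ∑ I' : Fin r → Fin n, ∑ J' : Fin s → Fin n,
          (∏ a, jacobian φ ψ ξ.proj (I a) (I' a)) * (∏ b, jacobian ψ φ ξ.proj (J' b) (J b)) *
            T φ I' J' (inducedChart φ ξ)

/-! ### Natural metrics of diagonal type -/

/-- The conditions on the four parameters of a natural Riemannian metric of diagonal type:
they are smooth on `(0, ∞)` and the two blocks of the metric are positive definite. -/
structure IsMetricParam (c₁ c₂ d₁ d₂ : ℝ → ℝ) : Prop where
  smooth_c₁ : ContDiffOn ℝ ∞ c₁ (Ioi 0)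
  smooth_c₂ : ContDiffOn ℝ ∞ c₂ (Ioi 0)
  smooth_d₁ : ContDiffOn ℝ ∞ d₁ (Ioi 0)
  smooth_d₂ : ContDiffOn ℝ ∞ d₂ (Ioi 0)
  pos_c₁ : ∀ t > 0, 0 < c₁ t
  pos_c₂ : ∀ t > 0, 0 < c₂ t
  pos_d₁ : ∀ t > 0, 0 < c₁ t + 2 * t * d₁ t
  pos_d₂ : ∀ t > 0, 0 < c₂ t + 2 * t * d₂ t

/-- `G^{(1)}_{ij} = c₁(t) g_{ij} + d₁(t) p_i p_j`. -/
def G₁ (g : RiemMetric n M) (c₁ d₁ : ℝ → ℝ) (φ : LocalChart n M) (i j : Fin n)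
    (z : PhaseCoords n) : ℝ :=
  c₁ (energy g φ z) * gLow g φ i j z.1 + d₁ (energy g φ z) * z.2 i * z.2 j

/-- `G_{(2)}^{ij} = c₂(t) g^{ij} + d₂(t) g^{0i} g^{0j}`. -/
def G₂ (g : RiemMetric n M) (c₂ d₂ : ℝ → ℝ) (φ : LocalChart n M) (i j : Fin n)
    (z : PhaseCoords n) : ℝ :=
  c₂ (energy g φ z) * gUp g φ i j z.1 + d₂ (energy g φ z) * gZero g φ i z * gZero g φ j z

/-- `H_{(1)}^{jk}`, the entries of the inverse of the matrix `(G^{(1)}_{ij})`. -/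
def H₁ (g : RiemMetric n M) (c₁ d₁ : ℝ → ℝ) (φ : LocalChart n M) (j k : Fin n)
    (z : PhaseCoords n) : ℝ :=
  let t := energy g φ z
  1 / c₁ t * gUp g φ j k z.1
    - d₁ t / (c₁ t * (c₁ t + 2 * t * d₁ t)) * gZero g φ j z * gZero g φ k z

/-- `H^{(2)}_{jk}`, the entries of the inverse of the matrix `(G_{(2)}^{ij})`. -/
def H₂ (g : RiemMetric n M) (c₂ d₂ : ℝ → ℝ) (φ : LocalChart n M) (j k : Fin n)
    (z : PhaseCoords n) : ℝ :=
  let t := energy g φ z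
  1 / c₂ t * gLow g φ j k z.1
    - d₂ t / (c₂ t * (c₂ t + 2 * t * d₂ t)) * z.2 j * z.2 k

/-- The component `Dp_i(a) = dp_i(a) - Γ^0_{ij} dq^j(a)` of a tangent vector `a` at the point with
coordinates `z`. -/
def absDiffP (g : RiemMetric n M) (φ : LocalChart n M) (z a : PhaseCoords n) (i : Fin n) : ℝ :=
  a.2 i - ∑ j, christoffelZero g φ i j z * a.1 j

/-- The coordinate expression `G^{(1)}_{ij} dq^i dq^j + G_{(2)}^{ij} Dp_i Dp_j`. -/
def diagMetricCoord (g : RiemMetric n M) (c₁ c₂ d₁ d₂ : ℝ → ℝ) (φ : LocalChart n M)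
    (z a b : PhaseCoords n) : ℝ :=
  (∑ i, ∑ j, G₁ g c₁ d₁ φ i j z * a.1 i * b.1 j)
    + ∑ i, ∑ j, G₂ g c₂ d₂ φ i j z * absDiffP g φ z a i * absDiffP g φ z b j

/-- The natural metric of diagonal type
`G = G^{(1)}_{ij} dq^i dq^j + G_{(2)}^{ij} Dp_i Dp_j` on `T*₀M`. At each point, it is evaluated in
the chart induced from the preferred chart of `M` at the base point (the expression does not
depend on the chart). -/
def diagMetric (g : RiemMetric n M) (c₁ c₂ d₁ d₂ : ℝ → ℝ) (ξ : Cotangent n M)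
    (X Y : TangentSpace (cotModel n) ξ) : ℝ :=
  let φ : LocalChart n M := chartAt (Coords n) ξ.proj
  diagMetricCoord g c₁ c₂ d₁ d₂ φ (inducedChart φ ξ)
    (mfderiv (cotModel n) 𝓘(ℝ, PhaseCoords n) (inducedChart φ) ξ X)
    (mfderiv (cotModel n) 𝓘(ℝ, PhaseCoords n) (inducedChart φ) ξ Y)

/-! ### The fields `Q`, `P`, `S` -/

/-- `Q^{ij}_h = (1/2) H^{(2)}_{hk} (∂G_{(2)}^{jk}/∂p_i + ∂G_{(2)}^{ik}/∂p_j - ∂G_{(2)}^{ij}/∂p_k)`. -/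
def Qcoef (g : RiemMetric n M) (c₂ d₂ : ℝ → ℝ) (φ : LocalChart n M) (i j h : Fin n)
    (z : PhaseCoords n) : ℝ :=
  (1 / 2) * ∑ k, H₂ g c₂ d₂ φ h k z *
    (pderivP i (G₂ g c₂ d₂ φ j k) z + pderivP j (G₂ g c₂ d₂ φ i k) z
      - pderivP k (G₂ g c₂ d₂ φ i j) z)

/-- `P^{hi}_j = (1/2) H_{(1)}^{hk} (∂G^{(1)}_{jk}/∂p_i - G_{(2)}^{il} R^0_{ljk})`. -/
def Pcoef (g : RiemMetric n M) (c₁ c₂ d₁ d₂ : ℝ → ℝ) (φ : LocalChart n M) (h i j : Fin n)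
    (z : PhaseCoords n) : ℝ :=
  (1 / 2) * ∑ k, H₁ g c₁ d₁ φ h k z *
    (pderivP i (G₁ g c₁ d₁ φ j k) z - ∑ l, G₂ g c₂ d₂ φ i l z * curvZero g φ l j k z)

/-- `S_{hij} = -(1/2) H^{(2)}_{hk} ∂G^{(1)}_{ij}/∂p_k + (1/2) R^0_{hij}`. -/
def Scoef (g : RiemMetric n M) (c₁ c₂ d₁ d₂ : ℝ → ℝ) (φ : LocalChart n M) (h i j : Fin n)
    (z : PhaseCoords n) : ℝ :=
  -(1 / 2) * (∑ k, H₂ g c₂ d₂ φ h k z * pderivP k (G₁ g c₁ d₁ φ i j) z)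
    + (1 / 2) * curvZero g φ h i j z

end Cotangent

/-! ### The parameters of the Kähler metrics -/

/-- `c₁ = A t λ²`. -/
def kaehlerC₁ (A : ℝ) (lam : ℝ → ℝ) (t : ℝ) : ℝ := A * t * lam t ^ 2

/-- `c₂ = 1 / (A t)`. -/
def kaehlerC₂ (A : ℝ) (t : ℝ) : ℝ := 1 / (A * t)

/-- `d₁ = (c - A² t λ²) / (A t)`. -/
def kaehlerD₁ (A c : ℝ) (lam : ℝ → ℝ) (t : ℝ) : ℝ := (c - A ^ 2 * t * lam t ^ 2) / (A * t)

/-- `d₂ = -(c - A² t [λ² + 2 t λ' (λ + t λ')]) / (A t² (2 c - A² t λ²))`. -/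
def kaehlerD₂ (A c : ℝ) (lam : ℝ → ℝ) (t : ℝ) : ℝ :=
  -(c - A ^ 2 * t * (lam t ^ 2 + 2 * t * deriv lam t * (lam t + t * deriv lam t))) /
    (A * t ^ 2 * (2 * c - A ^ 2 * t * lam t ^ 2))

/-- The conditions on the parameter `λ` of the Kähler metrics. -/
structure IsKaehlerParam (A c : ℝ) (lam : ℝ → ℝ) : Prop where
  smooth : ContDiffOn ℝ ∞ lam (Ioi 0)
  pos_A : 0 < A
  pos_lam : ∀ t > 0, 0 < lam t
  pos_curv : ∀ t > 0, 0 < 2 * c - A ^ 2 * t * lam t ^ 2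
  pos_deriv : ∀ t > 0, 0 < lam t + 2 * t * deriv lam t

end CotangentLift

end

open CotangentLift

noncomputable section

namespace CotangentLift

set_option linter.unusedSectionVars false

section

variable {n : ℕ} {M : Type*} [TopologicalSpace M] [ChartedSpace (Coords n) M]

/-! ### Charts of the base, induced charts of the cotangent bundle, and lifted vector fields. -/

section Charts

variable [IsManifold (𝓡 n) ∞ M]

/-! All computations take place in the frame δ/δq^i, ∂/∂p_i, in which the Koszul formula
`IsLeviCivitaOn.koszul` collapses for three reasons. The frame is block-orthogonal for G.
Differentiation along δ/δq^k is covariant: it annihilates the energy t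
(`hasDirDeriv_energy_horizVec`) and treats g and p as parallel, so the derivatives of both blocks of
G along it consist of Christoffel terms only (`hasDirDeriv_G₁_horizVec`, `hasDirDeriv_G₂_horizVec`).
Finally, all brackets of frame fields are vertical: [∂/∂p_i, ∂/∂p_j] = 0, [∂/∂p_i, δ/δq^j] =
Γ^i_{jh} ∂/∂p_h, [δ/δq^i, δ/δq^j] = R^0_{hij} ∂/∂p_h (`lieBracket_horizVec`). The Christoffel terms
then cancel or combine into the Γ-terms of the connection, and only ∂G/∂p and the curvature remain.
Since `H₁` and `H₂` invert the two blocks (`G₁_mul_H₁`, `G₂_mul_H₂`), pairing with the frame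
determines the coefficients (`eq_frame_sum`).

The metric is defined through preferred charts, so its expression in every induced chart
(`diagMetric_eq`) has to be justified. This rests on the tensoriality of Dp_i
(`absDiffP_transform`), hence on the transformation law of the Christoffel symbols, which comes from
the uniqueness of the symmetric array for which g is parallel (`christoffel_eq_of_parallel`). That
Q, P, S are M-tensors follows termwise: ∂/∂p preserves M-tensors because Jacobians are constant
along fibres (`pderivP_transform`), and R^0 is one because the vertical part of the bracket of
horizontal fields is bilinear over functions on the base (`curvZero_transform`).

For constant curvature, the algebraic lemma `eq_zero_of_curvature_symmetries` gives R^0_{kij} = c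
(p_i g_{kj} - p_j g_{ki}) (`curvZero_of_constant`). The skew-symmetry it needs holds because fields
annihilating t have brackets annihilating t (`sum_curvZero_mul_gZero`). The contractions with `H₁`
and `H₂` are then explicit, and the identities `kaehlerC₁_add` and `kaehlerC₂_add` put every
denominator in closed form, which leaves rational identities in t, λ, λ', λ''. -/

theorem smoothChart_mdifferentiable {φ : LocalChart n M} (hφ : φ ∈ smoothCharts n M) :
    φ.MDifferentiable (𝓡 n) (𝓡 n) :=
  ⟨(contMDiffOn_of_mem_maximalAtlas hφ).mdifferentiableOn (by simp),
    (contMDiffOn_symm_of_mem_maximalAtlas hφ).mdifferentiableOn (by simp)⟩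

/-- The derivative of a chart, as a map into the coordinate space. -/
def chartDeriv (φ : LocalChart n M) (x : M) : TangentSpace (𝓡 n) x →L[ℝ] Coords n :=
  mfderiv (𝓡 n) 𝓘(ℝ, Coords n) φ x

theorem chartDeriv_isInvertible {φ : LocalChart n M} (hφ : φ ∈ smoothCharts n M)
    {x : M} (hx : x ∈ φ.source) : (chartDeriv φ x).IsInvertible :=
  ⟨(smoothChart_mdifferentiable hφ).mfderiv hx, rfl⟩

theorem coordVec_eq_inverse (φ : LocalChart n M) (i : Fin n) (x : M) :
    coordVec φ i x = (chartDeriv φ x).inverse (stdVec i) := rfl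

theorem chartDeriv_coordVec_self {φ : LocalChart n M} (hφ : φ ∈ smoothCharts n M)
    {x : M} (hx : x ∈ φ.source) (i : Fin n) :
    chartDeriv φ x (coordVec φ i x) = stdVec i := by
  rw [coordVec_eq_inverse]
  exact (chartDeriv_isInvertible hφ hx).self_apply_inverse _

theorem chartDeriv_injective {φ : LocalChart n M} (hφ : φ ∈ smoothCharts n M)
    {x : M} (hx : x ∈ φ.source) : Function.Injective (chartDeriv φ x) :=
  (smoothChart_mdifferentiable hφ).mfderiv_injective hx

theorem contMDiffAt_coordVec {φ : LocalChart n M} (hφ : φ ∈ smoothCharts n M)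
    {x : M} (hx : x ∈ φ.source) (i : Fin n) :
    ContMDiffAt (𝓡 n) (𝓡 n).tangent ∞
      (fun y => (⟨y, coordVec φ i y⟩ : TangentBundle (𝓡 n) M)) x := by
  refine ContMDiffAt.mpullback_vectorField_preimage (n := ∞) (m := ∞) (f := φ)
    (V := fun _ => stdVec i) ?_ (contMDiffAt_of_mem_maximalAtlas hφ hx)
    (chartDeriv_isInvertible hφ hx) (by simp)
  exact contMDiffAt_vectorSpace_iff_contDiffAt.2 contDiffAt_const

theorem stdVec_apply (i j : Fin n) : (stdVec i : Coords n) j = if j = i then 1 else 0 := by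
  simp

theorem sum_smul_stdVec (v : Coords n) : ∑ i, v i • (stdVec i : Coords n) = v := by
  ext j
  simp only [WithLp.ofLp_sum, Finset.sum_apply, WithLp.ofLp_smul, Pi.smul_apply, stdVec_apply]
  simp

theorem coords_sum_apply {ι : Type*} (s : Finset ι) (f : ι → Coords n) (i : Fin n) :
    (∑ a ∈ s, f a) i = ∑ a ∈ s, f a i := by
  simp [WithLp.ofLp_sum, Finset.sum_apply]

/-- Chain rule for ψ = (ψ ∘ φ⁻¹) ∘ φ near x, applied to ∂/∂x^a, whose image under dφ is a standard
basis vector. -/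
theorem chartDeriv_coordVec {φ ψ : LocalChart n M} (hφ : φ ∈ smoothCharts n M)
    (hψ : ψ ∈ smoothCharts n M) {x : M} (hφx : x ∈ φ.source) (hψx : x ∈ ψ.source) (a : Fin n) :
    chartDeriv ψ x (coordVec φ a x) = fderiv ℝ (fun y => ψ (φ.symm y)) (φ x) (stdVec a) := by
  have h1 : HasMFDerivAt (𝓡 n) 𝓘(ℝ, Coords n) ((ψ ∘ φ.symm) ∘ φ) x
      ((fderiv ℝ (ψ ∘ φ.symm) (φ x)).comp (chartDeriv φ x)) := by
    have h2 : MDifferentiableAt 𝓘(ℝ, Coords n) 𝓘(ℝ, Coords n) (ψ ∘ φ.symm) (φ x) := by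
      refine MDifferentiableAt.comp (I' := 𝓡 n) _ ?_
        ((smoothChart_mdifferentiable hφ).mdifferentiableAt_symm (φ.map_source hφx))
      rw [φ.left_inv hφx]
      exact (smoothChart_mdifferentiable hψ).mdifferentiableAt hψx
    exact h2.differentiableAt.hasFDerivAt.hasMFDerivAt.comp x
      ((smoothChart_mdifferentiable hφ).mdifferentiableAt hφx).hasMFDerivAt
  have h3 : HasMFDerivAt (𝓡 n) 𝓘(ℝ, Coords n) ((ψ ∘ φ.symm) ∘ φ) x (chartDeriv ψ x) := by
    refine HasMFDerivAt.congr_of_eventuallyEq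
      ((smoothChart_mdifferentiable hψ).mdifferentiableAt hψx).hasMFDerivAt ?_
    filter_upwards [φ.open_source.mem_nhds hφx] with y hy
    simp [φ.left_inv hy]
  rw [hasMFDerivAt_unique h3 h1]
  have h4 := chartDeriv_coordVec_self hφ hφx a
  exact congrArg (fderiv ℝ (ψ ∘ φ.symm) (φ x)) h4

theorem chartDeriv_coordVec_apply {φ ψ : LocalChart n M} (hφ : φ ∈ smoothCharts n M)
    (hψ : ψ ∈ smoothCharts n M) {x : M} (hφx : x ∈ φ.source) (hψx : x ∈ ψ.source) (i a : Fin n) :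
    chartDeriv ψ x (coordVec φ a x) i = jacobian φ ψ x i a := by
  rw [chartDeriv_coordVec hφ hψ hφx hψx]; rfl

theorem sum_smul_coordVec {φ : LocalChart n M} (hφ : φ ∈ smoothCharts n M)
    {x : M} (hφx : x ∈ φ.source) (v : TangentSpace (𝓡 n) x) :
    v = ∑ a, chartDeriv φ x v a • coordVec φ a x := by
  apply chartDeriv_injective hφ hφx
  rw [map_sum]
  simp only [map_smul, chartDeriv_coordVec_self hφ hφx]
  exact (sum_smul_stdVec _).symm

theorem coordVec_eq_sum {φ ψ : LocalChart n M} (hφ : φ ∈ smoothCharts n M)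
    (hψ : ψ ∈ smoothCharts n M) {x : M} (hφx : x ∈ φ.source) (hψx : x ∈ ψ.source) (i : Fin n) :
    coordVec ψ i x = ∑ a, jacobian ψ φ x a i • coordVec φ a x := by
  conv_lhs => rw [sum_smul_coordVec hφ hφx (coordVec ψ i x)]
  simp only [chartDeriv_coordVec_apply hψ hφ hψx hφx]

theorem sum_jacobian_mul_jacobian {φ ψ : LocalChart n M} (hφ : φ ∈ smoothCharts n M)
    (hψ : ψ ∈ smoothCharts n M) {x : M} (hφx : x ∈ φ.source) (hψx : x ∈ ψ.source) (i j : Fin n) :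
    ∑ a, jacobian φ ψ x i a * jacobian ψ φ x a j = if i = j then 1 else 0 := by
  have h := congrArg (fun v => chartDeriv ψ x v i) (coordVec_eq_sum hφ hψ hφx hψx j)
  simp only [map_sum, map_smul, chartDeriv_coordVec_self hψ hψx, coords_sum_apply,
    PiLp.smul_apply, chartDeriv_coordVec_apply hφ hψ hφx hψx, stdVec_apply, smul_eq_mul] at h
  rw [h]
  exact Finset.sum_congr rfl fun a _ => mul_comm _ _

/-- The function pairs two sections over the projection: the tautological one, which as a map of
total spaces is the identity, and the pulled-back coordinate field. The bundle pairing is smooth. -/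
theorem contMDiffAt_coordSection_apply {φ : LocalChart n M} (hφ : φ ∈ smoothCharts n M)
    {ξ : Cotangent n M} (hx : ξ.proj ∈ φ.source) (i : Fin n) :
    ContMDiffAt (cotModel n) 𝓘(ℝ, ℝ) ∞
      (fun η : Cotangent n M => (η.snd (coordVec φ i η.proj) : ℝ)) ξ := by
  have h1 : ContMDiffAt (cotModel n) ((𝓡 n).prod 𝓘(ℝ, Coords n →L[ℝ] ℝ)) ∞
      (fun η : Cotangent n M => TotalSpace.mk' (Coords n →L[ℝ] ℝ)
        (E := fun x : M => TangentSpace (𝓡 n) x →L[ℝ] Bundle.Trivial M ℝ x) η.proj η.snd) ξ :=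
    contMDiffAt_id
  have h2 : ContMDiffAt (cotModel n) ((𝓡 n).prod 𝓘(ℝ, Coords n)) ∞
      (fun η : Cotangent n M => TotalSpace.mk' (Coords n)
        (E := fun x : M => TangentSpace (𝓡 n) x) η.proj (coordVec φ i η.proj)) ξ := by
    exact ContMDiffAt.comp ξ (contMDiffAt_coordVec hφ hx i) (Bundle.contMDiffAt_proj _)
  have h3 := ContMDiffAt.clm_bundle_apply h1 h2
  exact (contMDiffAt_totalSpace.1 h3).2

theorem contMDiffAt_inducedChart {φ : LocalChart n M} (hφ : φ ∈ smoothCharts n M)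
    {ξ : Cotangent n M} (hx : ξ.proj ∈ φ.source) :
    ContMDiffAt (cotModel n) 𝓘(ℝ, PhaseCoords n) ∞ (inducedChart φ) ξ := by
  have h1 : ContMDiffAt (cotModel n) 𝓘(ℝ, Coords n) ∞ (fun η : Cotangent n M => φ η.proj) ξ :=
    ContMDiffAt.comp ξ (contMDiffAt_of_mem_maximalAtlas hφ hx) (Bundle.contMDiffAt_proj _)
  have h2 : ContMDiffAt (cotModel n) 𝓘(ℝ, Coords n) ∞ (fun η : Cotangent n M =>
      ∑ i, (η.snd (coordVec φ i η.proj) : ℝ) • (stdVec i : Coords n)) ξ := by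
    apply contMDiffAt_finsetSum
    intro i _
    exact (contMDiffAt_coordSection_apply hφ hx i).smul contMDiffAt_const
  refine (h1.prodMk_space h2).congr_of_eventuallyEq (Filter.Eventually.of_forall fun η => ?_)
  simp only [inducedChart]
  congr 1
  exact (sum_smul_stdVec (WithLp.toLp 2 fun i => (η.snd (coordVec φ i η.proj) : ℝ))).symm

/-- The covector `dx^i` of a chart. -/
def coordForm (φ : LocalChart n M) (i : Fin n) (x : M) :
    TangentSpace (𝓡 n) x →L[ℝ] Bundle.Trivial M ℝ x :=
  (EuclideanSpace.proj i : Coords n →L[ℝ] ℝ).comp (chartDeriv φ x)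

/-- The inverse of the chart induced from `φ`. -/
def inducedChartSymm (φ : LocalChart n M) (z : PhaseCoords n) : Cotangent n M :=
  ⟨φ.symm z.1, ∑ i, z.2 i • coordForm φ i (φ.symm z.1)⟩

theorem coordForm_coordVec {φ : LocalChart n M} (hφ : φ ∈ smoothCharts n M)
    {x : M} (hx : x ∈ φ.source) (i j : Fin n) :
    (coordForm φ i x (coordVec φ j x) : ℝ) = if i = j then 1 else 0 := by
  have : (coordForm φ i x (coordVec φ j x) : ℝ) = chartDeriv φ x (coordVec φ j x) i := rfl
  rw [this, chartDeriv_coordVec_self hφ hx, stdVec_apply]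

theorem inducedChart_inducedChartSymm {φ : LocalChart n M} (hφ : φ ∈ smoothCharts n M)
    {z : PhaseCoords n} (hz : z.1 ∈ φ.target) :
    inducedChart φ (inducedChartSymm φ z) = z := by
  ext i
  · simp [inducedChart, inducedChartSymm, φ.right_inv hz]
  · have h : ((∑ a, z.2 a • coordForm φ a (φ.symm z.1)) (coordVec φ i (φ.symm z.1)) : ℝ)
        = ∑ a, z.2 a * (coordForm φ a (φ.symm z.1) (coordVec φ i (φ.symm z.1)) : ℝ) := by
      rw [sum_apply]; rfl
    refine Eq.trans h ?_
    simp [coordForm_coordVec hφ (φ.map_target hz)]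

theorem inducedChartSymm_inducedChart {φ : LocalChart n M} (hφ : φ ∈ smoothCharts n M)
    {ξ : Cotangent n M} (hx : ξ.proj ∈ φ.source) :
    inducedChartSymm φ (inducedChart φ ξ) = ξ := by
  obtain ⟨x, w⟩ := ξ
  simp only [inducedChart, inducedChartSymm]
  -- The base point φ⁻¹(φ x) equals x only propositionally; generalising it to a variable lets
  -- `rintro y rfl` remove the dependent-type mismatch in the fibre.
  have h : ∀ y : M, y = x → (⟨y, ∑ i, (w (coordVec φ i x) : ℝ) • coordForm φ i y⟩ : Cotangent n M)
      = ⟨x, w⟩ := by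
    rintro y rfl
    congr 1
    ext v
    have h1 : w v = w (∑ a, chartDeriv φ y v a • coordVec φ a y) := by
      conv_lhs => rw [sum_smul_coordVec hφ hx v]
    rw [h1, map_sum, sum_apply]
    refine Finset.sum_congr rfl fun a _ => ?_
    rw [map_smul]
    exact mul_comm _ _
  exact h _ (φ.left_inv hx)

/-- In local trivialisations dx^i is the i-th coordinate functional composed with the derivative of
the chart in tangent coordinates, and the latter depends smoothly on the point. -/
theorem contMDiffAt_coordForm {φ : LocalChart n M} (hφ : φ ∈ smoothCharts n M)
    {x : M} (hx : x ∈ φ.source) (i : Fin n) :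
    ContMDiffAt (𝓡 n) (cotModel n) ∞
      (fun y => (⟨y, coordForm φ i y⟩ : Cotangent n M)) x := by
  rw [contMDiffAt_hom_bundle]
  refine ⟨contMDiffAt_id, ?_⟩
  have h1 := ContMDiffAt.mfderiv_const (m := ∞) (contMDiffAt_of_mem_maximalAtlas hφ hx) (by simp)
  have h2 : ContMDiffAt (𝓡 n) 𝓘(ℝ, Coords n →L[ℝ] ℝ) ∞ 
    (fun y => (EuclideanSpace.proj i : Coords n →L[ℝ] ℝ).comp (inTangentCoordinates (𝓡 n) 𝓘(ℝ, Coords n) id φ (mfderiv (𝓡 n) (𝓡 n) φ) x y)) x :=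
    contMDiffAt_const.clm_comp h1
  refine h2.congr_of_eventuallyEq (Filter.Eventually.of_forall fun y => ?_)
  ext v
  simp [ContinuousLinearMap.inCoordinates, inTangentCoordinates, coordForm, chartDeriv]
  rfl

theorem contMDiffAt_inducedChartSymm {φ : LocalChart n M} (hφ : φ ∈ smoothCharts n M)
    {z : PhaseCoords n} (hz : z.1 ∈ φ.target) :
    ContMDiffAt 𝓘(ℝ, PhaseCoords n) (cotModel n) ∞ (inducedChartSymm φ) z := by
  rw [contMDiffAt_hom_bundle]
  have h0 : ContMDiffAt 𝓘(ℝ, PhaseCoords n) (𝓡 n) ∞ (fun z : PhaseCoords n => φ.symm z.1) z :=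
    ContMDiffAt.comp z (contMDiffAt_symm_of_mem_maximalAtlas hφ hz) contDiffAt_fst.contMDiffAt
  refine ⟨h0, ?_⟩
  have h1 : ∀ i, ContMDiffAt 𝓘(ℝ, PhaseCoords n) (cotModel n) ∞ (fun z : PhaseCoords n => 
     (⟨φ.symm z.1, coordForm φ i (φ.symm z.1)⟩ : Cotangent n M)) z := fun i => 
     ContMDiffAt.comp z (contMDiffAt_coordForm hφ (φ.map_target hz) i) h0
  have h2 := fun i => ((contMDiffAt_hom_bundle _).1 (h1 i)).2
  have h3 : ∀ i, ContMDiffAt 𝓘(ℝ, PhaseCoords n) 𝓘(ℝ, ℝ) ∞ (fun z : PhaseCoords n => z.2 i) z := by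
    intro i
    apply ContDiffAt.contMDiffAt
    fun_prop
  have h4 := contMDiffAt_finsetSum (t := Finset.univ) (fun i _ => (h3 i).smul (h2 i))
  refine h4.congr_of_eventuallyEq (Filter.Eventually.of_forall fun y => ?_)
  simp [ContinuousLinearMap.inCoordinates, inducedChartSymm]
  ext v
  simp only [ContinuousLinearMap.comp_apply, sum_apply]
  rfl

/-- The derivative of an induced chart, as a map into the coordinate space. -/
def phaseDeriv (φ : LocalChart n M) (ξ : Cotangent n M) :
    TangentSpace (cotModel n) ξ →L[ℝ] PhaseCoords n :=
  mfderiv (cotModel n) 𝓘(ℝ, PhaseCoords n) (inducedChart φ) ξ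

theorem hasMFDerivAt_inducedChart {φ : LocalChart n M} (hφ : φ ∈ smoothCharts n M)
    {ξ : Cotangent n M} (hx : ξ.proj ∈ φ.source) :
    HasMFDerivAt (cotModel n) 𝓘(ℝ, PhaseCoords n) (inducedChart φ) ξ (phaseDeriv φ ξ) :=
  ((contMDiffAt_inducedChart hφ hx).mdifferentiableAt (by simp)).hasMFDerivAt

theorem proj_mem_nhds {φ : LocalChart n M} {ξ : Cotangent n M} (hx : ξ.proj ∈ φ.source) :
    ∀ᶠ η in 𝓝 ξ, η.proj ∈ φ.source :=
  (FiberBundle.continuous_proj (Coords n →L[ℝ] ℝ)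
    (fun x : M => TangentSpace (𝓡 n) x →L[ℝ] Bundle.Trivial M ℝ x)).continuousAt.eventually_mem
    (φ.open_source.mem_nhds hx)

theorem isOpen_prod_target (φ : LocalChart n M) :
    IsOpen {z : PhaseCoords n | z.1 ∈ φ.target} :=
  φ.open_target.preimage continuous_fst

/-- Differentiating the two local inverse identities between the induced chart and
`inducedChartSymm` produces a two-sided inverse of the derivative. -/
theorem phaseDeriv_isInvertible {φ : LocalChart n M} (hφ : φ ∈ smoothCharts n M)
    {ξ : Cotangent n M} (hx : ξ.proj ∈ φ.source) : (phaseDeriv φ ξ).IsInvertible := by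
  have hz : (inducedChart φ ξ).1 ∈ φ.target := φ.map_source hx
  have hd := ((contMDiffAt_inducedChartSymm hφ hz).mdifferentiableAt (by simp)).hasMFDerivAt
  have h1 := hd.comp ξ (hasMFDerivAt_inducedChart hφ hx)
  have h2 := HasMFDerivAt.congr_of_eventuallyEq h1 (f₁ := id) (by
    filter_upwards [proj_mem_nhds hx] with η hη
    exact (inducedChartSymm_inducedChart hφ hη).symm)
  have e2 := hasMFDerivAt_unique h2 (hasMFDerivAt_id ξ)
  have h3 := HasMFDerivAt.comp (g := inducedChart φ) (f := inducedChartSymm φ) (inducedChart φ ξ)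
    (g' := phaseDeriv φ ξ)
    (by rw [inducedChartSymm_inducedChart hφ hx]; exact hasMFDerivAt_inducedChart hφ hx) hd
  have h4 := HasMFDerivAt.congr_of_eventuallyEq h3 (f₁ := id) (by
    filter_upwards [(isOpen_prod_target φ).mem_nhds hz] with z hz
    exact (inducedChart_inducedChartSymm hφ hz).symm)
  have e4 := hasMFDerivAt_unique h4 (hasMFDerivAt_id _)
  exact ContinuousLinearMap.IsInvertible.of_inverse e4 e2

theorem phaseDeriv_injective {φ : LocalChart n M} (hφ : φ ∈ smoothCharts n M)
    {ξ : Cotangent n M} (hx : ξ.proj ∈ φ.source) : Function.Injective (phaseDeriv φ ξ) := by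
  obtain ⟨e, he⟩ := phaseDeriv_isInvertible hφ hx
  rw [← he]
  exact e.injective

/-- The pull-back to the cotangent bundle of a vector field on the coordinate space. -/
def liftField (φ : LocalChart n M) (V : PhaseCoords n → PhaseCoords n) (ξ : Cotangent n M) :
    TangentSpace (cotModel n) ξ :=
  VectorField.mpullback (cotModel n) 𝓘(ℝ, PhaseCoords n) (inducedChart φ) V ξ

theorem phaseDeriv_liftField {φ : LocalChart n M} (hφ : φ ∈ smoothCharts n M)
    {ξ : Cotangent n M} (hx : ξ.proj ∈ φ.source) (V : PhaseCoords n → PhaseCoords n) :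
    phaseDeriv φ ξ (liftField φ V ξ) = V (inducedChart φ ξ) :=
  (phaseDeriv_isInvertible hφ hx).self_apply_inverse _

theorem mdifferentiableAt_liftField {φ : LocalChart n M} (hφ : φ ∈ smoothCharts n M)
    {ξ : Cotangent n M} (hx : ξ.proj ∈ φ.source) {V : PhaseCoords n → PhaseCoords n}
    (hV : ContDiffAt ℝ 1 V (inducedChart φ ξ)) :
    MDifferentiableAt (cotModel n) (cotModel n).tangent
      (fun η => (⟨η, liftField φ V η⟩ : TangentBundle (cotModel n) (Cotangent n M))) ξ := by
  have h1 := (contMDiffAt_vectorSpace_iff_contDiffAt (n := 1) (V := V)).2 hV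
  exact (h1.mdifferentiableAt one_ne_zero).mpullback_vectorField
    (contMDiffAt_inducedChart hφ hx) (phaseDeriv_isInvertible hφ hx) ENat.LEInfty.out

theorem mlieBracket_eq_lieBracket {E : Type*} [NormedAddCommGroup E] [NormedSpace ℝ E]
    (V W : (x : E) → TangentSpace 𝓘(ℝ, E) x) :
    VectorField.mlieBracket 𝓘(ℝ, E) V W = VectorField.lieBracket ℝ (E := E) V W := by
  rw [← VectorField.mlieBracketWithin_univ, VectorField.mlieBracketWithin_eq_lieBracketWithin]
  exact VectorField.lieBracketWithin_univ

/-- Pull-back commutes with brackets, so brackets of lifted fields reduce to the flat formula DW(V)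
- DV(W). Both `frameP` and `frameQ` are lifts of this kind by definition. -/
theorem mlieBracket_liftField {φ : LocalChart n M} (hφ : φ ∈ smoothCharts n M)
    {ξ : Cotangent n M} (hx : ξ.proj ∈ φ.source) {V W : PhaseCoords n → PhaseCoords n}
    (hV : ContDiffAt ℝ 1 V (inducedChart φ ξ)) (hW : ContDiffAt ℝ 1 W (inducedChart φ ξ)) :
    phaseDeriv φ ξ (VectorField.mlieBracket (cotModel n) (liftField φ V) (liftField φ W) ξ) =
      fderiv ℝ W (inducedChart φ ξ) (V (inducedChart φ ξ))
        - fderiv ℝ V (inducedChart φ ξ) (W (inducedChart φ ξ)) := by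
  have h1 := (contMDiffAt_vectorSpace_iff_contDiffAt (n := 1) (V := V)).2 hV
  have h2 := (contMDiffAt_vectorSpace_iff_contDiffAt (n := 1) (V := W)).2 hW
  have : IsManifold (cotModel n) (minSmoothness ℝ 2) (Cotangent n M) := by
    rw [minSmoothness_of_isRCLikeNormedField]
    infer_instance
  have h3 := VectorField.mpullback_mlieBracket (h1.mdifferentiableAt one_ne_zero)
    (h2.mdifferentiableAt one_ne_zero) (contMDiffAt_inducedChart hφ hx)
    (by rw [minSmoothness_of_isRCLikeNormedField]; exact ENat.LEInfty.out)
  have h4 := phaseDeriv_liftField hφ hx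
    (VectorField.mlieBracket 𝓘(ℝ, PhaseCoords n) V W)
  refine (congrArg (phaseDeriv φ ξ) h3.symm).trans (h4.trans ?_)
  exact congrFun (mlieBracket_eq_lieBracket V W) _

theorem mfderiv_comp_inducedChart {φ : LocalChart n M} (hφ : φ ∈ smoothCharts n M)
    {ξ : Cotangent n M} (hx : ξ.proj ∈ φ.source) {f : PhaseCoords n → ℝ}
    (hf : DifferentiableAt ℝ f (inducedChart φ ξ)) {F : Cotangent n M → ℝ}
    (hF : F =ᶠ[𝓝 ξ] fun η => f (inducedChart φ η)) (v : TangentSpace (cotModel n) ξ) :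
    mfderiv (cotModel n) 𝓘(ℝ, ℝ) F ξ v = fderiv ℝ f (inducedChart φ ξ) (phaseDeriv φ ξ v) := by
  have h := (hf.hasFDerivAt.hasMFDerivAt.comp ξ
    (hasMFDerivAt_inducedChart hφ hx)).congr_of_eventuallyEq hF
  rw [h.mfderiv]
  rfl

end Charts

end

section

variable {n : ℕ} {M : Type*} [TopologicalSpace M] [ChartedSpace (Coords n) M]

/-! ### The base metric in coordinates: inverse matrix, smoothness, Christoffel symbols. -/

section BaseMetric

variable [IsManifold (𝓡 n) ∞ M]

theorem gLow_symm (g : RiemMetric n M) (φ : LocalChart n M) (i j : Fin n) (y : Coords n) :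
    gLow g φ i j y = gLow g φ j i y :=
  g.symm _ _ _

theorem contDiffAt_gLow (g : RiemMetric n M) {φ : LocalChart n M} (hφ : φ ∈ smoothCharts n M)
    {y : Coords n} (hy : y ∈ φ.target) (i j : Fin n) : ContDiffAt ℝ ∞ (gLow g φ i j) y := by
  have hx := φ.map_target hy
  have h1 := ContMDiffAt.clm_bundle_apply₂ (F₃ := ℝ) (E₃ := Bundle.Trivial M ℝ)
    (b := fun x : M => x) (ψ := g.inner) g.contMDiff.contMDiffAt
    (contMDiffAt_coordVec hφ hx i) (contMDiffAt_coordVec hφ hx j)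
  have h2 := (contMDiffAt_totalSpace.1 h1).2
  exact (ContMDiffAt.comp y h2 (contMDiffAt_symm_of_mem_maximalAtlas hφ hy)).contDiffAt

theorem inner_eq_sum_gLow (g : RiemMetric n M) (φ : LocalChart n M) (y : Coords n)
    (u v : Fin n → ℝ) :
    g.inner (φ.symm y) (∑ i, u i • coordVec φ i (φ.symm y)) (∑ j, v j • coordVec φ j (φ.symm y)) =
      ∑ i, ∑ j, gLow g φ i j y * u i * v j := by
  rw [map_sum (g.inner (φ.symm y)), sum_apply]
  refine Finset.sum_congr rfl fun i _ => ?_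
  rw [map_sum]
  refine Finset.sum_congr rfl fun j _ => ?_
  rw [map_smul, map_smul]
  change v j * (u i * gLow g φ i j y) = _
  ring

theorem gLow_posDef (g : RiemMetric n M) {φ : LocalChart n M} (hφ : φ ∈ smoothCharts n M)
    {y : Coords n} (hy : y ∈ φ.target) {v : Fin n → ℝ} (hv : v ≠ 0) :
    0 < ∑ i, ∑ j, gLow g φ i j y * v i * v j := by
  rw [← inner_eq_sum_gLow]
  apply g.pos
  intro h
  apply hv
  have h2 := congrArg (chartDeriv φ (φ.symm y)) h
  rw [map_sum, map_zero] at h2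
  simp only [map_smul, chartDeriv_coordVec_self hφ (φ.map_target hy)] at h2
  have h3 := sum_smul_stdVec (WithLp.toLp 2 v)
  funext i
  exact congrFun (congrArg WithLp.ofLp (h3.symm.trans h2)) i

/-- The matrix `(g_{ij})`. -/
def gMat (g : RiemMetric n M) (φ : LocalChart n M) (y : Coords n) : Matrix (Fin n) (Fin n) ℝ :=
  Matrix.of fun a b => gLow g φ a b y

/-- A nonzero kernel vector would be a null vector of a positive definite form. -/
theorem isUnit_det_gMat (g : RiemMetric n M) {φ : LocalChart n M} (hφ : φ ∈ smoothCharts n M)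
    {y : Coords n} (hy : y ∈ φ.target) : IsUnit (gMat g φ y).det := by
  rw [isUnit_iff_ne_zero]
  intro h
  obtain ⟨v, hv, h0⟩ := Matrix.exists_mulVec_eq_zero_iff.2 h
  have h1 := gLow_posDef g hφ hy hv
  have h2 : ∑ i, ∑ j, gLow g φ i j y * v i * v j = ∑ i, v i * (gMat g φ y).mulVec v i := by
    refine Finset.sum_congr rfl fun i _ => ?_
    rw [Matrix.mulVec, dotProduct, Finset.mul_sum]
    exact Finset.sum_congr rfl fun j _ => by rw [gMat, Matrix.of_apply]; ring
  rw [h2, h0] at h1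
  simp at h1

theorem gUp_mul_gLow (g : RiemMetric n M) {φ : LocalChart n M} (hφ : φ ∈ smoothCharts n M)
    {y : Coords n} (hy : y ∈ φ.target) (i j : Fin n) :
    ∑ k, gUp g φ i k y * gLow g φ k j y = if i = j then 1 else 0 := by
  have h := congrFun (congrFun (Matrix.nonsing_inv_mul _ (isUnit_det_gMat g hφ hy)) i) j
  rw [Matrix.mul_apply, Matrix.one_apply] at h
  exact h

theorem gLow_mul_gUp (g : RiemMetric n M) {φ : LocalChart n M} (hφ : φ ∈ smoothCharts n M)
    {y : Coords n} (hy : y ∈ φ.target) (i j : Fin n) :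
    ∑ k, gLow g φ i k y * gUp g φ k j y = if i = j then 1 else 0 := by
  have h := congrFun (congrFun (Matrix.mul_nonsing_inv _ (isUnit_det_gMat g hφ hy)) i) j
  rw [Matrix.mul_apply, Matrix.one_apply] at h
  exact h

theorem gUp_symm (g : RiemMetric n M) (φ : LocalChart n M) (i j : Fin n) (y : Coords n) :
    gUp g φ i j y = gUp g φ j i y := by
  have h : (gMat g φ y).transpose = gMat g φ y := by
    ext a b
    exact gLow_symm g φ b a y
  have h2 := Matrix.transpose_nonsing_inv (gMat g φ y)
  rw [h] at h2
  exact congrFun (congrFun h2 j) i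

theorem contDiffAt_matrix_det {E : Type*} [NormedAddCommGroup E] [NormedSpace ℝ E]
    {A : E → Matrix (Fin n) (Fin n) ℝ} {y : E} {k : WithTop ℕ∞}
    (hA : ∀ i j, ContDiffAt ℝ k (fun y => A y i j) y) :
    ContDiffAt ℝ k (fun y => (A y).det) y := by
  simp only [Matrix.det_apply]
  refine ContDiffAt.sum fun σ _ => ?_
  exact (contDiffAt_prod fun i _ => hA _ _).const_smul _

/-- Cramer's rule: each entry of the inverse is a quotient of determinants, and these are polynomial
in the entries. -/
theorem contDiffAt_matrix_inv {E : Type*} [NormedAddCommGroup E] [NormedSpace ℝ E]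
    {A : E → Matrix (Fin n) (Fin n) ℝ} {y : E} {k : WithTop ℕ∞}
    (hA : ∀ i j, ContDiffAt ℝ k (fun y => A y i j) y) (hy : IsUnit (A y).det) (i j : Fin n) :
    ContDiffAt ℝ k (fun y => (A y)⁻¹ i j) y := by
  simp only [Matrix.inv_def, Ring.inverse_eq_inv', Matrix.smul_apply, smul_eq_mul,
    Matrix.adjugate_apply]
  refine ((contDiffAt_matrix_det hA).inv hy.ne_zero).mul (contDiffAt_matrix_det fun a b => ?_)
  simp only [Matrix.updateRow_apply]
  split_ifs
  · exact contDiffAt_const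
  · exact hA a b

theorem contDiffAt_gUp (g : RiemMetric n M) {φ : LocalChart n M} (hφ : φ ∈ smoothCharts n M)
    {y : Coords n} (hy : y ∈ φ.target) (i j : Fin n) : ContDiffAt ℝ ∞ (gUp g φ i j) y :=
  contDiffAt_matrix_inv (A := gMat g φ) (fun a b => contDiffAt_gLow g hφ hy a b)
    (isUnit_det_gMat g hφ hy) i j

theorem contDiffAt_pderivX {f : Coords n → ℝ} {y : Coords n} (hf : ContDiffAt ℝ ∞ f y)
    (i : Fin n) : ContDiffAt ℝ ∞ (pderivX i f) y :=
  (hf.fderiv_right (m := ∞) (by simp)).clm_apply contDiffAt_const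

theorem contDiffAt_christoffel (g : RiemMetric n M) {φ : LocalChart n M}
    (hφ : φ ∈ smoothCharts n M) {y : Coords n} (hy : y ∈ φ.target) (k i j : Fin n) :
    ContDiffAt ℝ ∞ (christoffel g φ k i j) y := by
  have h := fun i a b => contDiffAt_pderivX (contDiffAt_gLow g hφ hy a b) i
  exact contDiffAt_const.mul (ContDiffAt.sum fun l _ => (contDiffAt_gUp g hφ hy k l).mul
    (((h _ _ _).add (h _ _ _)).sub (h _ _ _)))

theorem gLow_funext_symm (g : RiemMetric n M) (φ : LocalChart n M) (i j : Fin n) :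
    gLow g φ i j = gLow g φ j i :=
  funext fun y => gLow_symm g φ i j y

theorem christoffel_symm (g : RiemMetric n M) (φ : LocalChart n M) (k i j : Fin n)
    (y : Coords n) : christoffel g φ k i j y = christoffel g φ k j i y := by
  simp only [christoffel]
  congr 1
  refine Finset.sum_congr rfl fun l _ => ?_
  rw [gLow_funext_symm g φ j i]
  ring

theorem sum_ite_mul {ι : Type*} [Fintype ι] [DecidableEq ι] (f : ι → ℝ) (i : ι) :
    ∑ j, (if i = j then 1 else 0) * f j = f i := by
  simp

/-- Contraction with a pair of inverse matrices. -/
theorem sum_mul_sum_of_inverse {ι : Type*} [Fintype ι] [DecidableEq ι] {A B : ι → ι → ℝ}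
    (h : ∀ i j, ∑ k, A i k * B k j = if i = j then 1 else 0) (f : ι → ℝ) (i : ι) :
    ∑ k, A i k * ∑ l, B k l * f l = f i := by
  simp only [Finset.mul_sum, ← mul_assoc]
  rw [Finset.sum_comm]
  simp only [← Finset.sum_mul, h, sum_ite_mul]

theorem sum_gLow_mul_christoffel (g : RiemMetric n M) {φ : LocalChart n M}
    (hφ : φ ∈ smoothCharts n M) {y : Coords n} (hy : y ∈ φ.target) (i k j : Fin n) :
    ∑ h, gLow g φ j h y * christoffel g φ h k i y = (1 / 2) *
      (pderivX k (gLow g φ i j) y + pderivX i (gLow g φ k j) y - pderivX j (gLow g φ k i) y) := by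
  rw [← sum_mul_sum_of_inverse (gLow_mul_gUp g hφ hy) (fun l => (1 / 2) *
    (pderivX k (gLow g φ i l) y + pderivX i (gLow g φ k l) y - pderivX l (gLow g φ k i) y)) j]
  refine Finset.sum_congr rfl fun h _ => ?_
  rw [christoffel, Finset.mul_sum]
  congr 1
  exact Finset.sum_congr rfl fun l _ => by ring

/-- The Levi-Civita connection of the base is metric. -/
theorem pderivX_gLow (g : RiemMetric n M) {φ : LocalChart n M} (hφ : φ ∈ smoothCharts n M)
    {y : Coords n} (hy : y ∈ φ.target) (k i j : Fin n) :
    pderivX k (gLow g φ i j) y = ∑ h, christoffel g φ h k i y * gLow g φ h j y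
      + ∑ h, christoffel g φ h k j y * gLow g φ h i y := by
  have h1 := sum_gLow_mul_christoffel g hφ hy i k j
  have h2 := sum_gLow_mul_christoffel g hφ hy j k i
  simp only [gLow_symm g φ j, mul_comm (gLow g φ _ j y)] at h1
  simp only [gLow_symm g φ i, mul_comm (gLow g φ _ i y)] at h2
  rw [h1, h2, gLow_funext_symm g φ j i, gLow_funext_symm g φ k j, gLow_funext_symm g φ k i]
  ring

/-- A symmetric array for which the metric is parallel is given by the Christoffel symbols. -/
theorem christoffel_eq_of_parallel (g : RiemMetric n M) {φ : LocalChart n M}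
    (hφ : φ ∈ smoothCharts n M) {y : Coords n} (hy : y ∈ φ.target) (B : Fin n → Fin n → Fin n → ℝ)
    (hsymm : ∀ h i j, B h i j = B h j i)
    (hpar : ∀ k i j, pderivX k (gLow g φ i j) y =
      ∑ h, B h k i * gLow g φ h j y + ∑ h, B h k j * gLow g φ h i y) (k i j : Fin n) :
    christoffel g φ k i j y = B k i j := by
  rw [← sum_mul_sum_of_inverse (gUp_mul_gLow g hφ hy) (fun l => B l i j) k, christoffel,
    Finset.mul_sum]
  refine Finset.sum_congr rfl fun l _ => ?_
  rw [hpar, hpar, hpar]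
  -- The three metric derivatives give six contractions. By symmetry of `B` four of them cancel and
  -- the other two coincide, which absorbs the factor 1/2.
  simp only [hsymm _ l, hsymm _ j i, gLow_symm g φ l, mul_comm (gLow g φ _ l y)]
  ring

/-- Differentiating UG = 1 gives dU = -U dG U. Substituting dG = CᵀG + (CᵀG)ᵀ, with C the connection
matrix in the direction k, yields dU = -CU - (CU)ᵀ. -/
theorem pderivX_gUp (g : RiemMetric n M) {φ : LocalChart n M} (hφ : φ ∈ smoothCharts n M)
    {y : Coords n} (hy : y ∈ φ.target) (k i j : Fin n) :
    pderivX k (gUp g φ i j) y = -(∑ h, christoffel g φ i k h y * gUp g φ h j y)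
      - ∑ h, christoffel g φ j k h y * gUp g φ h i y := by
  let U : Matrix (Fin n) (Fin n) ℝ := Matrix.of fun a b => gUp g φ a b y
  let G : Matrix (Fin n) (Fin n) ℝ := Matrix.of fun a b => gLow g φ a b y
  let dU : Matrix (Fin n) (Fin n) ℝ := Matrix.of fun a b => pderivX k (gUp g φ a b) y
  let dG : Matrix (Fin n) (Fin n) ℝ := Matrix.of fun a b => pderivX k (gLow g φ a b) y
  let C : Matrix (Fin n) (Fin n) ℝ := Matrix.of fun a b => christoffel g φ a k b y
  have hUG : U * G = 1 := Matrix.nonsing_inv_mul _ (isUnit_det_gMat g hφ hy)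
  have hGU : G * U = 1 := Matrix.mul_nonsing_inv _ (isUnit_det_gMat g hφ hy)
  have hd : dU * G + U * dG = 0 := by
    ext a b
    have hc : (fun z => ∑ m, gUp g φ a m z * gLow g φ m b z) =ᶠ[𝓝 y]
        fun _ => if a = b then 1 else 0 := by
      filter_upwards [φ.open_target.mem_nhds hy] with z hz
      exact gUp_mul_gLow g hφ hz a b
    have h1 : HasFDerivAt (fun z => ∑ m, gUp g φ a m z * gLow g φ m b z)
        (∑ m, (gUp g φ a m y • fderiv ℝ (gLow g φ m b) y
          + gLow g φ m b y • fderiv ℝ (gUp g φ a m) y)) y := by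
      refine HasFDerivAt.fun_sum fun m _ => ?_
      exact ((contDiffAt_gUp g hφ hy a m).differentiableAt (by simp)).hasFDerivAt.mul
        ((contDiffAt_gLow g hφ hy m b).differentiableAt (by simp)).hasFDerivAt
    have h2 := (h1.congr_of_eventuallyEq hc.symm).unique (hasFDerivAt_const _ _)
    have h3 := congrArg (fun L => L (stdVec k)) h2
    simp only [sum_apply, add_apply, smul_apply,
      zero_apply, smul_eq_mul, Finset.sum_add_distrib] at h3
    rw [Matrix.add_apply, Matrix.mul_apply, Matrix.mul_apply, Matrix.zero_apply, ← h3, add_comm]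
    congr 1
    exact Finset.sum_congr rfl fun m _ => mul_comm _ _
  have hdG : dG = C.transpose * G + (C.transpose * G).transpose := by
    ext a b
    exact pderivX_gLow g hφ hy k a b
  have hG : G.transpose = G := Matrix.ext fun a b => gLow_symm g φ b a y
  have hU : U.transpose = U := Matrix.ext fun a b => gUp_symm g φ b a y
  have hfin : dU = -(C * U) - (C * U).transpose := by
    have h1 : dU = -(U * dG * U) := by
      have h2 : (dU * G + U * dG) * U = 0 := by rw [hd, zero_mul]
      rw [add_mul, mul_assoc dU, hGU, mul_one] at h2
      exact eq_neg_of_add_eq_zero_left h2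
    rw [h1, hdG, Matrix.transpose_mul, Matrix.transpose_mul, Matrix.transpose_transpose, hG, hU,
      mul_add, add_mul]
    have e1 : U * (C.transpose * G) * U = U * C.transpose := by
      rw [mul_assoc, mul_assoc, hGU, mul_one]
    have e2 : U * (G * C) * U = C * U := by
      rw [← mul_assoc, hUG, one_mul]
    rw [e1, e2]
    abel
  exact congrFun (congrFun hfin i) j

end BaseMetric

end

section

variable {n : ℕ} {M : Type*} [TopologicalSpace M] [ChartedSpace (Coords n) M]

/-! ### A calculus of directional derivatives that carries differentiability along with the value.
-/

section DirectionalDerivative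

variable {E : Type*} [NormedAddCommGroup E] [NormedSpace ℝ E]

/-- `f` is differentiable at `z`, with derivative `d` in the direction `v`. -/
def HasDirDeriv (f : E → ℝ) (z v : E) (d : ℝ) : Prop :=
  DifferentiableAt ℝ f z ∧ fderiv ℝ f z v = d

namespace HasDirDeriv

variable {f f' : E → ℝ} {z v : E} {d d' : ℝ}

theorem congr_deriv (h : HasDirDeriv f z v d) (e : d = d') : HasDirDeriv f z v d' := e ▸ h

theorem add (h : HasDirDeriv f z v d) (h' : HasDirDeriv f' z v d') :
    HasDirDeriv (fun z => f z + f' z) z v (d + d') :=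
  ⟨h.1.add h'.1, by rw [fderiv_fun_add h.1 h'.1, add_apply, h.2, h'.2]⟩

theorem mul (h : HasDirDeriv f z v d) (h' : HasDirDeriv f' z v d') :
    HasDirDeriv (fun z => f z * f' z) z v (d * f' z + f z * d') :=
  ⟨h.1.mul h'.1, by
    rw [fderiv_fun_mul h.1 h'.1, add_apply, smul_apply, smul_apply, h.2, h'.2, smul_eq_mul,
      smul_eq_mul]
    ring⟩

theorem const (c : ℝ) : HasDirDeriv (fun _ => c) z v 0 :=
  ⟨differentiableAt_const _, by simp⟩

theorem const_mul (c : ℝ) (h : HasDirDeriv f z v d) :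
    HasDirDeriv (fun z => c * f z) z v (c * d) :=
  ((const c).mul h).congr_deriv (by ring)

theorem sum {ι : Type*} {s : Finset ι} {F : ι → E → ℝ} {D : ι → ℝ}
    (h : ∀ i ∈ s, HasDirDeriv (F i) z v (D i)) :
    HasDirDeriv (fun z => ∑ i ∈ s, F i z) z v (∑ i ∈ s, D i) := by
  refine ⟨DifferentiableAt.fun_sum fun i hi => (h i hi).1, ?_⟩
  rw [fderiv_fun_sum fun i hi => (h i hi).1, sum_apply]
  exact Finset.sum_congr rfl fun i hi => (h i hi).2

theorem comp {c : ℝ → ℝ} (hc : DifferentiableAt ℝ c (f z)) (h : HasDirDeriv f z v d) :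
    HasDirDeriv (fun z => c (f z)) z v (deriv c (f z) * d) := by
  have h1 := hc.hasDerivAt.comp_hasFDerivAt z h.1.hasFDerivAt
  refine ⟨h1.differentiableAt, ?_⟩
  have h2 : fderiv ℝ (fun z => c (f z)) z = deriv c (f z) • fderiv ℝ f z := h1.fderiv
  rw [h2, smul_apply, h.2, smul_eq_mul]

theorem comp_map {E' : Type*} [NormedAddCommGroup E'] [NormedSpace ℝ E'] {T : E' → E} {w v : E'}
    (hT : DifferentiableAt ℝ T w) (h : HasDirDeriv f (T w) (fderiv ℝ T w v) d) :
    HasDirDeriv (fun w => f (T w)) w v d := by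
  have h1 := h.1.hasFDerivAt.comp w hT.hasFDerivAt
  refine ⟨h1.differentiableAt, ?_⟩
  have h2 : fderiv ℝ (fun w => f (T w)) w = _ := h1.fderiv
  rw [h2]
  exact h.2

theorem congr_fun (h : HasDirDeriv f z v d) (e : f' =ᶠ[𝓝 z] f) : HasDirDeriv f' z v d :=
  ⟨h.1.congr_of_eventuallyEq e, by rw [e.fderiv_eq, h.2]⟩

end HasDirDeriv

namespace HasDirDeriv

variable {z v : PhaseCoords n}

theorem base {a : Coords n → ℝ} (ha : DifferentiableAt ℝ a z.1) :
    HasDirDeriv (fun z : PhaseCoords n => a z.1) z v (fderiv ℝ a z.1 v.1) := by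
  have h1 := ha.hasFDerivAt.comp z (hasFDerivAt_fst (p := z))
  refine ⟨h1.differentiableAt, ?_⟩
  have h2 : fderiv ℝ (fun z : PhaseCoords n => a z.1) z = _ := h1.fderiv
  rw [h2]
  rfl

theorem momentum (i : Fin n) : HasDirDeriv (fun z : PhaseCoords n => z.2 i) z v (v.2 i) := by
  have h1 := (((EuclideanSpace.proj i : Coords n →L[ℝ] ℝ).comp
    (ContinuousLinearMap.snd ℝ (Coords n) (Coords n)))).hasFDerivAt (x := z)
  refine ⟨h1.differentiableAt, ?_⟩
  have h2 : fderiv ℝ (fun z : PhaseCoords n => z.2 i) z = _ := h1.fderiv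
  rw [h2]
  rfl

end HasDirDeriv

theorem fderiv_eq_sum_pderivX (f : Coords n → ℝ) (y v : Coords n) :
    fderiv ℝ f y v = ∑ k, v k * pderivX k f y := by
  conv_lhs => rw [← sum_smul_stdVec v]
  rw [map_sum]
  exact Finset.sum_congr rfl fun k _ => by rw [map_smul, smul_eq_mul, pderivX]

end DirectionalDerivative

/-! ### Algebra and smoothness of the blocks of the metric on phase space. -/

section Phase

variable [IsManifold (𝓡 n) ∞ M]

variable (g : RiemMetric n M) {φ : LocalChart n M}

/-- The vector `δ/δq^k` at `z`, in coordinates. -/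
def horizVec (φ : LocalChart n M) (k : Fin n) (z : PhaseCoords n) : PhaseCoords n :=
  (stdVec k, WithLp.toLp 2 fun h => christoffelZero g φ k h z)

/-- The vector `∂/∂p_k`, in coordinates. -/
def vertVec (k : Fin n) : PhaseCoords n := (0, stdVec k)

theorem horizVec_fst (k : Fin n) (z : PhaseCoords n) :
    (horizVec g φ k z).1 = stdVec k := rfl

theorem horizVec_snd (k h : Fin n) (z : PhaseCoords n) :
    (horizVec g φ k z).2 h = christoffelZero g φ k h z := rfl

theorem christoffelZero_symm (i j : Fin n) (z : PhaseCoords n) :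
    christoffelZero g φ i j z = christoffelZero g φ j i z := by
  simp only [christoffelZero, christoffel_symm g φ _ i j]

theorem energy_eq (φ : LocalChart n M) (z : PhaseCoords n) :
    energy g φ z = (1 / 2) * ∑ i, z.2 i * gZero g φ i z := by
  simp only [energy, gZero, Finset.mul_sum]
  congr 1
  ext i
  refine Finset.sum_congr rfl fun k _ => ?_
  rw [gUp_symm g φ k i]
  ring

variable {z : PhaseCoords n}

section Algebra

theorem sum_gUp_mul_momentum (φ : LocalChart n M) (z : PhaseCoords n) (i : Fin n) :
    ∑ k, gUp g φ i k z.1 * z.2 k = gZero g φ i z := by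
  refine Finset.sum_congr rfl fun k _ => ?_
  rw [gUp_symm g φ k i, mul_comm]

theorem sum_gZero_mul_momentum (φ : LocalChart n M) (z : PhaseCoords n) :
    ∑ k, gZero g φ k z * z.2 k = 2 * energy g φ z := by
  rw [energy_eq]
  simp only [mul_comm]
  ring

theorem sum_gLow_mul_gZero (hφ : φ ∈ smoothCharts n M) (hz : z.1 ∈ φ.target) (i : Fin n) :
    ∑ k, gLow g φ i k z.1 * gZero g φ k z = z.2 i := by
  simp only [← sum_gUp_mul_momentum]
  exact sum_mul_sum_of_inverse (gLow_mul_gUp g hφ hz) (fun k => z.2 k) i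

theorem sum_gZero_mul_gLow (hφ : φ ∈ smoothCharts n M) (hz : z.1 ∈ φ.target) (i : Fin n) :
    ∑ k, gZero g φ k z * gLow g φ k i z.1 = z.2 i := by
  rw [← sum_gLow_mul_gZero g hφ hz i]
  exact Finset.sum_congr rfl fun k _ => by rw [gLow_symm g φ k i, mul_comm]

/-- The vector g^{0i} has squared length 2t, and lowering its index returns p, so it cannot vanish
when p is nonzero. -/
theorem energy_pos (hφ : φ ∈ smoothCharts n M) (hz : z ∈ phaseDomain φ) :
    0 < energy g φ z := by
  have hz1 : z.1 ∈ φ.target := hz.1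
  have hw : (fun i => gZero g φ i z) ≠ 0 := by
    intro h
    apply hz.2
    ext i
    rw [← sum_gLow_mul_gZero g hφ hz1 i]
    have : ∀ k, gZero g φ k z = 0 := fun k => congrFun h k
    simp [this]
  have h1 := gLow_posDef g hφ hz1 hw
  have h2 : ∑ i, ∑ j, gLow g φ i j z.1 * gZero g φ i z * gZero g φ j z = 2 * energy g φ z := by
    rw [← sum_gZero_mul_momentum]
    refine Finset.sum_congr rfl fun i _ => ?_
    rw [← sum_gLow_mul_gZero g hφ hz1 i, Finset.mul_sum]
    exact Finset.sum_congr rfl fun j _ => by ring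
  rw [h2] at h1
  linarith

variable {c₁ c₂ d₁ d₂ : ℝ → ℝ}

theorem G₁_symm (c₁ d₁ : ℝ → ℝ) (i j : Fin n) (z : PhaseCoords n) :
    G₁ g c₁ d₁ φ i j z = G₁ g c₁ d₁ φ j i z := by
  rw [G₁, G₁, gLow_symm g φ i j]; ring

theorem G₂_symm (c₂ d₂ : ℝ → ℝ) (i j : Fin n) (z : PhaseCoords n) :
    G₂ g c₂ d₂ φ i j z = G₂ g c₂ d₂ φ j i z := by
  rw [G₂, G₂, gUp_symm g φ i j]; ring

/-- Sherman–Morrison inversion of the rank-one perturbation c₁ g + d₁ p ⊗ p: since p has squared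
norm 2t for the inverse metric, the correction has denominator c₁ + 2 t d₁. -/
theorem G₁_mul_H₁ (hc : IsMetricParam c₁ c₂ d₁ d₂) (hφ : φ ∈ smoothCharts n M)
    (hz : z ∈ phaseDomain φ) (i j : Fin n) :
    ∑ k, G₁ g c₁ d₁ φ i k z * H₁ g c₁ d₁ φ k j z = if i = j then 1 else 0 := by
  have ht := energy_pos g hφ hz
  have hp := (hc.pos_c₁ _ ht).ne'
  have hq := (hc.pos_d₁ _ ht).ne'
  have hz1 : z.1 ∈ φ.target := hz.1
  set t := energy g φ z with ht'
  have h : ∀ k, G₁ g c₁ d₁ φ i k z * H₁ g c₁ d₁ φ k j z =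
      gLow g φ i k z.1 * gUp g φ k j z.1
      - d₁ t / (c₁ t + 2 * t * d₁ t) * gZero g φ j z * (gLow g φ i k z.1 * gZero g φ k z)
      + d₁ t / c₁ t * z.2 i * (gUp g φ j k z.1 * z.2 k)
      - d₁ t * (d₁ t / (c₁ t * (c₁ t + 2 * t * d₁ t))) * z.2 i * gZero g φ j z *
        (gZero g φ k z * z.2 k) := by
    intro k
    simp only [G₁, H₁, ← ht', gUp_symm g φ j k]
    field_simp
    ring
  simp only [h, Finset.sum_add_distrib, Finset.sum_sub_distrib, ← Finset.mul_sum,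
    gLow_mul_gUp g hφ hz1, sum_gLow_mul_gZero g hφ hz1, sum_gUp_mul_momentum,
    sum_gZero_mul_momentum, ← ht']
  -- The denominator becomes an opaque symbol, so that `field_simp` clears it as one factor; it is
  -- expanded again only in the resulting polynomial identity.
  obtain ⟨q, hq'⟩ : ∃ q, q = c₁ t + 2 * t * d₁ t := ⟨_, rfl⟩
  rw [← hq'] at hq ⊢
  field_simp
  rw [hq']
  ring

theorem G₂_mul_H₂ (hc : IsMetricParam c₁ c₂ d₁ d₂) (hφ : φ ∈ smoothCharts n M)
    (hz : z ∈ phaseDomain φ) (i j : Fin n) :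
    ∑ k, G₂ g c₂ d₂ φ i k z * H₂ g c₂ d₂ φ k j z = if i = j then 1 else 0 := by
  have ht := energy_pos g hφ hz
  have hp := (hc.pos_c₂ _ ht).ne'
  have hq := (hc.pos_d₂ _ ht).ne'
  have hz1 : z.1 ∈ φ.target := hz.1
  set t := energy g φ z with ht'
  have h : ∀ k, G₂ g c₂ d₂ φ i k z * H₂ g c₂ d₂ φ k j z =
      gUp g φ i k z.1 * gLow g φ k j z.1
      - d₂ t / (c₂ t + 2 * t * d₂ t) * z.2 j * (gUp g φ i k z.1 * z.2 k)
      + d₂ t / c₂ t * gZero g φ i z * (gLow g φ j k z.1 * gZero g φ k z)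
      - d₂ t * (d₂ t / (c₂ t * (c₂ t + 2 * t * d₂ t))) * gZero g φ i z * z.2 j *
        (gZero g φ k z * z.2 k) := by
    intro k
    simp only [G₂, H₂, ← ht', gLow_symm g φ j k]
    field_simp
    ring
  simp only [h, Finset.sum_add_distrib, Finset.sum_sub_distrib, ← Finset.mul_sum,
    gUp_mul_gLow g hφ hz1, sum_gLow_mul_gZero g hφ hz1, sum_gUp_mul_momentum,
    sum_gZero_mul_momentum, ← ht']
  obtain ⟨q, hq'⟩ : ∃ q, q = c₂ t + 2 * t * d₂ t := ⟨_, rfl⟩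
  rw [← hq'] at hq ⊢
  field_simp
  rw [hq']
  ring

end Algebra

section Smoothness

theorem contDiffAt_base {a : Coords n → ℝ} {k : WithTop ℕ∞} (ha : ContDiffAt ℝ k a z.1) :
    ContDiffAt ℝ k (fun z : PhaseCoords n => a z.1) z :=
  ContDiffAt.comp z ha contDiffAt_fst

theorem contDiffAt_momentum {k : WithTop ℕ∞} (i : Fin n) :
    ContDiffAt ℝ k (fun z : PhaseCoords n => z.2 i) z := by
  fun_prop

theorem contDiffAt_gZero (hφ : φ ∈ smoothCharts n M) (hz : z.1 ∈ φ.target) (i : Fin n) :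
    ContDiffAt ℝ ∞ (gZero g φ i) z :=
  ContDiffAt.sum fun h _ => (contDiffAt_momentum h).mul
    (contDiffAt_base (contDiffAt_gUp g hφ hz h i))

theorem contDiffAt_energy (hφ : φ ∈ smoothCharts n M) (hz : z.1 ∈ φ.target) :
    ContDiffAt ℝ ∞ (energy g φ) z :=
  contDiffAt_const.mul (ContDiffAt.sum fun i _ => ContDiffAt.sum fun k _ =>
    ((contDiffAt_base (contDiffAt_gUp g hφ hz i k)).mul (contDiffAt_momentum i)).mul
      (contDiffAt_momentum k))

theorem contDiffAt_christoffelZero (hφ : φ ∈ smoothCharts n M) (hz : z.1 ∈ φ.target)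
    (i h : Fin n) : ContDiffAt ℝ ∞ (christoffelZero g φ i h) z :=
  ContDiffAt.sum fun k _ => (contDiffAt_momentum k).mul
    (contDiffAt_base (contDiffAt_christoffel g hφ hz k i h))

theorem contDiffAt_curv (hφ : φ ∈ smoothCharts n M) {y : Coords n} (hy : y ∈ φ.target)
    (h k i j : Fin n) : ContDiffAt ℝ ∞ (curv g φ h k i j) y := by
  have hC := fun a b c => contDiffAt_christoffel g hφ hy a b c
  exact ((contDiffAt_pderivX (hC _ _ _) _).sub (contDiffAt_pderivX (hC _ _ _) _)).add
    (ContDiffAt.sum fun l _ => ((hC _ _ _).mul (hC _ _ _)).sub ((hC _ _ _).mul (hC _ _ _)))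

theorem contDiffAt_curvZero (hφ : φ ∈ smoothCharts n M) (hz : z.1 ∈ φ.target)
    (k i j : Fin n) : ContDiffAt ℝ ∞ (curvZero g φ k i j) z :=
  ContDiffAt.sum fun h _ => (contDiffAt_momentum h).mul
    (contDiffAt_base (contDiffAt_curv g hφ hz h k i j))

theorem contDiffAt_pderivP {f : PhaseCoords n → ℝ} (hf : ContDiffAt ℝ ∞ f z)
    (i : Fin n) : ContDiffAt ℝ ∞ (pderivP i f) z :=
  (hf.fderiv_right (m := ∞) (by simp)).clm_apply contDiffAt_const

theorem contDiffAt_comp_energy (hφ : φ ∈ smoothCharts n M) (hz : z ∈ phaseDomain φ)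
    {c : ℝ → ℝ} (hc : ContDiffOn ℝ ∞ c (Ioi 0)) :
    ContDiffAt ℝ ∞ (fun z => c (energy g φ z)) z :=
  ContDiffAt.comp z (hc.contDiffAt (Ioi_mem_nhds (energy_pos g hφ hz)))
    (contDiffAt_energy g hφ hz.1)

variable {c₁ c₂ d₁ d₂ : ℝ → ℝ}

theorem contDiffAt_G₁ (hc : IsMetricParam c₁ c₂ d₁ d₂) (hφ : φ ∈ smoothCharts n M)
    (hz : z ∈ phaseDomain φ) (i j : Fin n) : ContDiffAt ℝ ∞ (G₁ g c₁ d₁ φ i j) z :=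
  ((contDiffAt_comp_energy g hφ hz hc.smooth_c₁).mul
    (contDiffAt_base (contDiffAt_gLow g hφ hz.1 i j))).add
    (((contDiffAt_comp_energy g hφ hz hc.smooth_d₁).mul (contDiffAt_momentum i)).mul
      (contDiffAt_momentum j))

theorem contDiffAt_G₂ (hc : IsMetricParam c₁ c₂ d₁ d₂) (hφ : φ ∈ smoothCharts n M)
    (hz : z ∈ phaseDomain φ) (i j : Fin n) : ContDiffAt ℝ ∞ (G₂ g c₂ d₂ φ i j) z :=
  ((contDiffAt_comp_energy g hφ hz hc.smooth_c₂).mul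
    (contDiffAt_base (contDiffAt_gUp g hφ hz.1 i j))).add
    (((contDiffAt_comp_energy g hφ hz hc.smooth_d₂).mul (contDiffAt_gZero g hφ hz.1 i)).mul
      (contDiffAt_gZero g hφ hz.1 j))

theorem contDiffAt_H₁ (hc : IsMetricParam c₁ c₂ d₁ d₂) (hφ : φ ∈ smoothCharts n M)
    (hz : z ∈ phaseDomain φ) (i j : Fin n) : ContDiffAt ℝ ∞ (H₁ g c₁ d₁ φ i j) z := by
  have ht := energy_pos g hφ hz
  have h1 := contDiffAt_comp_energy g hφ hz hc.smooth_c₁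
  have h2 := contDiffAt_comp_energy g hφ hz hc.smooth_d₁
  have h3 := (hc.pos_c₁ _ ht).ne'
  have h4 := (hc.pos_d₁ _ ht).ne'
  exact ((contDiffAt_const.div h1 h3).mul (contDiffAt_base (contDiffAt_gUp g hφ hz.1 i j))).sub
    (((h2.div (h1.mul (h1.add ((contDiffAt_const.mul (contDiffAt_energy g hφ hz.1)).mul h2)))
      (mul_ne_zero h3 h4)).mul (contDiffAt_gZero g hφ hz.1 i)).mul (contDiffAt_gZero g hφ hz.1 j))

theorem contDiffAt_H₂ (hc : IsMetricParam c₁ c₂ d₁ d₂) (hφ : φ ∈ smoothCharts n M)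
    (hz : z ∈ phaseDomain φ) (i j : Fin n) : ContDiffAt ℝ ∞ (H₂ g c₂ d₂ φ i j) z := by
  have ht := energy_pos g hφ hz
  have h1 := contDiffAt_comp_energy g hφ hz hc.smooth_c₂
  have h2 := contDiffAt_comp_energy g hφ hz hc.smooth_d₂
  have h3 := (hc.pos_c₂ _ ht).ne'
  have h4 := (hc.pos_d₂ _ ht).ne'
  exact ((contDiffAt_const.div h1 h3).mul (contDiffAt_base (contDiffAt_gLow g hφ hz.1 i j))).sub
    (((h2.div (h1.mul (h1.add ((contDiffAt_const.mul (contDiffAt_energy g hφ hz.1)).mul h2)))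
      (mul_ne_zero h3 h4)).mul (contDiffAt_momentum i)).mul (contDiffAt_momentum j))

theorem contDiffAt_Qcoef (hc : IsMetricParam c₁ c₂ d₁ d₂) (hφ : φ ∈ smoothCharts n M)
    (hz : z ∈ phaseDomain φ) (i j h : Fin n) : ContDiffAt ℝ ∞ (Qcoef g c₂ d₂ φ i j h) z := by
  have hG := fun a i j => contDiffAt_pderivP (contDiffAt_G₂ g hc hφ hz i j) a
  exact contDiffAt_const.mul (ContDiffAt.sum fun k _ => (contDiffAt_H₂ g hc hφ hz h k).mul
    (((hG _ _ _).add (hG _ _ _)).sub (hG _ _ _)))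

theorem contDiffAt_Pcoef (hc : IsMetricParam c₁ c₂ d₁ d₂) (hφ : φ ∈ smoothCharts n M)
    (hz : z ∈ phaseDomain φ) (h i j : Fin n) :
    ContDiffAt ℝ ∞ (Pcoef g c₁ c₂ d₁ d₂ φ h i j) z := by
  have hG := fun a i j => contDiffAt_pderivP (contDiffAt_G₁ g hc hφ hz i j) a
  exact contDiffAt_const.mul (ContDiffAt.sum fun k _ => (contDiffAt_H₁ g hc hφ hz h k).mul
    ((hG _ _ _).sub (ContDiffAt.sum fun l _ => (contDiffAt_G₂ g hc hφ hz i l).mul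
      (contDiffAt_curvZero g hφ hz.1 l j k))))

theorem contDiffAt_Scoef (hc : IsMetricParam c₁ c₂ d₁ d₂) (hφ : φ ∈ smoothCharts n M)
    (hz : z ∈ phaseDomain φ) (h i j : Fin n) :
    ContDiffAt ℝ ∞ (Scoef g c₁ c₂ d₁ d₂ φ h i j) z := by
  have hG := fun a i j => contDiffAt_pderivP (contDiffAt_G₁ g hc hφ hz i j) a
  exact (contDiffAt_const.mul (ContDiffAt.sum fun k _ => (contDiffAt_H₂ g hc hφ hz h k).mul
    (hG _ _ _))).add (contDiffAt_const.mul (contDiffAt_curvZero g hφ hz.1 h i j))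

end Smoothness

end Phase

end

section

variable {n : ℕ} {M : Type*} [TopologicalSpace M] [ChartedSpace (Coords n) M]

/-! ### Derivatives along horizontal and vertical directions, and brackets of horizontal fields. -/

section PhaseDerivatives

variable [IsManifold (𝓡 n) ∞ M] (g : RiemMetric n M) {φ : LocalChart n M} {z : PhaseCoords n}

theorem hasDirDeriv_base_horizVec {a : Coords n → ℝ} (ha : DifferentiableAt ℝ a z.1) (k : Fin n) :
    HasDirDeriv (fun z : PhaseCoords n => a z.1) z (horizVec g φ k z) (pderivX k a z.1) :=
  HasDirDeriv.base ha

theorem hasDirDeriv_base_vertVec {a : Coords n → ℝ} (ha : DifferentiableAt ℝ a z.1) (k : Fin n) :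
    HasDirDeriv (fun z : PhaseCoords n => a z.1) z (vertVec k) 0 :=
  (HasDirDeriv.base ha).congr_deriv (map_zero _)

theorem hasDirDeriv_momentum_horizVec (k i : Fin n) :
    HasDirDeriv (fun z : PhaseCoords n => z.2 i) z (horizVec g φ k z)
      (christoffelZero g φ k i z) :=
  HasDirDeriv.momentum i

theorem hasDirDeriv_momentum_vertVec (k i : Fin n) :
    HasDirDeriv (fun z : PhaseCoords n => z.2 i) z (vertVec k) (if i = k then 1 else 0) :=
  (HasDirDeriv.momentum i).congr_deriv (stdVec_apply k i)

theorem hasDirDeriv_gZero_vertVec (hφ : φ ∈ smoothCharts n M) (hz : z.1 ∈ φ.target) (k i : Fin n) :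
    HasDirDeriv (gZero g φ i) z (vertVec k) (gUp g φ k i z.1) := by
  have h := HasDirDeriv.sum (s := Finset.univ) fun h _ => (hasDirDeriv_momentum_vertVec (z := z) k h).mul
    (hasDirDeriv_base_vertVec ((contDiffAt_gUp g hφ hz h i).differentiableAt (by simp)) k)
  exact h.congr_deriv (by simp)

theorem hasDirDeriv_energy_vertVec (hφ : φ ∈ smoothCharts n M) (hz : z.1 ∈ φ.target) (k : Fin n) :
    HasDirDeriv (energy g φ) z (vertVec k) (gZero g φ k z) := by
  have h := (HasDirDeriv.sum (s := Finset.univ) fun h _ =>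
    (hasDirDeriv_momentum_vertVec (z := z) k h).mul
      (hasDirDeriv_gZero_vertVec g hφ hz k h)).const_mul (1 / 2)
  rw [funext fun z => energy_eq g φ z]
  refine h.congr_deriv ?_
  simp only [Finset.sum_add_distrib, mul_comm (z.2 _), sum_gUp_mul_momentum]
  simp
  ring

/-- The change of p along the horizontal lift cancels the term of ∂_k g^{hi} that carries the index
h. Only the connection term of the free index i survives. -/
theorem hasDirDeriv_gZero_horizVec (hφ : φ ∈ smoothCharts n M) (hz : z.1 ∈ φ.target)
    (k i : Fin n) :
    HasDirDeriv (gZero g φ i) z (horizVec g φ k z)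
      (-∑ m, christoffel g φ i k m z.1 * gZero g φ m z) := by
  have h := HasDirDeriv.sum (s := Finset.univ) fun h _ =>
    (hasDirDeriv_momentum_horizVec (z := z) (φ := φ) g k h).mul
    (hasDirDeriv_base_horizVec (φ := φ) g
      ((contDiffAt_gUp g hφ hz h i).differentiableAt (by simp)) k)
  refine h.congr_deriv ?_
  simp only [pderivX_gUp g hφ hz, Finset.sum_add_distrib, mul_sub, mul_neg,
    Finset.sum_sub_distrib, Finset.sum_neg_distrib]
  have e1 : ∑ x, christoffelZero g φ k x z * gUp g φ x i z.1 =
      ∑ x, z.2 x * ∑ h, christoffel g φ x k h z.1 * gUp g φ h i z.1 := by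
    simp only [christoffelZero, Finset.sum_mul, Finset.mul_sum, mul_assoc]
    exact Finset.sum_comm
  have e2 : ∑ x, z.2 x * ∑ h, christoffel g φ i k h z.1 * gUp g φ h x z.1 =
      ∑ m, christoffel g φ i k m z.1 * gZero g φ m z := by
    simp only [gZero, Finset.mul_sum]
    rw [Finset.sum_comm]
    refine Finset.sum_congr rfl fun a _ => Finset.sum_congr rfl fun b _ => ?_
    rw [gUp_symm g φ a b]
    ring
  rw [e1, e2]
  ring

/-- Horizontal displacement transports p parallelly, and parallel transport is isometric.
Consequently c₁(t), c₂(t), d₁(t), d₂(t) behave as constants under horizontal differentiation. -/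
theorem hasDirDeriv_energy_horizVec (hφ : φ ∈ smoothCharts n M) (hz : z.1 ∈ φ.target)
    (k : Fin n) : HasDirDeriv (energy g φ) z (horizVec g φ k z) 0 := by
  have h := (HasDirDeriv.sum (s := Finset.univ) fun h _ =>
    (hasDirDeriv_momentum_horizVec (z := z) (φ := φ) g k h).mul
      (hasDirDeriv_gZero_horizVec g hφ hz k h)).const_mul (1 / 2)
  rw [funext fun z => energy_eq g φ z]
  refine h.congr_deriv ?_
  simp only [Finset.sum_add_distrib, mul_neg, Finset.sum_neg_distrib]
  have e1 : ∑ x, christoffelZero g φ k x z * gZero g φ x z =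
      ∑ x, z.2 x * ∑ m, christoffel g φ x k m z.1 * gZero g φ m z := by
    simp only [christoffelZero, Finset.sum_mul, Finset.mul_sum, mul_assoc]
    exact Finset.sum_comm
  rw [e1]
  ring

variable {c₁ c₂ d₁ d₂ : ℝ → ℝ}

theorem differentiableAt_of_contDiffOn_Ioi {c : ℝ → ℝ} (hc : ContDiffOn ℝ ∞ c (Ioi 0)) {t : ℝ}
    (ht : 0 < t) : DifferentiableAt ℝ c t :=
  (hc.contDiffAt (Ioi_mem_nhds ht)).differentiableAt (by simp)

theorem hasDirDeriv_G₁_vertVec (hc : IsMetricParam c₁ c₂ d₁ d₂) (hφ : φ ∈ smoothCharts n M)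
    (hz : z ∈ phaseDomain φ) (k i j : Fin n) :
    HasDirDeriv (G₁ g c₁ d₁ φ i j) z (vertVec k)
      (gZero g φ k z * (deriv c₁ (energy g φ z) * gLow g φ i j z.1
          + deriv d₁ (energy g φ z) * z.2 i * z.2 j)
        + d₁ (energy g φ z) * ((if i = k then 1 else 0) * z.2 j
          + z.2 i * (if j = k then 1 else 0))) := by
  have ht := energy_pos g hφ hz
  have he := hasDirDeriv_energy_vertVec g hφ hz.1 k
  have h := ((he.comp (differentiableAt_of_contDiffOn_Ioi hc.smooth_c₁ ht)).mul
    (hasDirDeriv_base_vertVec ((contDiffAt_gLow g hφ hz.1 i j).differentiableAt (by simp)) k)).add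
    (((he.comp (differentiableAt_of_contDiffOn_Ioi hc.smooth_d₁ ht)).mul
      (hasDirDeriv_momentum_vertVec k i)).mul (hasDirDeriv_momentum_vertVec k j))
  exact h.congr_deriv (by ring)

theorem hasDirDeriv_G₂_vertVec (hc : IsMetricParam c₁ c₂ d₁ d₂) (hφ : φ ∈ smoothCharts n M)
    (hz : z ∈ phaseDomain φ) (k i j : Fin n) :
    HasDirDeriv (G₂ g c₂ d₂ φ i j) z (vertVec k)
      (gZero g φ k z * (deriv c₂ (energy g φ z) * gUp g φ i j z.1
          + deriv d₂ (energy g φ z) * gZero g φ i z * gZero g φ j z)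
        + d₂ (energy g φ z) * (gUp g φ k i z.1 * gZero g φ j z
          + gZero g φ i z * gUp g φ k j z.1)) := by
  have ht := energy_pos g hφ hz
  have he := hasDirDeriv_energy_vertVec g hφ hz.1 k
  have h := ((he.comp (differentiableAt_of_contDiffOn_Ioi hc.smooth_c₂ ht)).mul
    (hasDirDeriv_base_vertVec ((contDiffAt_gUp g hφ hz.1 i j).differentiableAt (by simp)) k)).add
    (((he.comp (differentiableAt_of_contDiffOn_Ioi hc.smooth_d₂ ht)).mul
      (hasDirDeriv_gZero_vertVec g hφ hz.1 k i)).mul (hasDirDeriv_gZero_vertVec g hφ hz.1 k j))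
  exact h.congr_deriv (by ring)

/-- The energy is constant in this direction, and g and p ⊗ p each satisfy the same covariant law,
so any combination with coefficients depending on t does too. -/
theorem hasDirDeriv_G₁_horizVec (hc : IsMetricParam c₁ c₂ d₁ d₂) (hφ : φ ∈ smoothCharts n M)
    (hz : z ∈ phaseDomain φ) (k i j : Fin n) :
    HasDirDeriv (G₁ g c₁ d₁ φ i j) z (horizVec g φ k z)
      (∑ h, christoffel g φ h k i z.1 * G₁ g c₁ d₁ φ h j z
        + ∑ h, christoffel g φ h k j z.1 * G₁ g c₁ d₁ φ h i z) := by
  have ht := energy_pos g hφ hz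
  have he := hasDirDeriv_energy_horizVec g hφ hz.1 k
  have h := ((he.comp (differentiableAt_of_contDiffOn_Ioi hc.smooth_c₁ ht)).mul
    (hasDirDeriv_base_horizVec (φ := φ) g
      ((contDiffAt_gLow g hφ hz.1 i j).differentiableAt (by simp)) k)).add
    (((he.comp (differentiableAt_of_contDiffOn_Ioi hc.smooth_d₁ ht)).mul
      (hasDirDeriv_momentum_horizVec g k i)).mul (hasDirDeriv_momentum_horizVec g k j))
  refine h.congr_deriv ?_
  have e : ∀ i j, ∑ h, christoffel g φ h k i z.1 * G₁ g c₁ d₁ φ h j z =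
      c₁ (energy g φ z) * ∑ h, christoffel g φ h k i z.1 * gLow g φ h j z.1
        + d₁ (energy g φ z) * z.2 j * christoffelZero g φ k i z := by
    intro i j
    simp only [G₁, christoffelZero, Finset.mul_sum, ← Finset.sum_add_distrib]
    exact Finset.sum_congr rfl fun h _ => by ring
  rw [e, e, pderivX_gLow g hφ hz.1]
  ring

theorem hasDirDeriv_G₂_horizVec (hc : IsMetricParam c₁ c₂ d₁ d₂) (hφ : φ ∈ smoothCharts n M)
    (hz : z ∈ phaseDomain φ) (k i j : Fin n) :
    HasDirDeriv (G₂ g c₂ d₂ φ i j) z (horizVec g φ k z)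
      (-(∑ h, christoffel g φ i k h z.1 * G₂ g c₂ d₂ φ h j z)
        - ∑ h, christoffel g φ j k h z.1 * G₂ g c₂ d₂ φ h i z) := by
  have ht := energy_pos g hφ hz
  have he := hasDirDeriv_energy_horizVec g hφ hz.1 k
  have h := ((he.comp (differentiableAt_of_contDiffOn_Ioi hc.smooth_c₂ ht)).mul
    (hasDirDeriv_base_horizVec (φ := φ) g
      ((contDiffAt_gUp g hφ hz.1 i j).differentiableAt (by simp)) k)).add
    (((he.comp (differentiableAt_of_contDiffOn_Ioi hc.smooth_d₂ ht)).mul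
      (hasDirDeriv_gZero_horizVec g hφ hz.1 k i)).mul (hasDirDeriv_gZero_horizVec g hφ hz.1 k j))
  refine h.congr_deriv ?_
  have e : ∀ i j, ∑ h, christoffel g φ i k h z.1 * G₂ g c₂ d₂ φ h j z =
      c₂ (energy g φ z) * ∑ h, christoffel g φ i k h z.1 * gUp g φ h j z.1
        + d₂ (energy g φ z) * gZero g φ j z * ∑ m, christoffel g φ i k m z.1 * gZero g φ m z := by
    intro i j
    simp only [G₂, Finset.mul_sum, ← Finset.sum_add_distrib]
    exact Finset.sum_congr rfl fun h _ => by ring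
  rw [e, e, pderivX_gUp g hφ hz.1]
  ring

theorem contDiffAt_horizVec (hφ : φ ∈ smoothCharts n M) (hz : z.1 ∈ φ.target) (k : Fin n) :
    ContDiffAt ℝ ∞ (horizVec g φ k) z := by
  refine contDiffAt_const.prodMk ?_
  rw [contDiffAt_euclidean]
  exact fun i => contDiffAt_christoffelZero g hφ hz k i

theorem fderiv_phase_ext {F : PhaseCoords n → PhaseCoords n} {v w : PhaseCoords n}
    (hF : DifferentiableAt ℝ F z) (h1 : ∀ i, HasDirDeriv (fun z => (F z).1 i) z v (w.1 i))
    (h2 : ∀ i, HasDirDeriv (fun z => (F z).2 i) z v (w.2 i)) : fderiv ℝ F z v = w := by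
  have key : ∀ L : PhaseCoords n →L[ℝ] ℝ, fderiv ℝ (fun z => L (F z)) z v = L (fderiv ℝ F z v) := by
    intro L
    have := (L.hasFDerivAt.comp z hF.hasFDerivAt).fderiv
    exact congrArg (fun A => A v) this
  ext i
  · rw [← (h1 i).2]
    exact (key ((EuclideanSpace.proj i).comp (ContinuousLinearMap.fst ℝ _ _))).symm
  · rw [← (h2 i).2]
    exact (key ((EuclideanSpace.proj i).comp (ContinuousLinearMap.snd ℝ _ _))).symm

theorem hasDirDeriv_christoffelZero_vertVec (hφ : φ ∈ smoothCharts n M) (hz : z.1 ∈ φ.target)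
    (k i j : Fin n) :
    HasDirDeriv (christoffelZero g φ i j) z (vertVec k) (christoffel g φ k i j z.1) := by
  have h := HasDirDeriv.sum (s := Finset.univ) fun h _ =>
    (hasDirDeriv_momentum_vertVec (z := z) k h).mul (hasDirDeriv_base_vertVec
      ((contDiffAt_christoffel g hφ hz h i j).differentiableAt (by simp)) k)
  exact h.congr_deriv (by simp)

/-- The derivative ∂_kΓ comes from the base point and the quadratic term ΓΓ from the horizontal
motion of p; antisymmetrising in the two horizontal indices turns the sum into the curvature. -/
theorem hasDirDeriv_christoffelZero_horizVec (hφ : φ ∈ smoothCharts n M) (hz : z.1 ∈ φ.target)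
    (k i j : Fin n) :
    HasDirDeriv (christoffelZero g φ i j) z (horizVec g φ k z)
      (∑ h, z.2 h * (pderivX k (christoffel g φ h i j) z.1
        + ∑ l, christoffel g φ h k l z.1 * christoffel g φ l i j z.1)) := by
  have h := HasDirDeriv.sum (s := Finset.univ) fun h _ =>
    (hasDirDeriv_momentum_horizVec (z := z) (φ := φ) g k h).mul (hasDirDeriv_base_horizVec
      (φ := φ) g ((contDiffAt_christoffel g hφ hz h i j).differentiableAt (by simp)) k)
  refine h.congr_deriv ?_
  simp only [mul_add, Finset.sum_add_distrib]
  rw [add_comm]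
  congr 1
  simp only [christoffelZero, Finset.sum_mul, Finset.mul_sum, mul_assoc]
  exact Finset.sum_comm

theorem fderiv_horizVec_vertVec (hφ : φ ∈ smoothCharts n M) (hz : z.1 ∈ φ.target) (k i : Fin n) :
    fderiv ℝ (horizVec g φ i) z (vertVec k) =
      (0, WithLp.toLp 2 fun h => christoffel g φ k i h z.1) :=
  fderiv_phase_ext ((contDiffAt_horizVec g hφ hz i).differentiableAt (by simp))
    (fun _ => HasDirDeriv.const _)
    fun j => hasDirDeriv_christoffelZero_vertVec g hφ hz k i j

/-- The coordinate expression of the bracket of two horizontal frame fields. -/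
theorem lieBracket_horizVec (hφ : φ ∈ smoothCharts n M) (hz : z.1 ∈ φ.target) (i j : Fin n) :
    fderiv ℝ (horizVec g φ j) z (horizVec g φ i z)
      - fderiv ℝ (horizVec g φ i) z (horizVec g φ j z) =
      (0, WithLp.toLp 2 fun h => curvZero g φ h i j z) := by
  have key : ∀ i k, fderiv ℝ (horizVec g φ i) z (horizVec g φ k z) =
      (0, WithLp.toLp 2 fun j => ∑ h, z.2 h * (pderivX k (christoffel g φ h i j) z.1
        + ∑ l, christoffel g φ h k l z.1 * christoffel g φ l i j z.1)) := fun i k =>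
    fderiv_phase_ext ((contDiffAt_horizVec g hφ hz i).differentiableAt (by simp))
      (fun _ => HasDirDeriv.const _)
      fun j => hasDirDeriv_christoffelZero_horizVec g hφ hz k i j
  rw [key, key]
  ext h
  · simp
  · simp only [Prod.snd_sub, PiLp.sub_apply, curvZero, curv, ← Finset.sum_sub_distrib]
    refine Finset.sum_congr rfl fun m _ => ?_
    rw [Finset.sum_sub_distrib]
    ring

end PhaseDerivatives

end

section

variable {n : ℕ} {M : Type*} [TopologicalSpace M] [ChartedSpace (Coords n) M]

/-! ### Changes of charts on the base and the transformation law of the Christoffel symbols. -/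

section ChartChange

variable [IsManifold (𝓡 n) ∞ M] (g : RiemMetric n M) {φ ψ : LocalChart n M}

/-- The Jacobian is evaluated at ψ(ψ⁻¹ y), which is y only on the target of ψ; openness of the
target makes the two functions agree near y, enough for derivatives. -/
theorem jacobian_symm_eventuallyEq {y : Coords n} (hy : y ∈ ψ.target) (a i : Fin n) :
    (fun y => jacobian ψ φ (ψ.symm y) a i) =ᶠ[𝓝 y]
      fun y => (fderiv ℝ (fun y => φ (ψ.symm y)) y (stdVec i)) a := by
  filter_upwards [ψ.open_target.mem_nhds hy] with w hw
  rw [jacobian, ψ.right_inv hw]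

theorem contDiffAt_transition (hφ : φ ∈ smoothCharts n M) (hψ : ψ ∈ smoothCharts n M)
    {y : Coords n} (hy : y ∈ ψ.target) (hy' : ψ.symm y ∈ φ.source) :
    ContDiffAt ℝ ∞ (fun y => φ (ψ.symm y)) y :=
  (ContMDiffAt.comp y (contMDiffAt_of_mem_maximalAtlas hφ hy')
    (contMDiffAt_symm_of_mem_maximalAtlas hψ hy)).contDiffAt

theorem contDiffAt_fderiv_transition (hφ : φ ∈ smoothCharts n M) (hψ : ψ ∈ smoothCharts n M)
    {y : Coords n} (hy : y ∈ ψ.target) (hy' : ψ.symm y ∈ φ.source) :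
    ContDiffAt ℝ ∞ (fderiv ℝ (fun y => φ (ψ.symm y))) y :=
  (contDiffAt_transition hφ hψ hy hy').fderiv_right (by simp)

theorem contDiffAt_jacobian (hφ : φ ∈ smoothCharts n M) (hψ : ψ ∈ smoothCharts n M)
    {y : Coords n} (hy : y ∈ ψ.target) (hy' : ψ.symm y ∈ φ.source) (a i : Fin n) :
    ContDiffAt ℝ ∞ (fun y => jacobian ψ φ (ψ.symm y) a i) y := by
  refine ContDiffAt.congr_of_eventuallyEq ?_ (jacobian_symm_eventuallyEq hy a i)
  exact (EuclideanSpace.proj a : Coords n →L[ℝ] ℝ).contDiff.contDiffAt.comp y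
    ((contDiffAt_fderiv_transition hφ hψ hy hy').clm_apply contDiffAt_const)

/-- The second derivatives `∂²x^a/∂y^k∂y^i` of a change of coordinates. -/
def hessian (φ ψ : LocalChart n M) (a k i : Fin n) (y : Coords n) : ℝ :=
  pderivX k (fun y => jacobian ψ φ (ψ.symm y) a i) y

theorem hessian_symm (hφ : φ ∈ smoothCharts n M) (hψ : ψ ∈ smoothCharts n M)
    {y : Coords n} (hy : y ∈ ψ.target) (hy' : ψ.symm y ∈ φ.source) (a k i : Fin n) :
    hessian φ ψ a k i y = hessian φ ψ a i k y := by
  have key : ∀ k i, hessian φ ψ a k i y =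
      (fderiv ℝ (fderiv ℝ (fun y => φ (ψ.symm y))) y (stdVec k) (stdVec i)) a := by
    intro k i
    rw [hessian, pderivX, (jacobian_symm_eventuallyEq hy a i).fderiv_eq]
    have h1 := ((contDiffAt_fderiv_transition hφ hψ hy hy').differentiableAt
      (by simp)).hasFDerivAt.clm_apply (hasFDerivAt_const (stdVec i : Coords n) y)
    have h2 := ((EuclideanSpace.proj a : Coords n →L[ℝ] ℝ).hasFDerivAt.comp y h1).fderiv
    refine (congrArg (fun L => L (stdVec k)) h2).trans ?_
    simp
  rw [key, key]
  have h3 := (contDiffAt_transition hφ hψ hy hy').isSymmSndFDerivAt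
    (by rw [minSmoothness_of_isRCLikeNormedField]; exact ENat.LEInfty.out)
  rw [h3 (stdVec k) (stdVec i)]

theorem fderiv_transition_stdVec {y : Coords n} (hy : y ∈ ψ.target) (c k : Fin n) :
    (fderiv ℝ (fun y => φ (ψ.symm y)) y (stdVec k)) c = jacobian ψ φ (ψ.symm y) c k := by
  rw [jacobian, ψ.right_inv hy]

theorem fderiv_transition_apply {y : Coords n} (hy : y ∈ ψ.target) (v : Coords n) (c : Fin n) :
    (fderiv ℝ (fun y => φ (ψ.symm y)) y v) c = ∑ k, jacobian ψ φ (ψ.symm y) c k * v k := by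
  conv_lhs => rw [← sum_smul_stdVec v]
  simp only [map_sum, map_smul, coords_sum_apply, PiLp.smul_apply, fderiv_transition_stdVec hy,
    smul_eq_mul, mul_comm]

theorem gLow_transform (hφ : φ ∈ smoothCharts n M) (hψ : ψ ∈ smoothCharts n M) {x : M}
    (hx : x ∈ φ.source) (hx' : x ∈ ψ.source) (i j : Fin n) :
    gLow g ψ i j (ψ x) =
      ∑ a, ∑ b, jacobian ψ φ x a i * jacobian ψ φ x b j * gLow g φ a b (φ x) := by
  have h1 := inner_eq_sum_gLow g φ (φ x) (fun a => jacobian ψ φ x a i)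
    (fun b => jacobian ψ φ x b j)
  rw [gLow]
  rw [φ.left_inv hx] at h1
  rw [ψ.left_inv hx', coordVec_eq_sum hφ hψ hx hx' i, coordVec_eq_sum hφ hψ hx hx' j, h1]
  exact Finset.sum_congr rfl fun a _ => Finset.sum_congr rfl fun b _ => by ring

/-- The matrix of the derivative of the change of coordinates. -/
def jacMat (ψ φ : LocalChart n M) (x : M) : Matrix (Fin n) (Fin n) ℝ :=
  Matrix.of fun a i => jacobian ψ φ x a i

theorem jacMat_mul_jacMat (hφ : φ ∈ smoothCharts n M) (hψ : ψ ∈ smoothCharts n M) {x : M}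
    (hx : x ∈ φ.source) (hx' : x ∈ ψ.source) : jacMat φ ψ x * jacMat ψ φ x = 1 := by
  ext i j
  rw [Matrix.mul_apply, Matrix.one_apply]
  exact sum_jacobian_mul_jacobian hφ hψ hx hx' i j

theorem gMat_transform (hφ : φ ∈ smoothCharts n M) (hψ : ψ ∈ smoothCharts n M) {x : M}
    (hx : x ∈ φ.source) (hx' : x ∈ ψ.source) :
    gMat g ψ (ψ x) = (jacMat ψ φ x).transpose * gMat g φ (φ x) * jacMat ψ φ x := by
  ext i j
  rw [gMat, Matrix.of_apply, gLow_transform g hφ hψ hx hx', Matrix.mul_apply]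
  simp only [Matrix.mul_apply, Finset.sum_mul, Matrix.transpose_apply, jacMat, gMat,
    Matrix.of_apply]
  rw [Finset.sum_comm]
  exact Finset.sum_congr rfl fun a _ => Finset.sum_congr rfl fun b _ => by ring

/-- The transformation law of the Christoffel symbols. -/
theorem christoffel_transform (hφ : φ ∈ smoothCharts n M) (hψ : ψ ∈ smoothCharts n M) {x : M}
    (hx : x ∈ φ.source) (hx' : x ∈ ψ.source) (h k i : Fin n) :
    christoffel g ψ h k i (ψ x) = ∑ d, jacobian φ ψ x h d * (hessian φ ψ d k i (ψ x)
      + ∑ e, (∑ c, christoffel g φ d c e (φ x) * jacobian ψ φ x c k) * jacobian ψ φ x e i) := by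
  have hy := ψ.map_source hx'
  have hy' : ψ.symm (ψ x) ∈ φ.source := by rwa [ψ.left_inv hx']
  -- The uniqueness of the symmetric array for which g is parallel reduces the law to two checks on
  -- the candidate, so the definition of the symbols is never expanded.
  refine christoffel_eq_of_parallel g hψ hy (fun h k i => ∑ d, jacobian φ ψ x h d *
    (hessian φ ψ d k i (ψ x) + ∑ e, (∑ c, christoffel g φ d c e (φ x) * jacobian ψ φ x c k)
      * jacobian ψ φ x e i)) ?_ ?_ h k i
  · intro h i j
    refine Finset.sum_congr rfl fun d _ => ?_
    rw [hessian_symm hφ hψ hy hy' d i j]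
    congr 2
    simp only [Finset.sum_mul]
    rw [Finset.sum_comm]
    refine Finset.sum_congr rfl fun a _ => Finset.sum_congr rfl fun b _ => ?_
    rw [christoffel_symm g φ d a b]
    ring
  · intro k i j
    -- In matrix form the new metric is JᵀGJ and the candidate connection matrix in the direction k
    -- is K(D + AJ), where K = J⁻¹, D is the k-derivative of J, and A is the old connection matrix
    -- in the direction ∂/∂y^k. Parallelism becomes the product rule for JᵀGJ combined with dG = AᵀG
    -- + (AᵀG)ᵀ.
    let J := jacMat ψ φ x
    let K := jacMat φ ψ x
    let D : Matrix (Fin n) (Fin n) ℝ := Matrix.of fun a i => hessian φ ψ a k i (ψ x)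
    let G := gMat g φ (φ x)
    let A : Matrix (Fin n) (Fin n) ℝ :=
      Matrix.of fun d e => ∑ c, christoffel g φ d c e (φ x) * jacobian ψ φ x c k
    have hJK : J * K = 1 := jacMat_mul_jacMat hψ hφ hx' hx
    have hGs : G.transpose = G := Matrix.ext fun a b => gLow_symm g φ b a _
    let dG : Matrix (Fin n) (Fin n) ℝ :=
      Matrix.of fun a b => fderiv ℝ (gLow g φ a b) (φ x)
        (fderiv ℝ (fun y => φ (ψ.symm y)) (ψ x) (stdVec k))
    have hdG : dG = A.transpose * G + (A.transpose * G).transpose := by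
      have e : ∀ a b, ∑ c, jacobian ψ φ x c k *
          ∑ h, christoffel g φ h c a (φ x) * gLow g φ h b (φ x) = (A.transpose * G) a b := by
        intro a b
        rw [Matrix.mul_apply]
        simp only [Matrix.transpose_apply, A, G, gMat, Matrix.of_apply, Finset.mul_sum,
          Finset.sum_mul]
        rw [Finset.sum_comm]
        exact Finset.sum_congr rfl fun c _ => Finset.sum_congr rfl fun d _ => by ring
      ext a b
      rw [Matrix.add_apply, Matrix.transpose_apply, ← e, ← e, ← Finset.sum_add_distrib]
      simp only [dG, Matrix.of_apply]
      rw [fderiv_eq_sum_pderivX]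
      refine Finset.sum_congr rfl fun c _ => ?_
      rw [fderiv_transition_stdVec hy, ψ.left_inv hx', pderivX_gLow g hφ (φ.map_source hx), mul_add]
    have hd : pderivX k (gLow g ψ i j) (ψ x) =
        (D.transpose * G * J + J.transpose * G * D + J.transpose * dG * J) i j := by
      have h1 : gLow g ψ i j =ᶠ[𝓝 (ψ x)] fun y => ∑ a, ∑ b, jacobian ψ φ (ψ.symm y) a i *
          jacobian ψ φ (ψ.symm y) b j * gLow g φ a b (φ (ψ.symm y)) := by
        have hopen : IsOpen (ψ.target ∩ ψ.symm ⁻¹' φ.source) :=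
          ψ.isOpen_inter_preimage_symm φ.open_source
        filter_upwards [hopen.mem_nhds ⟨hy, hy'⟩] with y hy
        have := gLow_transform g hφ hψ (x := ψ.symm y) hy.2 (ψ.map_target hy.1) i j
        rwa [ψ.right_inv hy.1] at this
      have hJd : ∀ a i, HasDirDeriv (fun y => jacobian ψ φ (ψ.symm y) a i) (ψ x) (stdVec k)
          (hessian φ ψ a k i (ψ x)) := fun a i =>
        ⟨(contDiffAt_jacobian hφ hψ hy hy' a i).differentiableAt (by simp), rfl⟩
      have hGd : ∀ a b, HasDirDeriv (fun y => gLow g φ a b (φ (ψ.symm y))) (ψ x) (stdVec k)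
          (dG a b) := by
        intro a b
        refine HasDirDeriv.comp_map (f := gLow g φ a b)
          ((contDiffAt_transition hφ hψ hy hy').differentiableAt (by simp)) ⟨?_, ?_⟩
        · exact (contDiffAt_gLow g hφ (φ.map_source hy') a b).differentiableAt (by simp)
        · simp only [dG, Matrix.of_apply]
          rw [ψ.left_inv hx']
      have h2 := (HasDirDeriv.sum (s := Finset.univ) fun a _ =>
        HasDirDeriv.sum (s := Finset.univ) fun b _ => ((hJd a i).mul (hJd b j)).mul (hGd a b))
      rw [pderivX, (h2.congr_fun h1).2]
      simp only [ψ.left_inv hx', Matrix.add_apply, Matrix.mul_apply, Matrix.transpose_apply,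
        Finset.sum_mul]
      rw [← Finset.sum_add_distrib, ← Finset.sum_add_distrib, Finset.sum_comm]
      refine Finset.sum_congr rfl fun a _ => ?_
      rw [← Finset.sum_add_distrib, ← Finset.sum_add_distrib]
      refine Finset.sum_congr rfl fun b _ => ?_
      simp only [D, G, J, jacMat, gMat, Matrix.of_apply]
      ring
    let B : Matrix (Fin n) (Fin n) ℝ := K * (D + A * J)
    have hB : ∀ i j, ∑ h, (∑ d, jacobian φ ψ x h d * (hessian φ ψ d k i (ψ x)
        + ∑ e, (∑ c, christoffel g φ d c e (φ x) * jacobian ψ φ x c k) * jacobian ψ φ x e i))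
          * gLow g ψ h j (ψ x) = (B.transpose * gMat g ψ (ψ x)) i j := by
      intro i j
      rw [Matrix.mul_apply]
      refine Finset.sum_congr rfl fun h _ => ?_
      change _ = (K * (D + A * J)) h i * _
      rw [Matrix.mul_apply]
      rfl
    have hB2 : B.transpose * gMat g ψ (ψ x) = (D + A * J).transpose * G * J := by
      rw [gMat_transform g hφ hψ hx hx', Matrix.transpose_mul]
      have e : K.transpose * J.transpose = 1 := by
        rw [← Matrix.transpose_mul, hJK, Matrix.transpose_one]
      calc (D + A * J).transpose * K.transpose * (J.transpose * G * J)
          = (D + A * J).transpose * (K.transpose * J.transpose) * G * J := by noncomm_ring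
        _ = _ := by rw [e, mul_one]
    rw [hB, hB, hd, hB2, ← Matrix.transpose_apply ((D + A * J).transpose * G * J) i j,
      ← Matrix.add_apply, hdG]
    refine congrFun (congrFun ?_ i) j
    simp only [Matrix.transpose_mul, Matrix.transpose_add, Matrix.transpose_transpose, hGs]
    noncomm_ring

end ChartChange

end

section

/-! ### Finite sums under linear changes of variables. -/

section Sums

variable {ι : Type*} [Fintype ι] [DecidableEq ι]

theorem sum_comm₄ (f : ι → ι → ι → ι → ℝ) :
    ∑ i, ∑ j, ∑ a, ∑ b, f i j a b = ∑ a, ∑ b, ∑ i, ∑ j, f i j a b := by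
  calc ∑ i, ∑ j, ∑ a, ∑ b, f i j a b = ∑ i, ∑ a, ∑ j, ∑ b, f i j a b :=
        Finset.sum_congr rfl fun i _ => Finset.sum_comm
    _ = ∑ a, ∑ i, ∑ b, ∑ j, f i j a b := by
        rw [Finset.sum_comm]
        exact Finset.sum_congr rfl fun a _ => Finset.sum_congr rfl fun i _ => Finset.sum_comm
    _ = _ := Finset.sum_congr rfl fun a _ => Finset.sum_comm

/-- Evaluation of a transformed bilinear form. -/
theorem sum_transform_mul (J G : ι → ι → ℝ) (u v : ι → ℝ) :
    ∑ i, ∑ j, (∑ a, ∑ b, J a i * J b j * G a b) * u i * v j =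
      ∑ a, ∑ b, G a b * (∑ i, J a i * u i) * ∑ j, J b j * v j := by
  simp only [Finset.sum_mul, Finset.mul_sum]
  rw [sum_comm₄]
  refine Finset.sum_congr rfl fun a _ => Finset.sum_congr rfl fun b _ => ?_
  rw [Finset.sum_comm]
  exact Finset.sum_congr rfl fun i _ => Finset.sum_congr rfl fun j _ => by ring

/-- Contraction of a transformed covector and a transformed vector. -/
theorem sum_transform_contract {J K : ι → ι → ℝ}
    (h : ∀ c d, ∑ k, J c k * K k d = if c = d then 1 else 0) (e f : ι → ℝ) :
    ∑ k, (∑ c, J c k * e c) * (∑ d, K k d * f d) = ∑ c, e c * f c := by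
  have h1 : ∀ k, (∑ c, J c k * e c) * (∑ d, K k d * f d) =
      ∑ c, e c * (J c k * ∑ d, K k d * f d) := fun k => by
    rw [Finset.sum_mul]
    exact Finset.sum_congr rfl fun c _ => by ring
  simp only [h1]
  rw [Finset.sum_comm]
  simp only [← Finset.mul_sum, sum_mul_sum_of_inverse h]

end Sums

variable {n : ℕ} {M : Type*} [TopologicalSpace M] [ChartedSpace (Coords n) M]

/-! ### Changes of induced charts and independence of the metric from the chart. -/

section PhaseChange

variable [IsManifold (𝓡 n) ∞ M] (g : RiemMetric n M) {φ ψ : LocalChart n M}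

/-- `z` and `z'` are the coordinates, in the charts induced from `φ` and `ψ`, of the same covector
at the point `x`. -/
structure Corresponds (φ ψ : LocalChart n M) (x : M) (z z' : PhaseCoords n) : Prop where
  left : x ∈ φ.source
  right : x ∈ ψ.source
  fst : z.1 = φ x
  fst' : z'.1 = ψ x
  snd' : ∀ j, z'.2 j = ∑ a, jacobian ψ φ x a j * z.2 a

theorem Corresponds.snd {x : M} {z z' : PhaseCoords n} (h : Corresponds φ ψ x z z')
    (hφ : φ ∈ smoothCharts n M) (hψ : ψ ∈ smoothCharts n M) (a : Fin n) :
    z.2 a = ∑ j, jacobian φ ψ x j a * z'.2 j := by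
  have h1 := sum_mul_sum_of_inverse (A := fun a j => jacobian φ ψ x j a)
    (B := fun j a => jacobian ψ φ x a j) (fun i j => by
      have := sum_jacobian_mul_jacobian hψ hφ h.right h.left j i
      simp only [mul_comm (jacobian φ ψ x _ i), this, eq_comm]) (fun a => z.2 a) a
  rw [← h1]
  simp only [h.snd']

theorem Corresponds.symm {x : M} {z z' : PhaseCoords n} (h : Corresponds φ ψ x z z')
    (hφ : φ ∈ smoothCharts n M) (hψ : ψ ∈ smoothCharts n M) : Corresponds ψ φ x z' z :=
  ⟨h.right, h.left, h.fst', h.fst, h.snd hφ hψ⟩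

theorem corresponds_inducedChart (hφ : φ ∈ smoothCharts n M) (hψ : ψ ∈ smoothCharts n M)
    {ξ : Cotangent n M} (hx : ξ.proj ∈ φ.source) (hx' : ξ.proj ∈ ψ.source) :
    Corresponds φ ψ ξ.proj (inducedChart φ ξ) (inducedChart ψ ξ) := by
  refine ⟨hx, hx', rfl, rfl, fun j => ?_⟩
  change (ξ.snd (coordVec ψ j ξ.proj) : ℝ) =
    ∑ a, jacobian ψ φ ξ.proj a j * (ξ.snd (coordVec φ a ξ.proj) : ℝ)
  rw [coordVec_eq_sum hφ hψ hx hx' j, map_sum]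
  exact Finset.sum_congr rfl fun a _ => by rw [map_smul]; rfl

theorem inducedChart_mem_phaseDomain (hφ : φ ∈ smoothCharts n M)
    {ξ : Cotangent n M} (hx : ξ.proj ∈ φ.source) (hξ : ξ ∈ nonzeroCotangent n M) :
    inducedChart φ ξ ∈ phaseDomain φ := by
  refine ⟨φ.map_source hx, fun h => hξ ?_⟩
  ext v
  rw [sum_smul_coordVec hφ hx v, map_sum]
  refine Finset.sum_eq_zero fun a _ => ?_
  rw [map_smul]
  have : (ξ.snd (coordVec φ a ξ.proj) : ℝ) = 0 := congrFun (congrArg WithLp.ofLp h) a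
  exact (congrArg (fun r : ℝ => chartDeriv φ ξ.proj v a • r) this).trans (smul_zero _)

variable {x : M} {z z' : PhaseCoords n}

/-- The inverse of JᵀGJ is K G⁻¹ Kᵀ, with K the inverse Jacobian. -/
theorem gUp_transform (hφ : φ ∈ smoothCharts n M) (hψ : ψ ∈ smoothCharts n M) {x : M}
    (hx : x ∈ φ.source) (hx' : x ∈ ψ.source) (i j : Fin n) :
    gUp g ψ i j (ψ x) =
      ∑ a, ∑ b, jacobian φ ψ x i a * jacobian φ ψ x j b * gUp g φ a b (φ x) := by
  have h1 := gMat_transform g hφ hψ hx hx'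
  have hJK := jacMat_mul_jacMat hψ hφ hx' hx
  have hKJ := jacMat_mul_jacMat hφ hψ hx hx'
  have hG := Matrix.mul_nonsing_inv _ (isUnit_det_gMat g hφ (φ.map_source hx))
  set J := jacMat ψ φ x
  set K := jacMat φ ψ x with hK
  set G := gMat g φ (φ x) with hGdef
  have hJK' : J.transpose * K.transpose = 1 := by
    rw [← Matrix.transpose_mul, hKJ, Matrix.transpose_one]
  have h2 : (gMat g ψ (ψ x))⁻¹ = K * G⁻¹ * K.transpose := by
    apply Matrix.inv_eq_right_inv
    rw [h1]
    calc J.transpose * G * J * (K * G⁻¹ * K.transpose)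
        = J.transpose * (G * ((J * K) * G⁻¹)) * K.transpose := by noncomm_ring
      _ = 1 := by rw [hJK, one_mul, hG, mul_one, hJK']
  have h3 : gUp g ψ i j (ψ x) = (K * G⁻¹ * K.transpose) i j := by
    rw [← h2]; rfl
  rw [h3]
  simp only [Matrix.mul_apply, Finset.sum_mul, Matrix.transpose_apply]
  rw [Finset.sum_comm]
  refine Finset.sum_congr rfl fun a _ => Finset.sum_congr rfl fun b _ => ?_
  simp only [hK, jacMat, Matrix.of_apply]
  change _ * gUp g φ a b (φ x) * _ = _
  ring

theorem gZero_transform (hφ : φ ∈ smoothCharts n M) (hψ : ψ ∈ smoothCharts n M)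
    (h : Corresponds φ ψ x z z') (i : Fin n) :
    gZero g ψ i z' = ∑ a, jacobian φ ψ x i a * gZero g φ a z := by
  rw [← sum_gUp_mul_momentum, h.fst']
  simp only [gUp_transform g hφ hψ h.left h.right, Finset.sum_mul]
  rw [Finset.sum_comm]
  refine Finset.sum_congr rfl fun a _ => ?_
  rw [← sum_gUp_mul_momentum, Finset.sum_comm, Finset.mul_sum]
  refine Finset.sum_congr rfl fun b _ => ?_
  rw [h.snd hφ hψ b, Finset.mul_sum, Finset.mul_sum, h.fst]
  exact Finset.sum_congr rfl fun c _ => by ring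

theorem energy_transform (hφ : φ ∈ smoothCharts n M) (hψ : ψ ∈ smoothCharts n M)
    (h : Corresponds φ ψ x z z') : energy g ψ z' = energy g φ z := by
  have h1 : ∑ k, z'.2 k * gZero g ψ k z' = ∑ a, z.2 a * gZero g φ a z := by
    simp only [h.snd', gZero_transform g hφ hψ h]
    exact sum_transform_contract (sum_jacobian_mul_jacobian hψ hφ h.right h.left) _ _
  rw [energy_eq, energy_eq, h1]

/-- All four blocks `G₁`, `G₂`, `H₁`, `H₂` have the shape A·G + B·u ⊗ v with scalars A, B invariant
under chart changes, so this one computation serves each of them. -/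
theorem sum_mul_mul_transform {ι : Type*} [Fintype ι] (J : ι → ι → ℝ) (A B : ℝ) (G : ι → ι → ℝ)
    (u v : ι → ℝ) (i j : ι) :
    A * (∑ a, ∑ b, J a i * J b j * G a b) + B * (∑ a, J a i * u a) * (∑ b, J b j * v b) =
      ∑ a, ∑ b, J a i * J b j * (A * G a b + B * u a * v b) := by
  rw [mul_assoc, Finset.sum_mul_sum, Finset.mul_sum, Finset.mul_sum, ← Finset.sum_add_distrib]
  refine Finset.sum_congr rfl fun a _ => ?_
  rw [Finset.mul_sum, Finset.mul_sum, ← Finset.sum_add_distrib]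
  exact Finset.sum_congr rfl fun b _ => by ring

theorem G₁_transform (hφ : φ ∈ smoothCharts n M) (hψ : ψ ∈ smoothCharts n M)
    (h : Corresponds φ ψ x z z') (c₁ d₁ : ℝ → ℝ) (i j : Fin n) :
    G₁ g c₁ d₁ ψ i j z' =
      ∑ a, ∑ b, jacobian ψ φ x a i * jacobian ψ φ x b j * G₁ g c₁ d₁ φ a b z := by
  simp only [G₁, energy_transform g hφ hψ h, h.fst', h.fst, h.snd',
    gLow_transform g hφ hψ h.left h.right]
  exact sum_mul_mul_transform (jacobian ψ φ x) _ _ (fun a b => gLow g φ a b (φ x)) _ _ i j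

theorem G₂_transform (hφ : φ ∈ smoothCharts n M) (hψ : ψ ∈ smoothCharts n M)
    (h : Corresponds φ ψ x z z') (c₂ d₂ : ℝ → ℝ) (i j : Fin n) :
    G₂ g c₂ d₂ ψ i j z' =
      ∑ a, ∑ b, jacobian φ ψ x i a * jacobian φ ψ x j b * G₂ g c₂ d₂ φ a b z := by
  simp only [G₂, energy_transform g hφ hψ h, h.fst', h.fst, gZero_transform g hφ hψ h,
    gUp_transform g hφ hψ h.left h.right]
  exact sum_mul_mul_transform (fun a i => jacobian φ ψ x i a) _ _
    (fun a b => gUp g φ a b (φ x)) _ _ i j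

theorem H₁_transform (hφ : φ ∈ smoothCharts n M) (hψ : ψ ∈ smoothCharts n M)
    (h : Corresponds φ ψ x z z') (c₁ d₁ : ℝ → ℝ) (i j : Fin n) :
    H₁ g c₁ d₁ ψ i j z' =
      ∑ a, ∑ b, jacobian φ ψ x i a * jacobian φ ψ x j b * H₁ g c₁ d₁ φ a b z := by
  simp only [H₁, energy_transform g hφ hψ h, h.fst', h.fst, gZero_transform g hφ hψ h,
    gUp_transform g hφ hψ h.left h.right, sub_eq_add_neg, ← neg_mul]
  exact sum_mul_mul_transform (fun a i => jacobian φ ψ x i a) _ _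
    (fun a b => gUp g φ a b (φ x)) _ _ i j

theorem H₂_transform (hφ : φ ∈ smoothCharts n M) (hψ : ψ ∈ smoothCharts n M)
    (h : Corresponds φ ψ x z z') (c₂ d₂ : ℝ → ℝ) (i j : Fin n) :
    H₂ g c₂ d₂ ψ i j z' =
      ∑ a, ∑ b, jacobian ψ φ x a i * jacobian ψ φ x b j * H₂ g c₂ d₂ φ a b z := by
  simp only [H₂, energy_transform g hφ hψ h, h.fst', h.fst, h.snd',
    gLow_transform g hφ hψ h.left h.right, sub_eq_add_neg, ← neg_mul]
  exact sum_mul_mul_transform (jacobian ψ φ x) _ _ (fun a b => gLow g φ a b (φ x)) _ _ i j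

/-- The Hessian term measures the failure of Γ^0 to be tensorial; it will cancel against the
derivative of the Jacobian in the transformation of dp. -/
theorem christoffelZero_transform (hφ : φ ∈ smoothCharts n M) (hψ : ψ ∈ smoothCharts n M)
    (h : Corresponds φ ψ x z z') (k i : Fin n) :
    christoffelZero g ψ k i z' = ∑ d, z.2 d * hessian φ ψ d k i (ψ x)
      + ∑ a, ∑ b, jacobian ψ φ x a k * jacobian ψ φ x b i * christoffelZero g φ a b z := by
  simp only [christoffelZero, h.fst', h.fst, christoffel_transform g hφ hψ h.left h.right, h.snd']
  rw [sum_transform_contract (sum_jacobian_mul_jacobian hψ hφ h.right h.left)]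
  simp only [mul_add, Finset.sum_add_distrib]
  congr 1
  simp only [Finset.mul_sum, Finset.sum_mul]
  rw [Finset.sum_comm]
  calc ∑ e, ∑ d, ∑ c, z.2 d * (christoffel g φ d c e (φ x) * jacobian ψ φ x c k
          * jacobian ψ φ x e i)
      = ∑ e, ∑ c, ∑ d, z.2 d * (christoffel g φ d c e (φ x) * jacobian ψ φ x c k
          * jacobian ψ φ x e i) := Finset.sum_congr rfl fun e _ => Finset.sum_comm
    _ = _ := by
      rw [Finset.sum_comm]
      refine Finset.sum_congr rfl fun c _ => Finset.sum_congr rfl fun e _ =>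
        Finset.sum_congr rfl fun d _ => ?_
      ring

/-- The change between induced charts. -/
def phaseChange (φ ψ : LocalChart n M) (z : PhaseCoords n) : PhaseCoords n :=
  (ψ (φ.symm z.1), WithLp.toLp 2 fun j => ∑ a, jacobian ψ φ (φ.symm z.1) a j * z.2 a)

theorem contDiffAt_jacobian_symm (hφ : φ ∈ smoothCharts n M) (hψ : ψ ∈ smoothCharts n M)
    (hx : x ∈ φ.source) (hx' : x ∈ ψ.source) (a i : Fin n) :
    ContDiffAt ℝ ∞ (fun y => jacobian ψ φ (φ.symm y) a i) (φ x) := by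
  have h1 : ContDiffAt ℝ ∞ (fun y => ψ (φ.symm y)) (φ x) :=
    contDiffAt_transition hψ hφ (φ.map_source hx) (by rwa [φ.left_inv hx])
  have h2 := contDiffAt_jacobian hφ hψ (ψ.map_source hx') (by rwa [ψ.left_inv hx']) a i
  have h3 : ContDiffAt ℝ ∞ (fun y => jacobian ψ φ (ψ.symm (ψ (φ.symm y))) a i) (φ x) := by
    refine ContDiffAt.comp (φ x) (g := fun y => jacobian ψ φ (ψ.symm y) a i) ?_ h1
    rwa [φ.left_inv hx]
  refine h3.congr_of_eventuallyEq ?_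
  have hopen := φ.isOpen_inter_preimage_symm ψ.open_source
  filter_upwards [hopen.mem_nhds ⟨φ.map_source hx, by
    change φ.symm (φ x) ∈ ψ.source; rwa [φ.left_inv hx]⟩] with y hy
  rw [ψ.left_inv hy.2]

/-- The Jacobian is differentiated in φ-coordinates while `hessian` refers to ψ-coordinates; writing
φ⁻¹(y) as ψ⁻¹(ψ(φ⁻¹(y))) brings in the transition map, and the chain rule converts the direction. -/
theorem fderiv_jacobian_symm (hφ : φ ∈ smoothCharts n M) (hψ : ψ ∈ smoothCharts n M)
    (hx : x ∈ φ.source) (hx' : x ∈ ψ.source) (a i : Fin n) (w : Coords n) :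
    fderiv ℝ (fun y => jacobian ψ φ (φ.symm y) a i) (φ x) w =
      ∑ k, (∑ b, jacobian φ ψ x k b * w b) * hessian φ ψ a k i (ψ x) := by
  have h1 : ContDiffAt ℝ ∞ (fun y => ψ (φ.symm y)) (φ x) :=
    contDiffAt_transition hψ hφ (φ.map_source hx) (by rwa [φ.left_inv hx])
  have h2 := contDiffAt_jacobian hφ hψ (ψ.map_source hx') (by rwa [ψ.left_inv hx']) a i
  have h3 : (fun y => jacobian ψ φ (φ.symm y) a i) =ᶠ[𝓝 (φ x)]
      fun y => jacobian ψ φ (ψ.symm (ψ (φ.symm y))) a i := by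
    have hopen := φ.isOpen_inter_preimage_symm ψ.open_source
    filter_upwards [hopen.mem_nhds ⟨φ.map_source hx, by
      change φ.symm (φ x) ∈ ψ.source; rwa [φ.left_inv hx]⟩] with y hy
    rw [ψ.left_inv hy.2]
  rw [h3.fderiv_eq]
  have h4 : HasDirDeriv (fun y => jacobian ψ φ (ψ.symm (ψ (φ.symm y))) a i) (φ x) w
      (fderiv ℝ (fun y => jacobian ψ φ (ψ.symm y) a i) (ψ x)
        (fderiv ℝ (fun y => ψ (φ.symm y)) (φ x) w)) := by
    refine HasDirDeriv.comp_map (f := fun y => jacobian ψ φ (ψ.symm y) a i)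
      (h1.differentiableAt (by simp)) ?_
    rw [φ.left_inv hx]
    exact ⟨h2.differentiableAt (by simp), rfl⟩
  rw [h4.2, fderiv_eq_sum_pderivX]
  refine Finset.sum_congr rfl fun k _ => ?_
  rw [fderiv_transition_apply (φ.map_source hx), φ.left_inv hx]
  rfl

theorem differentiableAt_phaseChange (hφ : φ ∈ smoothCharts n M) (hψ : ψ ∈ smoothCharts n M)
    {ξ : Cotangent n M} (hx : ξ.proj ∈ φ.source) (hx' : ξ.proj ∈ ψ.source) :
    DifferentiableAt ℝ (phaseChange φ ψ) (inducedChart φ ξ) := by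
  have h1 : ContDiffAt ℝ ∞ (fun y => ψ (φ.symm y)) (φ ξ.proj) :=
    contDiffAt_transition hψ hφ (φ.map_source hx) (by rwa [φ.left_inv hx])
  have h : ContDiffAt ℝ ∞ (phaseChange φ ψ) (inducedChart φ ξ) := by
    refine ContDiffAt.prodMk (ContDiffAt.comp (inducedChart φ ξ)
      (g := fun y => ψ (φ.symm y)) (f := Prod.fst) h1 contDiffAt_fst) ?_
    rw [contDiffAt_euclidean]
    intro i
    exact ContDiffAt.sum (s := Finset.univ)
      (f := fun a (z : PhaseCoords n) => jacobian ψ φ (φ.symm z.1) a i * z.2 a)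
      fun a _ => (contDiffAt_base (z := inducedChart φ ξ)
        (contDiffAt_jacobian_symm hφ hψ hx hx' a i)).mul (contDiffAt_momentum a)
  exact h.differentiableAt (by simp)

theorem phaseDeriv_eq_fderiv_phaseChange (hφ : φ ∈ smoothCharts n M) (hψ : ψ ∈ smoothCharts n M)
    {ξ : Cotangent n M} (hx : ξ.proj ∈ φ.source) (hx' : ξ.proj ∈ ψ.source)
    (v : TangentSpace (cotModel n) ξ) :
    phaseDeriv ψ ξ v = fderiv ℝ (phaseChange φ ψ) (inducedChart φ ξ) (phaseDeriv φ ξ v) := by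
  have h1 := (differentiableAt_phaseChange hφ hψ hx hx').hasFDerivAt.hasMFDerivAt.comp ξ
    (hasMFDerivAt_inducedChart hφ hx)
  have h2 := HasMFDerivAt.congr_of_eventuallyEq h1 (f₁ := inducedChart ψ) (by
    filter_upwards [proj_mem_nhds hx, proj_mem_nhds hx'] with η hη hη'
    have h := corresponds_inducedChart hφ hψ hη hη'
    have e : φ.symm (inducedChart φ η).1 = η.proj := φ.left_inv hη
    refine Prod.ext ?_ ?_
    · simp only [Function.comp, phaseChange, e]
      rfl
    · ext j
      simp only [Function.comp, phaseChange, e]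
      exact h.snd' j)
  exact congrArg (fun L => L v) (hasMFDerivAt_unique (hasMFDerivAt_inducedChart hψ hx') h2)

theorem phaseDeriv_fst (hφ : φ ∈ smoothCharts n M) (hψ : ψ ∈ smoothCharts n M)
    {ξ : Cotangent n M} (hx : ξ.proj ∈ φ.source) (hx' : ξ.proj ∈ ψ.source)
    (v : TangentSpace (cotModel n) ξ) (i : Fin n) :
    (phaseDeriv ψ ξ v).1 i = ∑ a, jacobian φ ψ ξ.proj i a * (phaseDeriv φ ξ v).1 a := by
  have hT := differentiableAt_phaseChange hφ hψ hx hx'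
  rw [phaseDeriv_eq_fderiv_phaseChange hφ hψ hx hx']
  have h1 := ((EuclideanSpace.proj i : Coords n →L[ℝ] ℝ).comp
    (ContinuousLinearMap.fst ℝ (Coords n) (Coords n))).hasFDerivAt.comp _ hT.hasFDerivAt
  have h2 : HasDirDeriv (fun z : PhaseCoords n => (ψ (φ.symm z.1)) i) (inducedChart φ ξ)
      (phaseDeriv φ ξ v) (∑ a, jacobian φ ψ ξ.proj i a * (phaseDeriv φ ξ v).1 a) := by
    have h3 : ContDiffAt ℝ ∞ (fun y => ψ (φ.symm y)) (φ ξ.proj) :=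
      contDiffAt_transition hψ hφ (φ.map_source hx) (by rwa [φ.left_inv hx])
    have h4 : HasFDerivAt (fun y => (ψ (φ.symm y)) i) _ (φ ξ.proj) :=
      (EuclideanSpace.proj i : Coords n →L[ℝ] ℝ).hasFDerivAt.comp _
        (h3.differentiableAt (by simp)).hasFDerivAt
    refine (HasDirDeriv.base (z := inducedChart φ ξ) h4.differentiableAt).congr_deriv ?_
    have h5 := fderiv_transition_apply (φ := ψ) (φ.map_source hx) (phaseDeriv φ ξ v).1 i
    rw [φ.left_inv hx] at h5
    rw [← h5]
    exact congrArg (fun L => L (phaseDeriv φ ξ v).1) h4.fderiv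
  rw [← h2.2]
  exact (congrArg (fun L => L (phaseDeriv φ ξ v)) h1.fderiv).symm

/-- Product rule for p'_j = (∂x^a/∂y^j) p_a; the derivative of the Jacobian contributes the Hessian.
-/
theorem phaseDeriv_snd (hφ : φ ∈ smoothCharts n M) (hψ : ψ ∈ smoothCharts n M)
    {ξ : Cotangent n M} (hx : ξ.proj ∈ φ.source) (hx' : ξ.proj ∈ ψ.source)
    (v : TangentSpace (cotModel n) ξ) (j : Fin n) :
    (phaseDeriv ψ ξ v).2 j = ∑ a, ((∑ k, (phaseDeriv ψ ξ v).1 k *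
        hessian φ ψ a k j (ψ ξ.proj)) * (inducedChart φ ξ).2 a
      + jacobian ψ φ ξ.proj a j * (phaseDeriv φ ξ v).2 a) := by
  have hT := differentiableAt_phaseChange hφ hψ hx hx'
  simp only [phaseDeriv_fst hφ hψ hx hx']
  rw [phaseDeriv_eq_fderiv_phaseChange hφ hψ hx hx']
  have h1 := ((EuclideanSpace.proj j : Coords n →L[ℝ] ℝ).comp
    (ContinuousLinearMap.snd ℝ (Coords n) (Coords n))).hasFDerivAt.comp _ hT.hasFDerivAt
  have h2 := HasDirDeriv.sum (s := Finset.univ) fun a _ => (HasDirDeriv.base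
    (z := inducedChart φ ξ) (v := phaseDeriv φ ξ v)
    ((contDiffAt_jacobian_symm hφ hψ hx hx' a j).differentiableAt (by simp))).mul
    (HasDirDeriv.momentum a)
  have e' : (inducedChart φ ξ).1 = φ ξ.proj := rfl
  simp only [e', φ.left_inv hx, fderiv_jacobian_symm hφ hψ hx hx'] at h2
  rw [← h2.2]
  exact (congrArg (fun L => L (phaseDeriv φ ξ v)) h1.fderiv).symm

/-- The Hessian terms of dp' and of Γ^0 dq cancel by symmetry of second derivatives. This is what
makes the horizontal distribution, and hence the metric, independent of the chart. -/
theorem absDiffP_transform (hφ : φ ∈ smoothCharts n M) (hψ : ψ ∈ smoothCharts n M)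
    {ξ : Cotangent n M} (hx : ξ.proj ∈ φ.source) (hx' : ξ.proj ∈ ψ.source)
    (v : TangentSpace (cotModel n) ξ) (j : Fin n) :
    absDiffP g ψ (inducedChart ψ ξ) (phaseDeriv ψ ξ v) j =
      ∑ a, jacobian ψ φ ξ.proj a j * absDiffP g φ (inducedChart φ ξ) (phaseDeriv φ ξ v) a := by
  have hC := corresponds_inducedChart hφ hψ hx hx'
  have hy := ψ.map_source hx'
  have hy' : ψ.symm (ψ ξ.proj) ∈ φ.source := by rwa [ψ.left_inv hx']
  rw [absDiffP, phaseDeriv_snd hφ hψ hx hx']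
  simp only [absDiffP, christoffelZero_transform g hφ hψ hC, mul_sub, Finset.sum_sub_distrib,
    Finset.sum_add_distrib, add_mul]
  have e1 : ∑ a, (∑ k, (phaseDeriv ψ ξ v).1 k * hessian φ ψ a k j (ψ ξ.proj))
      * (inducedChart φ ξ).2 a =
      ∑ k, (∑ d, (inducedChart φ ξ).2 d * hessian φ ψ d j k (ψ ξ.proj))
        * (phaseDeriv ψ ξ v).1 k := by
    simp only [Finset.sum_mul]
    rw [Finset.sum_comm]
    refine Finset.sum_congr rfl fun k _ => Finset.sum_congr rfl fun d _ => ?_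
    rw [hessian_symm hφ hψ hy hy' d k j]
    ring
  have e2 : ∑ k, (∑ a, ∑ b, jacobian ψ φ ξ.proj a j * jacobian ψ φ ξ.proj b k *
        christoffelZero g φ a b (inducedChart φ ξ)) * (phaseDeriv ψ ξ v).1 k =
      ∑ a, jacobian ψ φ ξ.proj a j * ∑ b, christoffelZero g φ a b (inducedChart φ ξ) *
        (phaseDeriv φ ξ v).1 b := by
    simp only [phaseDeriv_fst hψ hφ hx' hx v, Finset.mul_sum, Finset.sum_mul]
    rw [Finset.sum_comm]
    refine Finset.sum_congr rfl fun a _ => ?_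
    rw [Finset.sum_comm]
    exact Finset.sum_congr rfl fun b _ => Finset.sum_congr rfl fun k _ => by ring
  rw [e1, e2]
  ring

theorem diagMetricCoord_transform (hφ : φ ∈ smoothCharts n M) (hψ : ψ ∈ smoothCharts n M)
    {ξ : Cotangent n M} (hx : ξ.proj ∈ φ.source) (hx' : ξ.proj ∈ ψ.source)
    (v w : TangentSpace (cotModel n) ξ) (c₁ c₂ d₁ d₂ : ℝ → ℝ) :
    diagMetricCoord g c₁ c₂ d₁ d₂ ψ (inducedChart ψ ξ) (phaseDeriv ψ ξ v) (phaseDeriv ψ ξ w) =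
      diagMetricCoord g c₁ c₂ d₁ d₂ φ (inducedChart φ ξ) (phaseDeriv φ ξ v)
        (phaseDeriv φ ξ w) := by
  have hC := corresponds_inducedChart hφ hψ hx hx'
  rw [diagMetricCoord, diagMetricCoord]
  simp only [G₁_transform g hφ hψ hC, G₂_transform g hφ hψ hC]
  rw [sum_transform_mul, sum_transform_mul (fun a i => jacobian φ ψ ξ.proj i a)]
  simp only [← phaseDeriv_fst hψ hφ hx' hx, ← absDiffP_transform g hψ hφ hx' hx]

/-- The natural metric in an arbitrary induced chart. -/
theorem diagMetric_eq (hφ : φ ∈ smoothCharts n M) {ξ : Cotangent n M} (hx : ξ.proj ∈ φ.source)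
    (c₁ c₂ d₁ d₂ : ℝ → ℝ) (v w : TangentSpace (cotModel n) ξ) :
    diagMetric g c₁ c₂ d₁ d₂ ξ v w =
      diagMetricCoord g c₁ c₂ d₁ d₂ φ (inducedChart φ ξ) (phaseDeriv φ ξ v)
        (phaseDeriv φ ξ w) :=
  diagMetricCoord_transform g hφ (IsManifold.chart_mem_maximalAtlas ξ.proj) hx
    (mem_chart_source _ _) v w c₁ c₂ d₁ d₂

end PhaseChange

end

section

/-! ### The Koszul formula on an open set. -/

section Koszul

/-- The Koszul formula. -/
theorem IsLeviCivitaOn.koszul {E : Type*} [NormedAddCommGroup E] [NormedSpace ℝ E]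
    {H : Type*} [TopologicalSpace H] {I : ModelWithCorners ℝ E H}
    {N : Type*} [TopologicalSpace N] [ChartedSpace H N] [IsManifold I 1 N] {s : Set N}
    {G : (x : N) → TangentSpace I x → TangentSpace I x → ℝ}
    {nabla : ((x : N) → TangentSpace I x) →
      ((x : N) → TangentSpace I x →L[ℝ] TangentSpace I x)}
    (h : IsLeviCivitaOn I s G nabla) {x : N} (hx : x ∈ s)
    (hsymm : ∀ v w, G x v w = G x w v) (hsub : ∀ u v w, G x (u - v) w = G x u w - G x v w)
    {X Y Z : (x : N) → TangentSpace I x}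
    (hX : MDifferentiableAt I I.tangent (fun y => (⟨y, X y⟩ : TangentBundle I N)) x)
    (hY : MDifferentiableAt I I.tangent (fun y => (⟨y, Y y⟩ : TangentBundle I N)) x)
    (hZ : MDifferentiableAt I I.tangent (fun y => (⟨y, Z y⟩ : TangentBundle I N)) x)
    {a b c : ℝ} (ha : mfderiv I 𝓘(ℝ, ℝ) (fun y => G y (Y y) (Z y)) x (X x) = a)
    (hb : mfderiv I 𝓘(ℝ, ℝ) (fun y => G y (X y) (Z y)) x (Y x) = b)
    (hc : mfderiv I 𝓘(ℝ, ℝ) (fun y => G y (X y) (Y y)) x (Z x) = c) :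
    2 * G x (nabla Y x (X x)) (Z x) =
      a + b - c + G x (VectorField.mlieBracket I X Y x) (Z x)
      - G x (VectorField.mlieBracket I X Z x) (Y x)
      - G x (VectorField.mlieBracket I Y Z x) (X x) := by
  have m1 : a = _ := ha.symm.trans (h.metric Y Z x hx hY hZ (X x))
  have m2 : b = _ := hb.symm.trans (h.metric X Z x hx hX hZ (Y x))
  have m3 : c = _ := hc.symm.trans (h.metric X Y x hx hX hY (Z x))
  rw [← h.torsion_free X Y x hx hX hY, ← h.torsion_free X Z x hx hX hZ,
    ← h.torsion_free Y Z x hx hY hZ, hsub, hsub, hsub]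
  rw [hsymm (Y x) (nabla Z x (X x))] at m1
  rw [hsymm (X x) (nabla Z x (Y x))] at m2
  rw [hsymm (X x) (nabla Y x (Z x))] at m3
  -- With brackets replaced by differences of covariant derivatives, the combination of the three
  -- metric identities leaves only 2 G(∇_X Y, Z).
  linear_combination -m1 - m2 + m3

end Koszul

variable {n : ℕ} {M : Type*} [TopologicalSpace M] [ChartedSpace (Coords n) M]

/-! ### The adapted frame: components, orthogonality, nondegeneracy and brackets. -/

section Frames

variable [IsManifold (𝓡 n) ∞ M] (g : RiemMetric n M) {φ : LocalChart n M} {ξ : Cotangent n M}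

/-- The components of a tangent vector along the horizontal frame fields. -/
def horizComp (φ : LocalChart n M) (ξ : Cotangent n M) :
    TangentSpace (cotModel n) ξ →ₗ[ℝ] (Fin n → ℝ) where
  toFun v i := (phaseDeriv φ ξ v).1 i
  map_add' v w := by
    ext i
    rw [ContinuousLinearMap.map_add]
    rfl
  map_smul' r v := by
    ext i
    rw [ContinuousLinearMap.map_smul]
    rfl

/-- The components of a tangent vector along the vertical frame fields. -/
def vertComp (φ : LocalChart n M) (ξ : Cotangent n M) :
    TangentSpace (cotModel n) ξ →ₗ[ℝ] (Fin n → ℝ) where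
  toFun v i := absDiffP g φ (inducedChart φ ξ) (phaseDeriv φ ξ v) i
  map_add' v w := by
    ext i
    simp only [absDiffP, ContinuousLinearMap.map_add, Prod.snd_add, Prod.fst_add, PiLp.add_apply, Pi.add_apply,
      mul_add, Finset.sum_add_distrib]
    ring
  map_smul' r v := by
    ext i
    simp only [absDiffP, ContinuousLinearMap.map_smul, Prod.smul_snd, Prod.smul_fst, PiLp.smul_apply, Pi.smul_apply,
      smul_eq_mul, mul_sub, Finset.mul_sum, RingHom.id_apply]
    congr 1
    exact Finset.sum_congr rfl fun j _ => by ring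

/-- For a vector without base component Dp reduces to dp. Every bracket of frame fields is of this
kind. -/
theorem vertComp_of_phaseDeriv {v : TangentSpace (cotModel n) ξ} {w : Fin n → ℝ}
    (h : phaseDeriv φ ξ v = (0, WithLp.toLp 2 w)) :
    horizComp φ ξ v = 0 ∧ vertComp g φ ξ v = w := by
  constructor
  · ext i
    change (phaseDeriv φ ξ v).1 i = 0
    rw [h]
    rfl
  · ext i
    change absDiffP g φ (inducedChart φ ξ) (phaseDeriv φ ξ v) i = w i
    rw [h]
    simp [absDiffP]

theorem phaseDeriv_frameP (hφ : φ ∈ smoothCharts n M) (hx : ξ.proj ∈ φ.source) (i : Fin n) :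
    phaseDeriv φ ξ (frameP φ i ξ) = vertVec i :=
  phaseDeriv_liftField hφ hx fun _ => vertVec i

theorem phaseDeriv_frameQ (hφ : φ ∈ smoothCharts n M) (hx : ξ.proj ∈ φ.source) (i : Fin n) :
    phaseDeriv φ ξ (frameQ g φ i ξ) = horizVec g φ i (inducedChart φ ξ) :=
  phaseDeriv_liftField hφ hx (horizVec g φ i)

theorem horizComp_frameP (hφ : φ ∈ smoothCharts n M) (hx : ξ.proj ∈ φ.source) (i : Fin n) :
    horizComp φ ξ (frameP φ i ξ) = 0 := by
  ext j
  change (phaseDeriv φ ξ (frameP φ i ξ)).1 j = 0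
  rw [phaseDeriv_frameP hφ hx]
  rfl

theorem vertComp_frameP (hφ : φ ∈ smoothCharts n M) (hx : ξ.proj ∈ φ.source) (i : Fin n) :
    vertComp g φ ξ (frameP φ i ξ) = Pi.single i 1 := by
  rw [(vertComp_of_phaseDeriv g (w := fun j => (stdVec i : Coords n) j)
    (phaseDeriv_frameP hφ hx i)).2]
  ext j
  rw [stdVec_apply, Pi.single_apply]

theorem horizComp_frameQ (hφ : φ ∈ smoothCharts n M) (hx : ξ.proj ∈ φ.source) (i : Fin n) :
    horizComp φ ξ (frameQ g φ i ξ) = Pi.single i 1 := by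
  ext j
  change (phaseDeriv φ ξ (frameQ g φ i ξ)).1 j = _
  rw [phaseDeriv_frameQ g hφ hx, horizVec_fst, stdVec_apply, Pi.single_apply]

theorem vertComp_frameQ (hφ : φ ∈ smoothCharts n M) (hx : ξ.proj ∈ φ.source) (i : Fin n) :
    vertComp g φ ξ (frameQ g φ i ξ) = 0 := by
  ext j
  change absDiffP g φ (inducedChart φ ξ) (phaseDeriv φ ξ (frameQ g φ i ξ)) j = 0
  rw [phaseDeriv_frameQ g hφ hx, absDiffP, horizVec_snd]
  simp only [horizVec_fst, stdVec_apply, mul_ite, mul_one, mul_zero, Finset.sum_ite_eq',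
    Finset.mem_univ, if_true]
  rw [christoffelZero_symm, sub_self]

theorem eq_of_components (hφ : φ ∈ smoothCharts n M) (hx : ξ.proj ∈ φ.source)
    {v w : TangentSpace (cotModel n) ξ} (h1 : horizComp φ ξ v = horizComp φ ξ w)
    (h2 : vertComp g φ ξ v = vertComp g φ ξ w) : v = w := by
  apply phaseDeriv_injective hφ hx
  have h1' : (phaseDeriv φ ξ v).1 = (phaseDeriv φ ξ w).1 := by
    ext i
    exact congrFun h1 i
  refine Prod.ext h1' ?_
  ext i
  have h3 : absDiffP g φ (inducedChart φ ξ) (phaseDeriv φ ξ v) i =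
      absDiffP g φ (inducedChart φ ξ) (phaseDeriv φ ξ w) i := congrFun h2 i
  rw [absDiffP, absDiffP, h1'] at h3
  linarith

variable (c₁ c₂ d₁ d₂ : ℝ → ℝ)

theorem diagMetric_eq_components (hφ : φ ∈ smoothCharts n M) (hx : ξ.proj ∈ φ.source)
    (v w : TangentSpace (cotModel n) ξ) :
    diagMetric g c₁ c₂ d₁ d₂ ξ v w =
      (∑ i, ∑ j, G₁ g c₁ d₁ φ i j (inducedChart φ ξ) * horizComp φ ξ v i * horizComp φ ξ w j)
      + ∑ i, ∑ j, G₂ g c₂ d₂ φ i j (inducedChart φ ξ) * vertComp g φ ξ v i * vertComp g φ ξ w j :=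
  diagMetric_eq g hφ hx c₁ c₂ d₁ d₂ v w

theorem diagMetric_frameQ_right (hφ : φ ∈ smoothCharts n M) (hx : ξ.proj ∈ φ.source)
    (v : TangentSpace (cotModel n) ξ) (k : Fin n) :
    diagMetric g c₁ c₂ d₁ d₂ ξ v (frameQ g φ k ξ) =
      ∑ i, G₁ g c₁ d₁ φ i k (inducedChart φ ξ) * horizComp φ ξ v i := by
  rw [diagMetric_eq_components g c₁ c₂ d₁ d₂ hφ hx, horizComp_frameQ g hφ hx,
    vertComp_frameQ g hφ hx]
  simp [Pi.single_apply]

theorem diagMetric_frameP_right (hφ : φ ∈ smoothCharts n M) (hx : ξ.proj ∈ φ.source)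
    (v : TangentSpace (cotModel n) ξ) (k : Fin n) :
    diagMetric g c₁ c₂ d₁ d₂ ξ v (frameP φ k ξ) =
      ∑ i, G₂ g c₂ d₂ φ i k (inducedChart φ ξ) * vertComp g φ ξ v i := by
  rw [diagMetric_eq_components g c₁ c₂ d₁ d₂ hφ hx, horizComp_frameP hφ hx,
    vertComp_frameP g hφ hx]
  simp [Pi.single_apply]

theorem diagMetric_symm (ξ : Cotangent n M) (v w : TangentSpace (cotModel n) ξ) :
    diagMetric g c₁ c₂ d₁ d₂ ξ v w = diagMetric g c₁ c₂ d₁ d₂ ξ w v := by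
  have hφ : chartAt (Coords n) ξ.proj ∈ smoothCharts n M :=
    IsManifold.chart_mem_maximalAtlas ξ.proj
  rw [diagMetric_eq_components g c₁ c₂ d₁ d₂ hφ (mem_chart_source _ _),
    diagMetric_eq_components g c₁ c₂ d₁ d₂ hφ (mem_chart_source _ _)]
  congr 1
  · rw [Finset.sum_comm]
    refine Finset.sum_congr rfl fun i _ => Finset.sum_congr rfl fun j _ => ?_
    rw [G₁_symm]
    ring
  · rw [Finset.sum_comm]
    refine Finset.sum_congr rfl fun i _ => Finset.sum_congr rfl fun j _ => ?_
    rw [G₂_symm]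
    ring

theorem diagMetric_sub_left (ξ : Cotangent n M) (u v w : TangentSpace (cotModel n) ξ) :
    diagMetric g c₁ c₂ d₁ d₂ ξ (u - v) w =
      diagMetric g c₁ c₂ d₁ d₂ ξ u w - diagMetric g c₁ c₂ d₁ d₂ ξ v w := by
  have hφ : chartAt (Coords n) ξ.proj ∈ smoothCharts n M :=
    IsManifold.chart_mem_maximalAtlas ξ.proj
  simp only [diagMetric_eq_components g c₁ c₂ d₁ d₂ hφ (mem_chart_source _ _), map_sub,
    Pi.sub_apply, mul_sub, sub_mul, Finset.sum_sub_distrib]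
  ring

variable {c₁ c₂ d₁ d₂}

theorem sum_mul_right_cancel {ι : Type*} [Fintype ι] [DecidableEq ι] {A B : ι → ι → ℝ}
    (h : ∀ i j, ∑ k, A i k * B k j = if i = j then 1 else 0) {u v : ι → ℝ}
    (huv : ∀ k, ∑ i, A i k * u i = ∑ i, A i k * v i) : u = v := by
  have key : ∀ u : ι → ℝ, ∀ j, ∑ k, B k j * ∑ i, A i k * u i = u j := by
    intro u j
    simp only [Finset.mul_sum]
    rw [Finset.sum_comm]
    calc ∑ i, ∑ k, B k j * (A i k * u i) = ∑ i, (∑ k, A i k * B k j) * u i := by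
          refine Finset.sum_congr rfl fun i _ => ?_
          rw [Finset.sum_mul]
          exact Finset.sum_congr rfl fun k _ => by ring
      _ = u j := by simp [h]
  ext j
  rw [← key u j, ← key v j]
  simp only [huv]

/-- The natural metric is nondegenerate. -/
theorem eq_of_diagMetric_frames (hc : IsMetricParam c₁ c₂ d₁ d₂) (hφ : φ ∈ smoothCharts n M)
    (hx : ξ.proj ∈ φ.source) (hξ : ξ ∈ nonzeroCotangent n M) {v w : TangentSpace (cotModel n) ξ}
    (h1 : ∀ k, diagMetric g c₁ c₂ d₁ d₂ ξ v (frameQ g φ k ξ) =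
      diagMetric g c₁ c₂ d₁ d₂ ξ w (frameQ g φ k ξ))
    (h2 : ∀ k, diagMetric g c₁ c₂ d₁ d₂ ξ v (frameP φ k ξ) =
      diagMetric g c₁ c₂ d₁ d₂ ξ w (frameP φ k ξ)) : v = w := by
  have hz := inducedChart_mem_phaseDomain hφ hx hξ
  simp only [diagMetric_frameQ_right g c₁ c₂ d₁ d₂ hφ hx] at h1
  simp only [diagMetric_frameP_right g c₁ c₂ d₁ d₂ hφ hx] at h2
  exact eq_of_components g hφ hx (sum_mul_right_cancel (G₁_mul_H₁ g hc hφ hz) h1)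
    (sum_mul_right_cancel (G₂_mul_H₂ g hc hφ hz) h2)

theorem mdifferentiableAt_frameP (hφ : φ ∈ smoothCharts n M) (hx : ξ.proj ∈ φ.source)
    (i : Fin n) : MDifferentiableAt (cotModel n) (cotModel n).tangent
      (fun η => (⟨η, frameP φ i η⟩ : TangentBundle (cotModel n) (Cotangent n M))) ξ :=
  mdifferentiableAt_liftField hφ hx (V := fun _ => vertVec i) contDiffAt_const

theorem mdifferentiableAt_frameQ (hφ : φ ∈ smoothCharts n M) (hx : ξ.proj ∈ φ.source)
    (i : Fin n) : MDifferentiableAt (cotModel n) (cotModel n).tangent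
      (fun η => (⟨η, frameQ g φ i η⟩ : TangentBundle (cotModel n) (Cotangent n M))) ξ :=
  mdifferentiableAt_liftField hφ hx (V := horizVec g φ i)
    ((contDiffAt_horizVec g hφ (φ.map_source hx) i).of_le (by simp))

theorem mlieBracket_frameP_frameP (hφ : φ ∈ smoothCharts n M) (hx : ξ.proj ∈ φ.source)
    (i j : Fin n) :
    phaseDeriv φ ξ (VectorField.mlieBracket (cotModel n) (frameP φ i) (frameP φ j) ξ) = 0 := by
  have h := mlieBracket_liftField hφ hx (V := fun _ => vertVec i) (W := fun _ => vertVec j)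
    contDiffAt_const contDiffAt_const
  refine h.trans ?_
  simp

/-- Since Γ^0 is linear in p, its derivative ∂Γ^0_{jh}/∂p_i is Γ^i_{jh}. -/
theorem mlieBracket_frameP_frameQ (hφ : φ ∈ smoothCharts n M) (hx : ξ.proj ∈ φ.source)
    (i j : Fin n) :
    phaseDeriv φ ξ (VectorField.mlieBracket (cotModel n) (frameP φ i) (frameQ g φ j) ξ) =
      (0, WithLp.toLp 2 fun h => christoffel g φ i j h (φ ξ.proj)) := by
  have hz : (inducedChart φ ξ).1 ∈ φ.target := φ.map_source hx
  have h := mlieBracket_liftField hφ hx (V := fun _ => vertVec i) (W := horizVec g φ j)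
    contDiffAt_const ((contDiffAt_horizVec g hφ hz j).of_le (by simp))
  refine h.trans ?_
  rw [fderiv_horizVec_vertVec g hφ hz]
  simp
  rfl

theorem mlieBracket_frameQ_frameP (hφ : φ ∈ smoothCharts n M) (hx : ξ.proj ∈ φ.source)
    (i j : Fin n) :
    phaseDeriv φ ξ (VectorField.mlieBracket (cotModel n) (frameQ g φ j) (frameP φ i) ξ) =
      (0, WithLp.toLp 2 fun h => -christoffel g φ i j h (φ ξ.proj)) := by
  rw [VectorField.mlieBracket_swap_apply, ContinuousLinearMap.map_neg, mlieBracket_frameP_frameQ g hφ hx]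
  ext h
  · simp
  · simp

theorem mlieBracket_frameQ_frameQ (hφ : φ ∈ smoothCharts n M) (hx : ξ.proj ∈ φ.source)
    (i j : Fin n) :
    phaseDeriv φ ξ (VectorField.mlieBracket (cotModel n) (frameQ g φ i) (frameQ g φ j) ξ) =
      (0, WithLp.toLp 2 fun h => curvZero g φ h i j (inducedChart φ ξ)) := by
  have hz : (inducedChart φ ξ).1 ∈ φ.target := φ.map_source hx
  have h := mlieBracket_liftField hφ hx (V := horizVec g φ i) (W := horizVec g φ j)
    ((contDiffAt_horizVec g hφ hz i).of_le (by simp))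
    ((contDiffAt_horizVec g hφ hz j).of_le (by simp))
  exact h.trans (lieBracket_horizVec g hφ hz i j)

end Frames

end

section

variable {n : ℕ} {M : Type*} [TopologicalSpace M] [ChartedSpace (Coords n) M]

/-! ### Evaluation of the Levi-Civita connection on the frame. -/

section Connection

variable [IsManifold (𝓡 n) ∞ M] (g : RiemMetric n M) {φ : LocalChart n M} {ξ : Cotangent n M}

theorem curv_antisymm (φ : LocalChart n M) (h k i j : Fin n) (y : Coords n) :
    curv g φ h k i j y = -curv g φ h k j i y := by
  simp only [curv, Finset.sum_sub_distrib]
  ring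

theorem horizComp_frame_sum (hφ : φ ∈ smoothCharts n M) (hx : ξ.proj ∈ φ.source)
    (a b : Fin n → ℝ) :
    horizComp φ ξ ((∑ h, a h • frameP φ h ξ) + ∑ h, b h • frameQ g φ h ξ) = b := by
  rw [map_add, map_sum, map_sum]
  simp only [map_smul, horizComp_frameP hφ hx, horizComp_frameQ g hφ hx]
  ext j
  simp [Finset.sum_apply, Pi.single_apply]

theorem vertComp_frame_sum (hφ : φ ∈ smoothCharts n M) (hx : ξ.proj ∈ φ.source)
    (a b : Fin n → ℝ) :
    vertComp g φ ξ ((∑ h, a h • frameP φ h ξ) + ∑ h, b h • frameQ g φ h ξ) = a := by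
  rw [map_add, map_sum, map_sum]
  simp only [map_smul, vertComp_frameP g hφ hx, vertComp_frameQ g hφ hx]
  ext j
  simp [Finset.sum_apply, Pi.single_apply]

variable {c₁ c₂ d₁ d₂ : ℝ → ℝ}

/-- Pairing with vertical fields sees only the vertical block and pairing with horizontal fields
only the horizontal one. The hypotheses have the form in which the Koszul formula delivers the
covariant derivatives. -/
theorem eq_frame_sum (hc : IsMetricParam c₁ c₂ d₁ d₂) (hφ : φ ∈ smoothCharts n M)
    (hx : ξ.proj ∈ φ.source) (hξ : ξ ∈ nonzeroCotangent n M) {v : TangentSpace (cotModel n) ξ}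
    {a b : Fin n → ℝ}
    (h1 : ∀ k, diagMetric g c₁ c₂ d₁ d₂ ξ v (frameP φ k ξ) =
      ∑ h, G₂ g c₂ d₂ φ h k (inducedChart φ ξ) * a h)
    (h2 : ∀ k, diagMetric g c₁ c₂ d₁ d₂ ξ v (frameQ g φ k ξ) =
      ∑ h, G₁ g c₁ d₁ φ h k (inducedChart φ ξ) * b h) :
    v = (∑ h, a h • frameP φ h ξ) + ∑ h, b h • frameQ g φ h ξ := by
  refine eq_of_diagMetric_frames g hc hφ hx hξ (fun k => ?_) fun k => ?_
  · rw [h2, diagMetric_frameQ_right g c₁ c₂ d₁ d₂ hφ hx, horizComp_frame_sum g hφ hx]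
  · rw [h1, diagMetric_frameP_right g c₁ c₂ d₁ d₂ hφ hx, vertComp_frame_sum g hφ hx]

/-! #### Derivatives of the metric along the frame fields -/

theorem mfderiv_diagMetric_frameQ_frameQ (hc : IsMetricParam c₁ c₂ d₁ d₂)
    (hφ : φ ∈ smoothCharts n M) (hx : ξ.proj ∈ φ.source) (hξ : ξ ∈ nonzeroCotangent n M)
    (i j : Fin n) (v : TangentSpace (cotModel n) ξ) :
    mfderiv (cotModel n) 𝓘(ℝ, ℝ) (fun η => diagMetric g c₁ c₂ d₁ d₂ η (frameQ g φ i η)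
      (frameQ g φ j η)) ξ v =
      fderiv ℝ (G₁ g c₁ d₁ φ i j) (inducedChart φ ξ) (phaseDeriv φ ξ v) := by
  refine mfderiv_comp_inducedChart hφ hx ((contDiffAt_G₁ g hc hφ
    (inducedChart_mem_phaseDomain hφ hx hξ) i j).differentiableAt (by simp)) ?_ v
  filter_upwards [proj_mem_nhds hx] with η hη
  rw [diagMetric_frameQ_right g c₁ c₂ d₁ d₂ hφ hη, horizComp_frameQ g hφ hη]
  simp [Pi.single_apply]

theorem mfderiv_diagMetric_frameP_frameP (hc : IsMetricParam c₁ c₂ d₁ d₂)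
    (hφ : φ ∈ smoothCharts n M) (hx : ξ.proj ∈ φ.source) (hξ : ξ ∈ nonzeroCotangent n M)
    (i j : Fin n) (v : TangentSpace (cotModel n) ξ) :
    mfderiv (cotModel n) 𝓘(ℝ, ℝ) (fun η => diagMetric g c₁ c₂ d₁ d₂ η (frameP φ i η)
      (frameP φ j η)) ξ v =
      fderiv ℝ (G₂ g c₂ d₂ φ i j) (inducedChart φ ξ) (phaseDeriv φ ξ v) := by
  refine mfderiv_comp_inducedChart hφ hx ((contDiffAt_G₂ g hc hφ
    (inducedChart_mem_phaseDomain hφ hx hξ) i j).differentiableAt (by simp)) ?_ v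
  filter_upwards [proj_mem_nhds hx] with η hη
  rw [diagMetric_frameP_right g c₁ c₂ d₁ d₂ hφ hη, vertComp_frameP g hφ hη]
  simp [Pi.single_apply]

theorem diagMetric_frameP_frameQ (hφ : φ ∈ smoothCharts n M) (hx : ξ.proj ∈ φ.source)
    (i j : Fin n) :
    diagMetric g c₁ c₂ d₁ d₂ ξ (frameP φ i ξ) (frameQ g φ j ξ) = 0 := by
  rw [diagMetric_frameQ_right g c₁ c₂ d₁ d₂ hφ hx, horizComp_frameP hφ hx]
  simp

theorem mfderiv_diagMetric_frameP_frameQ (hφ : φ ∈ smoothCharts n M) (hx : ξ.proj ∈ φ.source)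
    (i j : Fin n) (v : TangentSpace (cotModel n) ξ) :
    mfderiv (cotModel n) 𝓘(ℝ, ℝ) (fun η => diagMetric g c₁ c₂ d₁ d₂ η (frameP φ i η)
      (frameQ g φ j η)) ξ v = (0 : ℝ) := by
  refine (mfderiv_comp_inducedChart hφ hx (f := fun _ => 0)
    (differentiableAt_const _) ?_ v).trans (by rw [fderiv_const_apply]; rfl)
  filter_upwards [proj_mem_nhds hx] with η hη
  exact diagMetric_frameP_frameQ g hφ hη i j

theorem mfderiv_diagMetric_frameQ_frameP (hφ : φ ∈ smoothCharts n M) (hx : ξ.proj ∈ φ.source)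
    (i j : Fin n) (v : TangentSpace (cotModel n) ξ) :
    mfderiv (cotModel n) 𝓘(ℝ, ℝ) (fun η => diagMetric g c₁ c₂ d₁ d₂ η (frameQ g φ i η)
      (frameP φ j η)) ξ v = (0 : ℝ) := by
  rw [funext fun η => diagMetric_symm g c₁ c₂ d₁ d₂ η (frameQ g φ i η) (frameP φ j η)]
  exact mfderiv_diagMetric_frameP_frameQ g hφ hx j i v

section Values

variable (hc : IsMetricParam c₁ c₂ d₁ d₂) (hφ : φ ∈ smoothCharts n M) (hx : ξ.proj ∈ φ.source)
  (hξ : ξ ∈ nonzeroCotangent n M)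

include hc hφ hx hξ

theorem frameP_diagMetric_frameQ_frameQ (i j k : Fin n) :
    mfderiv (cotModel n) 𝓘(ℝ, ℝ) (fun η => diagMetric g c₁ c₂ d₁ d₂ η (frameQ g φ i η)
      (frameQ g φ j η)) ξ (frameP φ k ξ) = pderivP k (G₁ g c₁ d₁ φ i j) (inducedChart φ ξ) := by
  rw [mfderiv_diagMetric_frameQ_frameQ g hc hφ hx hξ, phaseDeriv_frameP hφ hx]
  rfl

theorem frameP_diagMetric_frameP_frameP (i j k : Fin n) :
    mfderiv (cotModel n) 𝓘(ℝ, ℝ) (fun η => diagMetric g c₁ c₂ d₁ d₂ η (frameP φ i η)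
      (frameP φ j η)) ξ (frameP φ k ξ) = pderivP k (G₂ g c₂ d₂ φ i j) (inducedChart φ ξ) := by
  rw [mfderiv_diagMetric_frameP_frameP g hc hφ hx hξ, phaseDeriv_frameP hφ hx]
  rfl

theorem frameQ_diagMetric_frameQ_frameQ (i j k : Fin n) :
    mfderiv (cotModel n) 𝓘(ℝ, ℝ) (fun η => diagMetric g c₁ c₂ d₁ d₂ η (frameQ g φ i η)
      (frameQ g φ j η)) ξ (frameQ g φ k ξ) =
      (∑ h, G₁ g c₁ d₁ φ h j (inducedChart φ ξ) * christoffel g φ h k i (φ ξ.proj)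
        + ∑ h, G₁ g c₁ d₁ φ h i (inducedChart φ ξ) * christoffel g φ h k j (φ ξ.proj) : ℝ) := by
  rw [mfderiv_diagMetric_frameQ_frameQ g hc hφ hx hξ, phaseDeriv_frameQ g hφ hx,
    (hasDirDeriv_G₁_horizVec g hc hφ (inducedChart_mem_phaseDomain hφ hx hξ) k i j).2]
  simp only [mul_comm]
  rfl

theorem frameQ_diagMetric_frameP_frameP (i j k : Fin n) :
    mfderiv (cotModel n) 𝓘(ℝ, ℝ) (fun η => diagMetric g c₁ c₂ d₁ d₂ η (frameP φ i η)
      (frameP φ j η)) ξ (frameQ g φ k ξ) =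
      (-(∑ h, G₂ g c₂ d₂ φ h j (inducedChart φ ξ) * christoffel g φ i k h (φ ξ.proj))
        - ∑ h, G₂ g c₂ d₂ φ h i (inducedChart φ ξ) * christoffel g φ j k h (φ ξ.proj) : ℝ) := by
  rw [mfderiv_diagMetric_frameP_frameP g hc hφ hx hξ, phaseDeriv_frameQ g hφ hx,
    (hasDirDeriv_G₂_horizVec g hc hφ (inducedChart_mem_phaseDomain hφ hx hξ) k i j).2]
  simp only [mul_comm]
  rfl

end Values

/-! #### Brackets of the frame fields -/

theorem mlieBracket_frameP_frameP_eq_zero (hφ : φ ∈ smoothCharts n M) (hx : ξ.proj ∈ φ.source)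
    (i j : Fin n) : VectorField.mlieBracket (cotModel n) (frameP φ i) (frameP φ j) ξ = 0 :=
  phaseDeriv_injective hφ hx ((mlieBracket_frameP_frameP hφ hx i j).trans
    (ContinuousLinearMap.map_zero _).symm)

theorem diagMetric_zero_left (v : TangentSpace (cotModel n) ξ) :
    diagMetric g c₁ c₂ d₁ d₂ ξ 0 v = 0 := by
  have h := diagMetric_sub_left g c₁ c₂ d₁ d₂ ξ 0 0 v
  rwa [sub_self, sub_self] at h

theorem diagMetric_frameQ_of_phaseDeriv (hφ : φ ∈ smoothCharts n M) (hx : ξ.proj ∈ φ.source)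
    {v : TangentSpace (cotModel n) ξ} {w : Fin n → ℝ}
    (h : phaseDeriv φ ξ v = (0, WithLp.toLp 2 w)) (k : Fin n) :
    diagMetric g c₁ c₂ d₁ d₂ ξ v (frameQ g φ k ξ) = 0 := by
  rw [diagMetric_frameQ_right g c₁ c₂ d₁ d₂ hφ hx, (vertComp_of_phaseDeriv g h).1]
  simp

theorem diagMetric_frameP_of_phaseDeriv (hφ : φ ∈ smoothCharts n M) (hx : ξ.proj ∈ φ.source)
    {v : TangentSpace (cotModel n) ξ} {w : Fin n → ℝ}
    (h : phaseDeriv φ ξ v = (0, WithLp.toLp 2 w)) (k : Fin n) :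
    diagMetric g c₁ c₂ d₁ d₂ ξ v (frameP φ k ξ) =
      ∑ i, G₂ g c₂ d₂ φ i k (inducedChart φ ξ) * w i := by
  rw [diagMetric_frameP_right g c₁ c₂ d₁ d₂ hφ hx, (vertComp_of_phaseDeriv g h).2]

/-! #### The connection -/

theorem sum_inverse_mul {ι : Type*} [Fintype ι] [DecidableEq ι] {A B : ι → ι → ℝ}
    (hA : ∀ i j, A i j = A j i) (h : ∀ i j, ∑ k, A i k * B k j = if i = j then 1 else 0)
    (f : ι → ℝ) (i : ι) : ∑ k, A k i * ∑ l, B k l * f l = f i := by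
  rw [← sum_mul_sum_of_inverse h f i]
  exact Finset.sum_congr rfl fun k _ => by rw [hA k i]

section Formulas

variable (hc : IsMetricParam c₁ c₂ d₁ d₂) (hφ : φ ∈ smoothCharts n M)

include hc hφ

/-- Contraction with `G₂` undoes the `H₂` in the definition of Q and recovers the right-hand side of
the Koszul formula. The two lemmas that follow do the same for P and S. -/
theorem sum_G₂_mul_Qcoef {z : PhaseCoords n} (hz : z ∈ phaseDomain φ) (i j k : Fin n) :
    2 * ∑ h, G₂ g c₂ d₂ φ h k z * Qcoef g c₂ d₂ φ i j h z =
      pderivP i (G₂ g c₂ d₂ φ j k) z + pderivP j (G₂ g c₂ d₂ φ i k) z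
        - pderivP k (G₂ g c₂ d₂ φ i j) z := by
  rw [← sum_inverse_mul (fun i j => G₂_symm g c₂ d₂ i j z) (G₂_mul_H₂ g hc hφ hz)
    (fun k => pderivP i (G₂ g c₂ d₂ φ j k) z + pderivP j (G₂ g c₂ d₂ φ i k) z
        - pderivP k (G₂ g c₂ d₂ φ i j) z) k, Finset.mul_sum]
  refine Finset.sum_congr rfl fun h _ => ?_
  rw [Qcoef]
  ring

theorem sum_G₁_mul_Pcoef {z : PhaseCoords n} (hz : z ∈ phaseDomain φ) (i j k : Fin n) :
    2 * ∑ h, G₁ g c₁ d₁ φ h k z * Pcoef g c₁ c₂ d₁ d₂ φ h i j z =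
      pderivP i (G₁ g c₁ d₁ φ j k) z - ∑ l, G₂ g c₂ d₂ φ i l z * curvZero g φ l j k z := by
  rw [← sum_inverse_mul (fun i j => G₁_symm g c₁ d₁ i j z) (G₁_mul_H₁ g hc hφ hz)
    (fun k => pderivP i (G₁ g c₁ d₁ φ j k) z - ∑ l, G₂ g c₂ d₂ φ i l z * curvZero g φ l j k z) k,
    Finset.mul_sum]
  refine Finset.sum_congr rfl fun h _ => ?_
  rw [Pcoef]
  ring

theorem sum_G₂_mul_Scoef {z : PhaseCoords n} (hz : z ∈ phaseDomain φ) (i j k : Fin n) :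
    2 * ∑ h, G₂ g c₂ d₂ φ h k z * Scoef g c₁ c₂ d₁ d₂ φ h i j z =
      -pderivP k (G₁ g c₁ d₁ φ i j) z + ∑ l, G₂ g c₂ d₂ φ l k z * curvZero g φ l i j z := by
  rw [← sum_inverse_mul (fun i j => G₂_symm g c₂ d₂ i j z) (G₂_mul_H₂ g hc hφ hz)
    (fun k => pderivP k (G₁ g c₁ d₁ φ i j) z) k, Finset.mul_sum, ← Finset.sum_neg_distrib,
    ← Finset.sum_add_distrib]
  refine Finset.sum_congr rfl fun h _ => ?_
  rw [Scoef]
  ring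

variable (hx : ξ.proj ∈ φ.source) (hξ : ξ ∈ nonzeroCotangent n M)
  {nabla : ((η : Cotangent n M) → TangentSpace (cotModel n) η) →
    ((η : Cotangent n M) → TangentSpace (cotModel n) η →L[ℝ] TangentSpace (cotModel n) η)}
  (hN : IsLeviCivitaOn (cotModel n) (nonzeroCotangent n M) (diagMetric g c₁ c₂ d₁ d₂) nabla)

include hx hξ hN

/-- Against ∂/∂p_k the brackets vanish and the Koszul formula is that of a metric on a vector space.
Against δ/δq^k the covariant derivative of `G₂` is cancelled by the two brackets [∂/∂p, δ/δq]. -/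
theorem nabla_frameP_frameP (i j : Fin n) :
    nabla (frameP φ j) ξ (frameP φ i ξ) =
      ∑ h, Qcoef g c₂ d₂ φ i j h (inducedChart φ ξ) • frameP φ h ξ := by
  have hz := inducedChart_mem_phaseDomain hφ hx hξ
  have dP := mdifferentiableAt_frameP hφ hx
  have dQ := mdifferentiableAt_frameQ g hφ hx
  have key := eq_frame_sum g hc hφ hx hξ (v := nabla (frameP φ j) ξ (frameP φ i ξ))
    (a := fun h => Qcoef g c₂ d₂ φ i j h (inducedChart φ ξ)) (b := 0)
    (fun k => ?_) fun k => ?_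
  · refine key.trans ?_
    simp
  · have h := hN.koszul hξ (diagMetric_symm g c₁ c₂ d₁ d₂ ξ) (diagMetric_sub_left g c₁ c₂ d₁ d₂ ξ)
      (dP i) (dP j) (dP k)
      (frameP_diagMetric_frameP_frameP g hc hφ hx hξ j k i)
      (frameP_diagMetric_frameP_frameP g hc hφ hx hξ i k j)
      (frameP_diagMetric_frameP_frameP g hc hφ hx hξ i j k)
    rw [mlieBracket_frameP_frameP_eq_zero hφ hx, mlieBracket_frameP_frameP_eq_zero hφ hx,
      mlieBracket_frameP_frameP_eq_zero hφ hx, diagMetric_zero_left, diagMetric_zero_left,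
      diagMetric_zero_left] at h
    linarith [sum_G₂_mul_Qcoef g hc hφ hz i j k]
  · have h := hN.koszul hξ (diagMetric_symm g c₁ c₂ d₁ d₂ ξ) (diagMetric_sub_left g c₁ c₂ d₁ d₂ ξ)
      (dP i) (dP j) (dQ k)
      (mfderiv_diagMetric_frameP_frameQ g hφ hx j k (frameP φ i ξ))
      (mfderiv_diagMetric_frameP_frameQ g hφ hx i k (frameP φ j ξ))
      (frameQ_diagMetric_frameP_frameP g hc hφ hx hξ i j k)
    rw [mlieBracket_frameP_frameP_eq_zero hφ hx, diagMetric_zero_left,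
      diagMetric_frameP_of_phaseDeriv g hφ hx (mlieBracket_frameP_frameQ g hφ hx i k),
      diagMetric_frameP_of_phaseDeriv g hφ hx (mlieBracket_frameP_frameQ g hφ hx j k)] at h
    simp only [Pi.zero_apply, mul_zero, Finset.sum_const_zero]
    linarith

/-- Against ∂/∂p_k the terms with Γ^k cancel and those with Γ^j double. Against δ/δq^k there remain
∂G₁/∂p_j and the vertical bracket [δ/δq^i, δ/δq^k], which is the curvature term of P. -/
theorem nabla_frameQ_frameP (i j : Fin n) :
    nabla (frameP φ j) ξ (frameQ g φ i ξ) =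
      -(∑ h, christoffel g φ j i h (φ ξ.proj) • frameP φ h ξ)
        + ∑ h, Pcoef g c₁ c₂ d₁ d₂ φ h j i (inducedChart φ ξ) • frameQ g φ h ξ := by
  have hz := inducedChart_mem_phaseDomain hφ hx hξ
  have dP := mdifferentiableAt_frameP hφ hx
  have dQ := mdifferentiableAt_frameQ g hφ hx
  have key := eq_frame_sum g hc hφ hx hξ (v := nabla (frameP φ j) ξ (frameQ g φ i ξ))
    (a := fun h => -christoffel g φ j i h (φ ξ.proj))
    (b := fun h => Pcoef g c₁ c₂ d₁ d₂ φ h j i (inducedChart φ ξ))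
    (fun k => ?_) fun k => ?_
  · refine key.trans ?_
    simp only [neg_smul, Finset.sum_neg_distrib]
  · have h := hN.koszul hξ (diagMetric_symm g c₁ c₂ d₁ d₂ ξ) (diagMetric_sub_left g c₁ c₂ d₁ d₂ ξ)
      (dQ i) (dP j) (dP k)
      (frameQ_diagMetric_frameP_frameP g hc hφ hx hξ j k i)
      (mfderiv_diagMetric_frameQ_frameP g hφ hx i k (frameP φ j ξ))
      (mfderiv_diagMetric_frameQ_frameP g hφ hx i j (frameP φ k ξ))
    rw [mlieBracket_frameP_frameP_eq_zero hφ hx, diagMetric_zero_left,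
      diagMetric_frameP_of_phaseDeriv g hφ hx (mlieBracket_frameQ_frameP g hφ hx j i),
      diagMetric_frameP_of_phaseDeriv g hφ hx (mlieBracket_frameQ_frameP g hφ hx k i)] at h
    simp only [mul_neg, Finset.sum_neg_distrib] at h ⊢
    linarith
  · have h := hN.koszul hξ (diagMetric_symm g c₁ c₂ d₁ d₂ ξ) (diagMetric_sub_left g c₁ c₂ d₁ d₂ ξ)
      (dQ i) (dP j) (dQ k)
      (mfderiv_diagMetric_frameP_frameQ g hφ hx j k (frameQ g φ i ξ))
      (frameP_diagMetric_frameQ_frameQ g hc hφ hx hξ i k j)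
      (mfderiv_diagMetric_frameQ_frameP g hφ hx i j (frameQ g φ k ξ))
    rw [diagMetric_frameQ_of_phaseDeriv g hφ hx (mlieBracket_frameQ_frameP g hφ hx j i),
      diagMetric_frameQ_of_phaseDeriv g hφ hx (mlieBracket_frameP_frameQ g hφ hx j k),
      diagMetric_frameP_of_phaseDeriv g hφ hx (mlieBracket_frameQ_frameQ g hφ hx i k)] at h
    have e := sum_G₁_mul_Pcoef g hc hφ hz j i k
    simp only [G₂_symm g c₂ d₂ j] at e
    linarith

/-- Torsion-freeness reduces this to the mixed derivative taken in the other order; the bracket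
removes exactly its vertical part. -/
theorem nabla_frameP_frameQ (i j : Fin n) :
    nabla (frameQ g φ j) ξ (frameP φ i ξ) =
      ∑ h, Pcoef g c₁ c₂ d₁ d₂ φ h i j (inducedChart φ ξ) • frameQ g φ h ξ := by
  have h1 := hN.torsion_free (frameP φ i) (frameQ g φ j) ξ hξ (mdifferentiableAt_frameP hφ hx i)
    (mdifferentiableAt_frameQ g hφ hx j)
  have h2 : VectorField.mlieBracket (cotModel n) (frameP φ i) (frameQ g φ j) ξ =
      (∑ h, christoffel g φ i j h (φ ξ.proj) • frameP φ h ξ)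
        + ∑ h, (0 : Fin n → ℝ) h • frameQ g φ h ξ := by
    have hb := vertComp_of_phaseDeriv g (mlieBracket_frameP_frameQ g hφ hx i j)
    refine eq_of_components g hφ hx ?_ ?_
    · rw [hb.1, horizComp_frame_sum g hφ hx]
    · rw [hb.2, vertComp_frame_sum g hφ hx]
  have h3 := nabla_frameQ_frameP g hc hφ hx hξ hN j i
  rw [sub_eq_iff_eq_add.1 h1, h2, h3]
  simp

/-- Against ∂/∂p_k there remain -∂G₁/∂p_k and the curvature bracket. Against δ/δq^k all brackets are
orthogonal, and the covariant derivatives of `G₁` combine exactly as those of g do in the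
Christoffel formula. -/
theorem nabla_frameQ_frameQ (i j : Fin n) :
    nabla (frameQ g φ j) ξ (frameQ g φ i ξ) =
      (∑ h, christoffel g φ h i j (φ ξ.proj) • frameQ g φ h ξ)
        + ∑ h, Scoef g c₁ c₂ d₁ d₂ φ h i j (inducedChart φ ξ) • frameP φ h ξ := by
  have hz := inducedChart_mem_phaseDomain hφ hx hξ
  have dP := mdifferentiableAt_frameP hφ hx
  have dQ := mdifferentiableAt_frameQ g hφ hx
  rw [add_comm]
  refine eq_frame_sum g hc hφ hx hξ (v := nabla (frameQ g φ j) ξ (frameQ g φ i ξ))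
    (fun k => ?_) fun k => ?_
  · have h := hN.koszul hξ (diagMetric_symm g c₁ c₂ d₁ d₂ ξ) (diagMetric_sub_left g c₁ c₂ d₁ d₂ ξ)
      (dQ i) (dQ j) (dP k)
      (mfderiv_diagMetric_frameQ_frameP g hφ hx j k (frameQ g φ i ξ))
      (mfderiv_diagMetric_frameQ_frameP g hφ hx i k (frameQ g φ j ξ))
      (frameP_diagMetric_frameQ_frameQ g hc hφ hx hξ i j k)
    rw [diagMetric_frameP_of_phaseDeriv g hφ hx (mlieBracket_frameQ_frameQ g hφ hx i j),
      diagMetric_frameQ_of_phaseDeriv g hφ hx (mlieBracket_frameQ_frameP g hφ hx k i),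
      diagMetric_frameQ_of_phaseDeriv g hφ hx (mlieBracket_frameQ_frameP g hφ hx k j)] at h
    linarith [sum_G₂_mul_Scoef g hc hφ hz i j k]
  · have h := hN.koszul hξ (diagMetric_symm g c₁ c₂ d₁ d₂ ξ) (diagMetric_sub_left g c₁ c₂ d₁ d₂ ξ)
      (dQ i) (dQ j) (dQ k)
      (frameQ_diagMetric_frameQ_frameQ g hc hφ hx hξ j k i)
      (frameQ_diagMetric_frameQ_frameQ g hc hφ hx hξ i k j)
      (frameQ_diagMetric_frameQ_frameQ g hc hφ hx hξ i j k)
    rw [diagMetric_frameQ_of_phaseDeriv g hφ hx (mlieBracket_frameQ_frameQ g hφ hx i j),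
      diagMetric_frameQ_of_phaseDeriv g hφ hx (mlieBracket_frameQ_frameQ g hφ hx i k),
      diagMetric_frameQ_of_phaseDeriv g hφ hx (mlieBracket_frameQ_frameQ g hφ hx j k)] at h
    simp only [christoffel_symm g φ _ j i, christoffel_symm g φ _ k i,
      christoffel_symm g φ _ k j] at h
    linarith

end Formulas

end Connection

end

section

/-! ### Trilinear forms in components. -/

section TripleSums

variable {ι : Type*} [Fintype ι]

/-- The value of a trilinear form with components `T` on three vectors. -/
def triSum (p q u : ι → ℝ) (T : ι → ι → ι → ℝ) : ℝ :=
  ∑ a, ∑ b, ∑ d, p a * q b * u d * T a b d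

theorem triSum_add (p q u : ι → ℝ) (S T : ι → ι → ι → ℝ) :
    triSum p q u (fun a b d => S a b d + T a b d) = triSum p q u S + triSum p q u T := by
  simp only [triSum, mul_add, Finset.sum_add_distrib]

theorem triSum_sub (p q u : ι → ℝ) (S T : ι → ι → ι → ℝ) :
    triSum p q u (fun a b d => S a b d - T a b d) = triSum p q u S - triSum p q u T := by
  simp only [triSum, mul_sub, Finset.sum_sub_distrib]

theorem triSum_const_mul (p q u : ι → ℝ) (r : ℝ) (T : ι → ι → ι → ℝ) :
    triSum p q u (fun a b d => r * T a b d) = r * triSum p q u T := by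
  simp only [triSum, Finset.mul_sum]
  refine Finset.sum_congr rfl fun a _ => Finset.sum_congr rfl fun b _ =>
    Finset.sum_congr rfl fun d _ => by ring

theorem triSum_swap_left (p q u : ι → ℝ) (T : ι → ι → ι → ℝ) :
    triSum p q u T = triSum q p u fun b a d => T a b d := by
  simp only [triSum]
  rw [Finset.sum_comm]
  refine Finset.sum_congr rfl fun a _ => Finset.sum_congr rfl fun b _ =>
    Finset.sum_congr rfl fun d _ => by ring

theorem triSum_swap_right (p q u : ι → ℝ) (T : ι → ι → ι → ℝ) :
    triSum p q u T = triSum p u q fun a d b => T a b d := by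
  simp only [triSum]
  refine Finset.sum_congr rfl fun a _ => ?_
  rw [Finset.sum_comm]
  refine Finset.sum_congr rfl fun b _ => Finset.sum_congr rfl fun d _ => by ring

theorem sum_mul_triSum (p q f : ι → ℝ) (u : ι → ι → ℝ) (T : ι → ι → ι → ℝ) :
    ∑ e, f e * triSum p q (u e) T = triSum p q (fun d => ∑ e, f e * u e d) T := by
  simp only [triSum, Finset.mul_sum, Finset.sum_mul]
  rw [Finset.sum_comm]
  refine Finset.sum_congr rfl fun a _ => ?_
  rw [Finset.sum_comm]
  refine Finset.sum_congr rfl fun b _ => ?_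
  rw [Finset.sum_comm]
  refine Finset.sum_congr rfl fun d _ => Finset.sum_congr rfl fun e _ => by ring

theorem triSum_sum_mul (p q u : ι → ℝ) (H : ι → ι → ℝ) (T : ι → ι → ι → ℝ) :
    triSum p q (fun e => ∑ d, u d * H d e) T =
      triSum p q u fun a b d => ∑ e, H d e * T a b e := by
  simp only [triSum, Finset.mul_sum, Finset.sum_mul]
  refine Finset.sum_congr rfl fun a _ => Finset.sum_congr rfl fun b _ => ?_
  rw [Finset.sum_comm]
  refine Finset.sum_congr rfl fun d _ => Finset.sum_congr rfl fun e _ => by ring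

variable [DecidableEq ι]

/-- Contraction of the components of two tensors commutes with changes of coordinates. -/
theorem sum_mul_triSum_contract {J K : ι → ι → ℝ}
    (h : ∀ c d, ∑ k, J c k * K k d = if c = d then 1 else 0) (p q u : ι → ℝ)
    (H : ι → ι → ℝ) (T : ι → ι → ι → ℝ) :
    ∑ k, (∑ d, ∑ e, u d * J e k * H d e) * triSum p q (K k) T =
      triSum p q u fun a b d => ∑ e, H d e * T a b e := by
  rw [sum_mul_triSum, ← triSum_sum_mul]
  congr 1
  ext f
  have h1 := sum_transform_contract h (fun e => ∑ d, u d * H d e) (fun e => if e = f then 1 else 0)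
  simp only [mul_ite, mul_one, mul_zero, Finset.sum_ite_eq', Finset.mem_univ, if_true] at h1
  rw [← h1]
  refine Finset.sum_congr rfl fun k _ => ?_
  congr 1
  rw [Finset.sum_comm]
  refine Finset.sum_congr rfl fun e _ => ?_
  rw [Finset.mul_sum]
  exact Finset.sum_congr rfl fun d _ => by ring

/-- Converts the sums over multi-indices in `IsMTensorField` into iterated sums. -/
theorem sum_fin_succ_arrow {m : ℕ} (f : (Fin (m + 1) → ι) → ℝ) :
    ∑ I, f I = ∑ a, ∑ I : Fin m → ι, f (Matrix.vecCons a I) := by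
  rw [← (Fin.consEquiv fun _ : Fin (m + 1) => ι).sum_comp f, Fintype.sum_prod_type]
  rfl

end TripleSums

variable {n : ℕ} {M : Type*} [TopologicalSpace M] [ChartedSpace (Coords n) M]

/-! ### Tensoriality of fibre derivatives and of the curvature. -/

section Transform

variable [IsManifold (𝓡 n) ∞ M] (g : RiemMetric n M) {φ ψ : LocalChart n M} {x : M}
  {z z' : PhaseCoords n}

/-- Over a fixed base point the momenta in two charts are related linearly, so the line z' + s e_k
corresponds to the line through z whose direction is the k-th row of the Jacobian. -/
theorem pderivP_of_corresponds (hφ : φ ∈ smoothCharts n M) (hψ : ψ ∈ smoothCharts n M)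
    (h : Corresponds φ ψ x z z') {F F' : PhaseCoords n → ℝ}
    (hF : DifferentiableAt ℝ F z) (hF' : DifferentiableAt ℝ F' z')
    (hFF : ∀ w w', Corresponds φ ψ x w w' → F' w' = F w) (k : Fin n) :
    pderivP k F' z' = ∑ c, jacobian φ ψ x k c * pderivP c F z := by
  have hv : ((0 : Coords n), WithLp.toLp 2 fun c => jacobian φ ψ x k c) =
      ∑ c, jacobian φ ψ x k c • ((0, stdVec c) : PhaseCoords n) := by
    refine Prod.ext ?_ ?_
    · simp [Prod.fst_sum]
    · rw [Prod.snd_sum]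
      ext a
      simp [coords_sum_apply]
  -- The two functions are compared only over the point x, hence as line derivatives along the
  -- fibre.
  have h1 : lineDeriv ℝ F' z' (0, stdVec k) =
      lineDeriv ℝ F z (0, WithLp.toLp 2 fun c => jacobian φ ψ x k c) := by
    rw [lineDeriv, lineDeriv]
    congr 1
    ext t
    refine hFF _ _ ⟨h.left, h.right, ?_, ?_, fun j => ?_⟩
    · simp [h.fst]
    · simp [h.fst']
    · have e := sum_jacobian_mul_jacobian hψ hφ h.right h.left
      simp only [Prod.snd_add, Prod.smul_snd, PiLp.add_apply, PiLp.smul_apply, smul_eq_mul,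
        h.snd' j, stdVec_apply, mul_add, Finset.sum_add_distrib]
      congr 1
      have e2 : ∑ a, jacobian φ ψ x k a * jacobian ψ φ x a j = if k = j then 1 else 0 :=
        sum_jacobian_mul_jacobian hφ hψ h.left h.right k j
      simp only [eq_comm (a := j)]
      rw [← e2, Finset.mul_sum]
      exact Finset.sum_congr rfl fun a _ => by ring
  rw [hF'.lineDeriv_eq_fderiv, hF.lineDeriv_eq_fderiv, hv, map_sum] at h1
  rw [pderivP, h1]
  exact Finset.sum_congr rfl fun c _ => by rw [map_smul]; rfl

theorem pderivP_sum_sum_mul {F : Fin n → Fin n → PhaseCoords n → ℝ}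
    (hF : ∀ a b, DifferentiableAt ℝ (F a b) z) (p q : Fin n → ℝ) (c : Fin n) :
    DifferentiableAt ℝ (fun w => ∑ a, ∑ b, p a * q b * F a b w) z ∧
    pderivP c (fun w => ∑ a, ∑ b, p a * q b * F a b w) z =
      ∑ a, ∑ b, p a * q b * pderivP c (F a b) z :=
  HasDirDeriv.sum fun a _ => HasDirDeriv.sum fun b _ =>
    HasDirDeriv.const_mul (p a * q b) (⟨hF a b, rfl⟩ : HasDirDeriv (F a b) z (0, stdVec c) _)

/-- The Jacobian factors depend on the base point alone, so they are constants for ∂/∂p, and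
differentiation adds one contravariant index. -/
theorem pderivP_transform (hφ : φ ∈ smoothCharts n M) (hψ : ψ ∈ smoothCharts n M)
    (h : Corresponds φ ψ x z z') {F : Fin n → Fin n → PhaseCoords n → ℝ}
    {F' : PhaseCoords n → ℝ} (hF : ∀ a b, DifferentiableAt ℝ (F a b) z)
    (hF' : DifferentiableAt ℝ F' z') (p q : Fin n → ℝ)
    (hFF : ∀ w w', Corresponds φ ψ x w w' → F' w' = ∑ a, ∑ b, p a * q b * F a b w) (k : Fin n) :
    pderivP k F' z' = triSum p q (jacobian φ ψ x k) fun a b c => pderivP c (F a b) z := by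
  rw [pderivP_of_corresponds hφ hψ h (pderivP_sum_sum_mul hF p q k).1 hF' hFF]
  simp only [fun c => (pderivP_sum_sum_mul hF p q c).2, triSum, Finset.mul_sum]
  rw [Finset.sum_comm]
  refine Finset.sum_congr rfl fun a _ => ?_
  rw [Finset.sum_comm]
  exact Finset.sum_congr rfl fun b _ => Finset.sum_congr rfl fun c _ => by ring

variable {c₁ c₂ d₁ d₂ : ℝ → ℝ}

theorem pderivP_G₁_transform (hc : IsMetricParam c₁ c₂ d₁ d₂) (hφ : φ ∈ smoothCharts n M)
    (hψ : ψ ∈ smoothCharts n M) (h : Corresponds φ ψ x z z') (hz : z ∈ phaseDomain φ)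
    (hz' : z' ∈ phaseDomain ψ) (k i j : Fin n) :
    pderivP k (G₁ g c₁ d₁ ψ i j) z' =
      triSum (fun a => jacobian ψ φ x a i) (fun b => jacobian ψ φ x b j) (jacobian φ ψ x k)
        fun a b c => pderivP c (G₁ g c₁ d₁ φ a b) z :=
  pderivP_transform hφ hψ h
    (fun a b => (contDiffAt_G₁ g hc hφ hz a b).differentiableAt (by simp))
    ((contDiffAt_G₁ g hc hψ hz' i j).differentiableAt (by simp)) _ _
    (fun _ _ hw => G₁_transform g hφ hψ hw c₁ d₁ i j) k

theorem pderivP_G₂_transform (hc : IsMetricParam c₁ c₂ d₁ d₂) (hφ : φ ∈ smoothCharts n M)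
    (hψ : ψ ∈ smoothCharts n M) (h : Corresponds φ ψ x z z') (hz : z ∈ phaseDomain φ)
    (hz' : z' ∈ phaseDomain ψ) (k i j : Fin n) :
    pderivP k (G₂ g c₂ d₂ ψ i j) z' =
      triSum (jacobian φ ψ x i) (jacobian φ ψ x j) (jacobian φ ψ x k)
        fun a b c => pderivP c (G₂ g c₂ d₂ φ a b) z :=
  pderivP_transform hφ hψ h
    (fun a b => (contDiffAt_G₂ g hc hφ hz a b).differentiableAt (by simp))
    ((contDiffAt_G₂ g hc hψ hz' i j).differentiableAt (by simp)) _ _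
    (fun _ _ hw => G₂_transform g hφ hψ hw c₂ d₂ i j) k

/-! #### The curvature -/

/-- The `i`-th component `Dp_i` of tangent vectors, as a linear map. -/
def absDiffPLin (φ : LocalChart n M) (z : PhaseCoords n) (i : Fin n) :
    PhaseCoords n →ₗ[ℝ] ℝ where
  toFun a := absDiffP g φ z a i
  map_add' v w := by
    simp only [absDiffP, Prod.snd_add, Prod.fst_add, PiLp.add_apply, mul_add,
      Finset.sum_add_distrib]
    ring
  map_smul' r v := by
    simp only [absDiffP, Prod.smul_snd, Prod.smul_fst, PiLp.smul_apply,
      smul_eq_mul, mul_sub, Finset.mul_sum, RingHom.id_apply]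
    congr 1
    exact Finset.sum_congr rfl fun j _ => by ring

theorem absDiffPLin_horizVec (φ : LocalChart n M) (z : PhaseCoords n) (i k : Fin n) :
    absDiffPLin g φ z i (horizVec g φ k z) = 0 := by
  change absDiffP g φ z _ i = 0
  rw [absDiffP, horizVec_snd]
  simp only [horizVec_fst, stdVec_apply, mul_ite, mul_one, mul_zero, Finset.sum_ite_eq',
    Finset.mem_univ, if_true]
  rw [christoffelZero_symm, sub_self]

theorem absDiffPLin_vert (φ : LocalChart n M) (z : PhaseCoords n) (i : Fin n) (w : Fin n → ℝ) :
    absDiffPLin g φ z i (0, WithLp.toLp 2 w) = w i := by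
  change absDiffP g φ z _ i = w i
  simp [absDiffP]

/-- The horizontal field with components `e` in the chart `φ`. -/
def horizField (φ : LocalChart n M) (e : Fin n → Coords n → ℝ) (z : PhaseCoords n) :
    PhaseCoords n :=
  ∑ a, e a z.1 • horizVec g φ a z

theorem fderiv_horizField (hφ : φ ∈ smoothCharts n M) (hz : z.1 ∈ φ.target)
    {e : Fin n → Coords n → ℝ} (he : ∀ a, ContDiffAt ℝ ∞ (e a) z.1) (v : PhaseCoords n) :
    fderiv ℝ (horizField g φ e) z v =
      ∑ a, (e a z.1 • fderiv ℝ (horizVec g φ a) z v + fderiv ℝ (e a) z.1 v.1 • horizVec g φ a z) := by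
  have h := HasFDerivAt.fun_sum (u := Finset.univ) fun a _ =>
    (((he a).differentiableAt (by simp)).hasFDerivAt.comp z hasFDerivAt_fst).smul
    (((contDiffAt_horizVec g hφ hz a).differentiableAt (by simp)).hasFDerivAt)
  refine (congrArg (fun L => L v) (HasFDerivAt.fderiv h)).trans ?_
  simp

theorem contDiffAt_horizField (hφ : φ ∈ smoothCharts n M) (hz : z.1 ∈ φ.target)
    {e : Fin n → Coords n → ℝ} (he : ∀ a, ContDiffAt ℝ ∞ (e a) z.1) :
    ContDiffAt ℝ ∞ (horizField g φ e) z :=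
  ContDiffAt.sum fun a _ => ((he a).comp z contDiffAt_fst).smul (contDiffAt_horizVec g hφ hz a)

/-- Derivatives of the coefficients multiply horizontal vectors, which Dp annihilates, so the
vertical part of the bracket is bilinear over functions of the base. -/
theorem absDiffPLin_bracket_horizField (hφ : φ ∈ smoothCharts n M) (hz : z.1 ∈ φ.target)
    {e f : Fin n → Coords n → ℝ} (he : ∀ a, ContDiffAt ℝ ∞ (e a) z.1)
    (hf : ∀ a, ContDiffAt ℝ ∞ (f a) z.1) (c : Fin n) :
    absDiffPLin g φ z c (fderiv ℝ (horizField g φ f) z (horizField g φ e z)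
      - fderiv ℝ (horizField g φ e) z (horizField g φ f z)) =
      ∑ a, ∑ b, e a z.1 * f b z.1 * curvZero g φ c a b z := by
  have key : ∀ a b, absDiffPLin g φ z c (fderiv ℝ (horizVec g φ b) z (horizVec g φ a z))
      - absDiffPLin g φ z c (fderiv ℝ (horizVec g φ a) z (horizVec g φ b z)) =
      curvZero g φ c a b z := by
    intro a b
    rw [← map_sub, lieBracket_horizVec g hφ hz, absDiffPLin_vert]
  have expand : ∀ {e f : Fin n → Coords n → ℝ}, (∀ a, ContDiffAt ℝ ∞ (f a) z.1) →
      absDiffPLin g φ z c (fderiv ℝ (horizField g φ f) z (horizField g φ e z)) =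
      ∑ b, ∑ a, e a z.1 * f b z.1 *
        absDiffPLin g φ z c (fderiv ℝ (horizVec g φ b) z (horizVec g φ a z)) := by
    intro e f hf
    rw [fderiv_horizField g hφ hz hf, map_sum]
    refine Finset.sum_congr rfl fun b _ => ?_
    rw [map_add, map_smul, map_smul, absDiffPLin_horizVec, horizField, map_sum, map_sum,
      smul_zero, add_zero, smul_eq_mul, Finset.mul_sum]
    refine Finset.sum_congr rfl fun a _ => ?_
    rw [map_smul, map_smul, smul_eq_mul]
    ring
  rw [map_sub, expand hf, expand he, Finset.sum_comm, ← Finset.sum_sub_distrib]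
  refine Finset.sum_congr rfl fun a _ => ?_
  rw [← Finset.sum_sub_distrib]
  refine Finset.sum_congr rfl fun b _ => ?_
  rw [← key a b]
  ring

/-- Both sides are annihilated by Dp, a condition independent of the chart, and their base
components are related by the Jacobian. -/
theorem frameQ_eq_liftField_horizField (hφ : φ ∈ smoothCharts n M) (hψ : ψ ∈ smoothCharts n M)
    {η : Cotangent n M} (hx : η.proj ∈ φ.source) (hx' : η.proj ∈ ψ.source) (i : Fin n) :
    frameQ g ψ i η =
      liftField φ (horizField g φ fun a y => jacobian ψ φ (φ.symm y) a i) η := by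
  have hl := phaseDeriv_liftField hφ hx (horizField g φ fun a y => jacobian ψ φ (φ.symm y) a i)
  have hs : φ.symm (inducedChart φ η).1 = η.proj := φ.left_inv hx
  refine eq_of_components g hφ hx ?_ ?_
  · ext a
    change (phaseDeriv φ η _).1 a = (phaseDeriv φ η _).1 a
    rw [hl, phaseDeriv_fst hψ hφ hx' hx, phaseDeriv_frameQ g hψ hx']
    simp only [horizVec_fst, stdVec_apply, mul_ite, mul_one, mul_zero, Finset.sum_ite_eq',
      Finset.mem_univ, if_true]
    rw [horizField, Prod.fst_sum, coords_sum_apply]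
    simp [horizVec_fst, hs]
  · ext a
    change absDiffP g φ _ (phaseDeriv φ η _) a = absDiffPLin g φ _ a (phaseDeriv φ η _)
    rw [hl, absDiffP_transform g hψ hφ hx' hx, horizField, map_sum]
    simp only [map_smul, absDiffPLin_horizVec, smul_zero, Finset.sum_const_zero]
    refine Finset.sum_eq_zero fun b _ => ?_
    rw [congrFun (vertComp_frameQ g hψ hx' i) b |> (fun h => (h : absDiffP g ψ (inducedChart ψ η)
      (phaseDeriv ψ η (frameQ g ψ i η)) b = 0)), mul_zero]

/-- R^0 is the vertical part of the bracket of two horizontal frame fields. Expressing the ψ-frame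
through the φ-frame and applying bilinearity gives the law without differentiating the
transformation rule of the Christoffel symbols. -/
theorem curvZero_transform (hφ : φ ∈ smoothCharts n M) (hψ : ψ ∈ smoothCharts n M)
    {ξ : Cotangent n M} (hx : ξ.proj ∈ φ.source) (hx' : ξ.proj ∈ ψ.source) (h i j : Fin n) :
    curvZero g ψ h i j (inducedChart ψ ξ) =
      triSum (fun a => jacobian ψ φ ξ.proj a i) (fun b => jacobian ψ φ ξ.proj b j)
        (fun c => jacobian ψ φ ξ.proj c h) fun a b c => curvZero g φ c a b (inducedChart φ ξ) := by
  have hz : (inducedChart φ ξ).1 ∈ φ.target := φ.map_source hx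
  have hs : φ.symm (inducedChart φ ξ).1 = ξ.proj := φ.left_inv hx
  have he : ∀ i a, ContDiffAt ℝ ∞ (fun y => jacobian ψ φ (φ.symm y) a i) (inducedChart φ ξ).1 :=
    fun i a => contDiffAt_jacobian_symm hφ hψ hx hx' a i
  have hev : ∀ i, frameQ g ψ i =ᶠ[𝓝 ξ]
      liftField φ (horizField g φ fun a y => jacobian ψ φ (φ.symm y) a i) := by
    intro i
    filter_upwards [proj_mem_nhds hx, proj_mem_nhds hx'] with η h1 h2
    exact frameQ_eq_liftField_horizField g hφ hψ h1 h2 i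
  have hb := (hev i).mlieBracket_vectorField_eq (hev j)
  have h1 := mlieBracket_liftField hφ hx
    ((contDiffAt_horizField g hφ hz (he i)).of_le (by simp))
    ((contDiffAt_horizField g hφ hz (he j)).of_le (by simp))
  rw [← hb] at h1
  have h2 := absDiffP_transform g hφ hψ hx hx'
    (VectorField.mlieBracket (cotModel n) (frameQ g ψ i) (frameQ g ψ j) ξ) h
  rw [h1] at h2
  have h3 : absDiffP g ψ (inducedChart ψ ξ) (phaseDeriv ψ ξ
      (VectorField.mlieBracket (cotModel n) (frameQ g ψ i) (frameQ g ψ j) ξ)) h =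
      curvZero g ψ h i j (inducedChart ψ ξ) :=
    congrFun (vertComp_of_phaseDeriv g (mlieBracket_frameQ_frameQ g hψ hx' i j)).2 h
  have h4 := fun c => absDiffPLin_bracket_horizField g hφ hz (he i) (he j) c
  rw [← h3, h2]
  refine (Finset.sum_congr rfl fun c _ => congrArg (jacobian ψ φ ξ.proj c h * ·) (h4 c)).trans ?_
  simp only [hs, triSum, Finset.mul_sum]
  rw [Finset.sum_comm]
  refine Finset.sum_congr rfl fun a _ => ?_
  rw [Finset.sum_comm]
  exact Finset.sum_congr rfl fun b _ => Finset.sum_congr rfl fun c _ => by ring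

end Transform

end

section

variable {n : ℕ} {M : Type*} [TopologicalSpace M] [ChartedSpace (Coords n) M]

/-! ### Transformation laws of Q, P and S. -/

section MTensors

variable [IsManifold (𝓡 n) ∞ M] (g : RiemMetric n M) {φ ψ : LocalChart n M} {x : M}
  {z z' : PhaseCoords n} {c₁ c₂ d₁ d₂ : ℝ → ℝ}

theorem Corresponds.sum_jacobian (h : Corresponds φ ψ x z z') (hφ : φ ∈ smoothCharts n M)
    (hψ : ψ ∈ smoothCharts n M) (i j : Fin n) :
    ∑ a, jacobian φ ψ x i a * jacobian ψ φ x a j = if i = j then 1 else 0 :=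
  sum_jacobian_mul_jacobian hφ hψ h.left h.right i j

theorem sum_H₂_transform (hφ : φ ∈ smoothCharts n M) (hψ : ψ ∈ smoothCharts n M)
    (h : Corresponds φ ψ x z z') (p q : Fin n → ℝ) (T : Fin n → Fin n → Fin n → ℝ) (i : Fin n) :
    ∑ k, H₂ g c₂ d₂ ψ i k z' * triSum p q (jacobian φ ψ x k) T =
      triSum p q (fun d => jacobian ψ φ x d i)
        fun a b d => ∑ e, H₂ g c₂ d₂ φ d e z * T a b e := by
  simp only [H₂_transform g hφ hψ h]
  exact sum_mul_triSum_contract ((h.symm hφ hψ).sum_jacobian hψ hφ) _ _ _ _ _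

theorem sum_H₁_transform (hφ : φ ∈ smoothCharts n M) (hψ : ψ ∈ smoothCharts n M)
    (h : Corresponds φ ψ x z z') (p q : Fin n → ℝ) (T : Fin n → Fin n → Fin n → ℝ) (i : Fin n) :
    ∑ k, H₁ g c₁ d₁ ψ i k z' * triSum p q (fun c => jacobian ψ φ x c k) T =
      triSum p q (jacobian φ ψ x i)
        fun a b d => ∑ e, H₁ g c₁ d₁ φ d e z * T a b e := by
  simp only [H₁_transform g hφ hψ h]
  refine sum_mul_triSum_contract (J := fun e k => jacobian φ ψ x k e)
    (K := fun k c => jacobian ψ φ x c k) (fun c d => ?_) _ _ _ _ _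
  refine (Finset.sum_congr rfl fun k _ => mul_comm _ _).trans ?_
  rw [(h.symm hφ hψ).sum_jacobian hψ hφ d c]
  simp only [eq_comm]

theorem sum_G₂_transform (hφ : φ ∈ smoothCharts n M) (hψ : ψ ∈ smoothCharts n M)
    (h : Corresponds φ ψ x z z') (p q : Fin n → ℝ) (T : Fin n → Fin n → Fin n → ℝ) (i : Fin n) :
    ∑ k, G₂ g c₂ d₂ ψ i k z' * triSum p q (fun c => jacobian ψ φ x c k) T =
      triSum p q (jacobian φ ψ x i)
        fun a b d => ∑ e, G₂ g c₂ d₂ φ d e z * T a b e := by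
  simp only [G₂_transform g hφ hψ h]
  refine sum_mul_triSum_contract (J := fun e k => jacobian φ ψ x k e)
    (K := fun k c => jacobian ψ φ x c k) (fun c d => ?_) _ _ _ _ _
  refine (Finset.sum_congr rfl fun k _ => mul_comm _ _).trans ?_
  rw [(h.symm hφ hψ).sum_jacobian hψ hφ d c]
  simp only [eq_comm]

variable (hc : IsMetricParam c₁ c₂ d₁ d₂) (hφ : φ ∈ smoothCharts n M) (hψ : ψ ∈ smoothCharts n M)
  {ξ : Cotangent n M} (hξ : ξ ∈ nonzeroCotangent n M) (hx : ξ.proj ∈ φ.source)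
  (hx' : ξ.proj ∈ ψ.source)

include hc hφ hψ hξ hx hx'

/-- The three fibre derivatives of `G₂` differ by a permutation of slots, so after reordering they
form a single trilinear expression, whose last index is lowered by `H₂`. -/
theorem Qcoef_transform (i j h : Fin n) :
    Qcoef g c₂ d₂ ψ i j h (inducedChart ψ ξ) =
      triSum (jacobian φ ψ ξ.proj i) (jacobian φ ψ ξ.proj j) (fun d => jacobian ψ φ ξ.proj d h)
        fun a b d => Qcoef g c₂ d₂ φ a b d (inducedChart φ ξ) := by
  have hz := inducedChart_mem_phaseDomain hφ hx hξ
  have hz' := inducedChart_mem_phaseDomain hψ hx' hξ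
  have hC := corresponds_inducedChart hφ hψ hx hx'
  have hX : ∀ k, pderivP i (G₂ g c₂ d₂ ψ j k) (inducedChart ψ ξ)
      + pderivP j (G₂ g c₂ d₂ ψ i k) (inducedChart ψ ξ)
      - pderivP k (G₂ g c₂ d₂ ψ i j) (inducedChart ψ ξ) =
      triSum (jacobian φ ψ ξ.proj i) (jacobian φ ψ ξ.proj j) (jacobian φ ψ ξ.proj k)
        fun a b e => pderivP a (G₂ g c₂ d₂ φ b e) (inducedChart φ ξ)
          + pderivP b (G₂ g c₂ d₂ φ a e) (inducedChart φ ξ)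
          - pderivP e (G₂ g c₂ d₂ φ a b) (inducedChart φ ξ) := by
    intro k
    simp only [pderivP_G₂_transform g hc hφ hψ hC hz hz', triSum_add, triSum_sub]
    congr 2
    · rw [triSum_swap_right, triSum_swap_left]
    · rw [triSum_swap_right]
  rw [Qcoef]
  simp only [hX]
  rw [sum_H₂_transform g hφ hψ hC, ← triSum_const_mul]
  rfl

theorem Pcoef_transform (h i j : Fin n) :
    Pcoef g c₁ c₂ d₁ d₂ ψ h i j (inducedChart ψ ξ) =
      triSum (jacobian φ ψ ξ.proj h) (jacobian φ ψ ξ.proj i) (fun d => jacobian ψ φ ξ.proj d j)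
        fun a b d => Pcoef g c₁ c₂ d₁ d₂ φ a b d (inducedChart φ ξ) := by
  have hz := inducedChart_mem_phaseDomain hφ hx hξ
  have hz' := inducedChart_mem_phaseDomain hψ hx' hξ
  have hC := corresponds_inducedChart hφ hψ hx hx'
  have hX : ∀ k, pderivP i (G₁ g c₁ d₁ ψ j k) (inducedChart ψ ξ)
      - ∑ l, G₂ g c₂ d₂ ψ i l (inducedChart ψ ξ) * curvZero g ψ l j k (inducedChart ψ ξ) =
      triSum (jacobian φ ψ ξ.proj i) (fun b => jacobian ψ φ ξ.proj b j)
        (fun b => jacobian ψ φ ξ.proj b k)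
        fun a b e => pderivP a (G₁ g c₁ d₁ φ b e) (inducedChart φ ξ)
          - ∑ l, G₂ g c₂ d₂ φ a l (inducedChart φ ξ) * curvZero g φ l b e (inducedChart φ ξ) := by
    intro k
    simp only [pderivP_G₁_transform g hc hφ hψ hC hz hz', triSum_sub,
      curvZero_transform g hφ hψ hx hx', sum_G₂_transform g hφ hψ hC]
    congr 1
    · rw [triSum_swap_right, triSum_swap_left]
    · rw [triSum_swap_right, triSum_swap_left]
  rw [Pcoef]
  simp only [hX]
  rw [sum_H₁_transform g hφ hψ hC, ← triSum_const_mul, triSum_swap_right, triSum_swap_left,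
    triSum_swap_right]
  rw [triSum_swap_right]
  rfl

theorem Scoef_transform (h i j : Fin n) :
    Scoef g c₁ c₂ d₁ d₂ ψ h i j (inducedChart ψ ξ) =
      triSum (fun d => jacobian ψ φ ξ.proj d h) (fun d => jacobian ψ φ ξ.proj d i)
        (fun d => jacobian ψ φ ξ.proj d j)
        fun a b d => Scoef g c₁ c₂ d₁ d₂ φ a b d (inducedChart φ ξ) := by
  have hz := inducedChart_mem_phaseDomain hφ hx hξ
  have hz' := inducedChart_mem_phaseDomain hψ hx' hξ
  have hC := corresponds_inducedChart hφ hψ hx hx'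
  rw [Scoef]
  simp only [pderivP_G₁_transform g hc hφ hψ hC hz hz', curvZero_transform g hφ hψ hx hx',
      sum_H₂_transform g hφ hψ hC]
  rw [← triSum_const_mul, ← triSum_const_mul, ← triSum_add, triSum_swap_right, triSum_swap_left]
  rfl

end MTensors

/-! ### Q, P and S as M-tensor fields. -/

section Main

variable [IsManifold (𝓡 n) ∞ M] (g : RiemMetric n M) {c₁ c₂ d₁ d₂ : ℝ → ℝ}

theorem isMTensorField_two_one {T : LocalChart n M → Fin n → Fin n → Fin n → PhaseCoords n → ℝ}
    (hT : ∀ φ ∈ smoothCharts n M, ∀ z ∈ phaseDomain φ, ∀ i j h, ContDiffAt ℝ ∞ (T φ i j h) z)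
    (hT' : ∀ φ ∈ smoothCharts n M, ∀ ψ ∈ smoothCharts n M, ∀ ξ ∈ nonzeroCotangent n M,
      ξ.proj ∈ φ.source → ξ.proj ∈ ψ.source → ∀ i j h, T ψ i j h (inducedChart ψ ξ) =
      triSum (jacobian φ ψ ξ.proj i) (jacobian φ ψ ξ.proj j) (fun d => jacobian ψ φ ξ.proj d h)
        fun a b d => T φ a b d (inducedChart φ ξ)) :
    IsMTensorField 2 1 fun (φ : LocalChart n M) I J => T φ (I 0) (I 1) (J 0) := by
  refine ⟨fun φ hφ I J z hz => (hT φ hφ z hz _ _ _).contDiffWithinAt,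
    fun φ hφ ψ hψ ξ hξ hx hx' I J => ?_⟩
  refine (hT' φ hφ ψ hψ ξ hξ hx hx' _ _ _).trans ?_
  simp only [sum_fin_succ_arrow, Finset.univ_unique, Finset.sum_singleton, Fin.prod_univ_two,
    Finset.prod_singleton, triSum]
  rfl

theorem isMTensorField_zero_three {T : LocalChart n M → Fin n → Fin n → Fin n → PhaseCoords n → ℝ}
    (hT : ∀ φ ∈ smoothCharts n M, ∀ z ∈ phaseDomain φ, ∀ i j h, ContDiffAt ℝ ∞ (T φ i j h) z)
    (hT' : ∀ φ ∈ smoothCharts n M, ∀ ψ ∈ smoothCharts n M, ∀ ξ ∈ nonzeroCotangent n M,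
      ξ.proj ∈ φ.source → ξ.proj ∈ ψ.source → ∀ h i j, T ψ h i j (inducedChart ψ ξ) =
      triSum (fun d => jacobian ψ φ ξ.proj d h) (fun d => jacobian ψ φ ξ.proj d i)
        (fun d => jacobian ψ φ ξ.proj d j) fun a b d => T φ a b d (inducedChart φ ξ)) :
    IsMTensorField 0 3 fun (φ : LocalChart n M) _ J => T φ (J 0) (J 1) (J 2) := by
  refine ⟨fun φ hφ I J z hz => (hT φ hφ z hz _ _ _).contDiffWithinAt,
    fun φ hφ ψ hψ ξ hξ hx hx' I J => ?_⟩
  refine (hT' φ hφ ψ hψ ξ hξ hx hx' _ _ _).trans ?_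
  simp only [sum_fin_succ_arrow, Finset.univ_unique, Finset.sum_singleton, Fin.prod_univ_three,
    Finset.univ_eq_empty, Finset.prod_empty, one_mul, triSum]
  rfl

theorem isMTensorField_Qcoef (hc : IsMetricParam c₁ c₂ d₁ d₂) :
    IsMTensorField 2 1 fun (φ : LocalChart n M) I J => Qcoef g c₂ d₂ φ (I 0) (I 1) (J 0) :=
  isMTensorField_two_one (T := Qcoef g c₂ d₂)
    (fun _ hφ _ hz i j h => contDiffAt_Qcoef g hc hφ hz i j h)
    fun _ hφ _ hψ _ hξ hx hx' => Qcoef_transform g hc hφ hψ hξ hx hx'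

theorem isMTensorField_Pcoef (hc : IsMetricParam c₁ c₂ d₁ d₂) :
    IsMTensorField 2 1
      fun (φ : LocalChart n M) I J => Pcoef g c₁ c₂ d₁ d₂ φ (I 0) (I 1) (J 0) :=
  isMTensorField_two_one (T := Pcoef g c₁ c₂ d₁ d₂)
    (fun _ hφ _ hz i j h => contDiffAt_Pcoef g hc hφ hz i j h)
    fun _ hφ _ hψ _ hξ hx hx' => Pcoef_transform g hc hφ hψ hξ hx hx'

theorem isMTensorField_Scoef (hc : IsMetricParam c₁ c₂ d₁ d₂) :
    IsMTensorField 0 3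
      fun (φ : LocalChart n M) _ J => Scoef g c₁ c₂ d₁ d₂ φ (J 0) (J 1) (J 2) :=
  isMTensorField_zero_three (T := Scoef g c₁ c₂ d₁ d₂)
    (fun _ hφ _ hz i j h => contDiffAt_Scoef g hc hφ hz i j h)
    fun _ hφ _ hψ _ hξ hx hx' => Scoef_transform g hc hφ hψ hξ hx hx'

end Main

end

section

/-! ### Algebraic curvature tensors with zero sectional curvature. -/

section CurvatureLike

/-- A quadrilinear form with the symmetries of a curvature tensor is determined by its sectional
curvatures. -/
theorem eq_zero_of_curvature_symmetries {V : Type*} [AddCommGroup V] {B : V → V → V → V → ℝ}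
    (a1 : ∀ x x' y z w, B (x + x') y z w = B x y z w + B x' y z w)
    (a2 : ∀ x y y' z w, B x (y + y') z w = B x y z w + B x y' z w)
    (a3 : ∀ x y z z' w, B x y (z + z') w = B x y z w + B x y z' w)
    (a4 : ∀ x y z w w', B x y z (w + w') = B x y z w + B x y z w')
    (h12 : ∀ x z w, B x x z w = 0) (h34 : ∀ x y z, B x y z z = 0)
    (bianchi : ∀ x y z w, B x y z w + B x z w y + B x w y z = 0)
    (hsec : ∀ u v, B u v u v = 0) (x y z w : V) : B x y z w = 0 := by
  -- Polarising the two vanishing conditions gives skew-symmetry in each pair.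
  have s12 : ∀ x y z w, B x y z w = -B y x z w := fun x y z w => by
    have := h12 (x + y) z w
    rw [a1, a2, a2, h12, h12] at this
    linarith
  have s34 : ∀ x y z w, B x y z w = -B x y w z := fun x y z w => by
    have := h34 x y (z + w)
    rw [a3, a4, a4, h34, h34] at this
    linarith
  -- Interchange of the two pairs is a combination of four Bianchi identities and skew-symmetries.
  have pair : ∀ x y z w, B x y z w = B z w x y := fun x y z w => by
    linarith [bianchi x y z w, bianchi y z w x, bianchi z w x y, bianchi w x y z,
      s12 x y z w, s12 z w x y, s12 x z w y, s12 x w y z, s12 y z w x, s12 y w x z,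
      s34 x y z w, s34 z w x y, s34 x z w y, s34 x w y z, s34 y z w x, s34 y w x z,
      s12 y x z w, s12 w z x y, s34 y x z w, s34 w z x y, s34 z x w y, s34 z x y w,
      s34 w x y z, s34 z y w x, s34 w y x z, s12 y x w z, s12 z w y x, s12 z x y w, s12 w y z x,
      s12 z y x w, s12 w x z y]
  -- Polarising the sectional condition in its second argument gives two terms, equal by pair
  -- symmetry.
  have s24 : ∀ u v w, B u v u w = 0 := fun u v w => by
    have := hsec u (v + w)
    rw [a2, a4, a4, hsec, hsec] at this
    linarith [pair u v u w]
  have s13 : ∀ x y z w, B x y z w = -B z y x w := fun x y z w => by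
    have := s24 (x + z) y w
    rw [a1, a3, a3, s24, s24] at this
    linarith
  -- The form is now alternating under all transpositions, so the three terms of the Bianchi
  -- identity, cyclic and hence even permutations of one another, are equal: 3B = 0.
  linarith [bianchi x y z w, s13 x z w y, s12 w z x y, s13 z w x y, s12 x w z y, s34 x w z y,
    s13 x y z w, s12 z y x w, s13 y z x w, s12 x z y w, s34 x z y w]

end CurvatureLike

/-- If two vector fields annihilate a function, so does their bracket. -/
theorem fderiv_lieBracket_eq_zero {E : Type*} [NormedAddCommGroup E] [NormedSpace ℝ E]
    {f : E → ℝ} {V W : E → E} {z : E} (hf : ContDiffAt ℝ 2 f z) (hV : DifferentiableAt ℝ V z)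
    (hW : DifferentiableAt ℝ W z) (h1 : ∀ᶠ w in 𝓝 z, fderiv ℝ f w (V w) = 0)
    (h2 : ∀ᶠ w in 𝓝 z, fderiv ℝ f w (W w) = 0) :
    fderiv ℝ f z (fderiv ℝ W z (V z) - fderiv ℝ V z (W z)) = 0 := by
  have hd : DifferentiableAt ℝ (fderiv ℝ f) z :=
    (hf.fderiv_right (m := 1) (by norm_num)).differentiableAt (by simp)
  -- Differentiating df(V) = 0 in a direction v gives D²f(v, V) + df(DV(v)) = 0. For the two fields
  -- the second-order terms agree by symmetry and drop out of the difference.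
  have key : ∀ {V : E → E}, DifferentiableAt ℝ V z → (∀ᶠ w in 𝓝 z, fderiv ℝ f w (V w) = 0) →
      ∀ v, fderiv ℝ (fderiv ℝ f) z v (V z) + fderiv ℝ f z (fderiv ℝ V z v) = 0 := by
    intro V hV h v
    have e1 := hd.hasFDerivAt.clm_apply hV.hasFDerivAt
    have e2 : HasFDerivAt (fun w => fderiv ℝ f w (V w)) (0 : E →L[ℝ] ℝ) z :=
      (hasFDerivAt_const (0 : ℝ) z).congr_of_eventuallyEq h
    have e3 := congrArg (fun L : E →L[ℝ] ℝ => L v) (e1.unique e2)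
    simp at e3
    linarith
  have hs : IsSymmSndFDerivAt ℝ f z :=
    hf.isSymmSndFDerivAt (by rw [minSmoothness_of_isRCLikeNormedField])
  rw [map_sub]
  linarith [key hV h1 (W z), key hW h2 (V z), hs.eq (V z) (W z)]

variable {n : ℕ} {M : Type*} [TopologicalSpace M] [ChartedSpace (Coords n) M]

/-! ### The curvature of the base and its form for constant sectional curvature. -/

section Curvature

variable [IsManifold (𝓡 n) ∞ M] (g : RiemMetric n M) {φ : LocalChart n M}

/-- By symmetry of Γ in its lower indices the derivative terms and the quadratic terms cancel in
pairs. -/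
theorem curv_bianchi (φ : LocalChart n M) (h k i j : Fin n) (y : Coords n) :
    curv g φ h k i j y + curv g φ h i j k y + curv g φ h j k i y = 0 := by
  have s : ∀ a b c, christoffel g φ a b c = christoffel g φ a c b :=
    fun a b c => funext fun y => christoffel_symm g φ a b c y
  simp only [curv, Finset.sum_sub_distrib]
  rw [s h k j, s h i k, s h j i]
  simp only [s _ k j, s _ i k, s _ j i]
  ring

/-- Horizontal fields annihilate the energy, hence so do their brackets; the bracket is R^0_{hij}
∂/∂p_h and ∂t/∂p_h = g^{0h}. This is the skew-symmetry of g(R(·,·)·,·) in its last two slots. -/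
theorem sum_curvZero_mul_gZero (hφ : φ ∈ smoothCharts n M) {z : PhaseCoords n}
    (hz : z.1 ∈ φ.target) (i j : Fin n) :
    ∑ h, curvZero g φ h i j z * gZero g φ h z = 0 := by
  have hev : ∀ k, ∀ᶠ w in 𝓝 z, fderiv ℝ (energy g φ) w (horizVec g φ k w) = 0 := by
    intro k
    filter_upwards [(isOpen_prod_target φ).mem_nhds hz] with w hw
    exact (hasDirDeriv_energy_horizVec g hφ hw k).2
  have hd := fun k => (contDiffAt_horizVec g hφ hz k).differentiableAt (by simp)
  have h := fderiv_lieBracket_eq_zero ((contDiffAt_energy g hφ hz).of_le ENat.LEInfty.out)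
    (hd i) (hd j) (hev i) (hev j)
  rw [lieBracket_horizVec g hφ hz] at h
  have hv : ((0 : Coords n), WithLp.toLp 2 fun h => curvZero g φ h i j z) =
      ∑ h, curvZero g φ h i j z • (vertVec h : PhaseCoords n) := by
    refine Prod.ext ?_ ?_
    · simp [Prod.fst_sum, vertVec]
    · rw [Prod.snd_sum]
      ext a
      simp [coords_sum_apply, vertVec]
  rw [hv, map_sum] at h
  rw [← h]
  refine Finset.sum_congr rfl fun a _ => ?_
  rw [map_smul, (hasDirDeriv_energy_vertVec g hφ hz a).2, smul_eq_mul]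

/-- The metric on vectors, in coordinates. -/
def gForm (φ : LocalChart n M) (y : Coords n) (u v : Fin n → ℝ) : ℝ :=
  ∑ i, ∑ j, gLow g φ i j y * u i * v j

/-- The curvature form `g(R(z, w) y, x)`, in coordinates. -/
def curvForm (φ : LocalChart n M) (q : Coords n) (x y z w : Fin n → ℝ) : ℝ :=
  ∑ h, ∑ k, ∑ i, ∑ j, ∑ l, gLow g φ h l q * curv g φ h k i j q * z i * w j * y k * x l

theorem gForm_symm (φ : LocalChart n M) (y : Coords n) (u v : Fin n → ℝ) :
    gForm g φ y u v = gForm g φ y v u := by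
  rw [gForm, gForm, Finset.sum_comm]
  refine Finset.sum_congr rfl fun i _ => Finset.sum_congr rfl fun j _ => ?_
  rw [gLow_symm]
  ring

theorem gForm_add_left (φ : LocalChart n M) (y : Coords n) (u u' v : Fin n → ℝ) :
    gForm g φ y (u + u') v = gForm g φ y u v + gForm g φ y u' v := by
  simp only [gForm, Pi.add_apply, mul_add, add_mul, Finset.sum_add_distrib]

theorem gForm_smul_left (φ : LocalChart n M) (y : Coords n) (r : ℝ) (u v : Fin n → ℝ) :
    gForm g φ y (r • u) v = r * gForm g φ y u v := by
  simp only [gForm, Pi.smul_apply, smul_eq_mul, Finset.mul_sum]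
  exact Finset.sum_congr rfl fun i _ => Finset.sum_congr rfl fun j _ => by ring

theorem gForm_single (φ : LocalChart n M) (y : Coords n) (i j : Fin n) :
    gForm g φ y (Pi.single i 1) (Pi.single j 1) = gLow g φ i j y := by
  simp [gForm, Pi.single_apply]

theorem curvForm_swap (φ : LocalChart n M) (q : Coords n) (x y z w : Fin n → ℝ) :
    curvForm g φ q x y z w = -curvForm g φ q x y w z := by
  simp only [curvForm, ← Finset.sum_neg_distrib]
  refine Finset.sum_congr rfl fun h _ => Finset.sum_congr rfl fun k _ => ?_
  rw [Finset.sum_comm]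
  refine Finset.sum_congr rfl fun i _ => Finset.sum_congr rfl fun j _ =>
    Finset.sum_congr rfl fun l _ => ?_
  rw [curv_antisymm]
  ring

theorem sum_rotate {ι : Type*} [Fintype ι] (f : ι → ι → ι → ℝ) :
    ∑ k, ∑ i, ∑ j, f k i j = ∑ k, ∑ i, ∑ j, f i j k := by
  rw [Finset.sum_comm (f := fun k i => ∑ j, f i j k)]
  exact Finset.sum_congr rfl fun k _ => Finset.sum_comm

theorem curvForm_bianchi (φ : LocalChart n M) (q : Coords n) (x y z w : Fin n → ℝ) :
    curvForm g φ q x y z w + curvForm g φ q x z w y + curvForm g φ q x w y z = 0 := by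
  simp only [curvForm, ← Finset.sum_add_distrib]
  refine Finset.sum_eq_zero fun h _ => ?_
  simp only [Finset.sum_add_distrib]
  -- Summation indices are renamed so that all three cyclic terms carry the monomial z_i w_j y_k
  -- x_l.
  rw [sum_rotate (fun k i j => ∑ l, gLow g φ h l q * curv g φ h k i j q * w i * y j * z k * x l),
    sum_rotate (fun k i j => ∑ l, gLow g φ h l q * curv g φ h k i j q * y i * z j * w k * x l),
    sum_rotate (fun k i j => ∑ l, gLow g φ h l q * curv g φ h i j k q * y j * z k * w i * x l)]
  simp only [← Finset.sum_add_distrib]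
  refine Finset.sum_eq_zero fun k _ => Finset.sum_eq_zero fun i _ =>
    Finset.sum_eq_zero fun j _ => Finset.sum_eq_zero fun l _ => ?_
  linear_combination (gLow g φ h l q * z i * w j * y k * x l) * curv_bianchi g φ h k i j q

theorem curvForm_eq_sum_curvZero (φ : LocalChart n M) (q : Coords n) (x y z w : Fin n → ℝ) :
    curvForm g φ q x y z w = ∑ i, ∑ j, z i * w j * ∑ k,
      curvZero g φ k i j (q, WithLp.toLp 2 fun h => ∑ l, gLow g φ h l q * x l) * y k := by
  simp only [curvForm, curvZero, Finset.mul_sum, Finset.sum_mul]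
  rw [sum_comm₄]
  refine Finset.sum_congr rfl fun i _ => Finset.sum_congr rfl fun j _ => ?_
  rw [Finset.sum_comm]
  exact Finset.sum_congr rfl fun k _ => Finset.sum_congr rfl fun h _ =>
    Finset.sum_congr rfl fun l _ => by ring

/-- With p the covector dual to x one has g^{0k} = x^k, so each term is an instance of
`sum_curvZero_mul_gZero`. -/
theorem curvForm_self (hφ : φ ∈ smoothCharts n M) {q : Coords n} (hq : q ∈ φ.target)
    (x z w : Fin n → ℝ) : curvForm g φ q x x z w = 0 := by
  rw [curvForm_eq_sum_curvZero]
  refine Finset.sum_eq_zero fun i _ => Finset.sum_eq_zero fun j _ => ?_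
  rw [← mul_zero (z i * w j), ← sum_curvZero_mul_gZero g hφ
    (z := (q, WithLp.toLp 2 fun h => ∑ l, gLow g φ h l q * x l)) hq i j]
  congr 1
  refine Finset.sum_congr rfl fun k _ => ?_
  congr 1
  rw [← sum_gUp_mul_momentum g φ _ k]
  exact (sum_mul_sum_of_inverse (gUp_mul_gLow g hφ hq) x k).symm

theorem sectionalCurv_eq (φ : LocalChart n M) (q : Coords n) (u v : Fin n → ℝ) :
    sectionalCurv g φ q u v = curvForm g φ q u v u v /
      (gForm g φ q u u * gForm g φ q v v - gForm g φ q u v ^ 2) := rfl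

theorem curvForm_add (φ : LocalChart n M) (q : Coords n) :
    (∀ x x' y z w, curvForm g φ q (x + x') y z w =
      curvForm g φ q x y z w + curvForm g φ q x' y z w) ∧
    (∀ x y y' z w, curvForm g φ q x (y + y') z w =
      curvForm g φ q x y z w + curvForm g φ q x y' z w) ∧
    (∀ x y z z' w, curvForm g φ q x y (z + z') w =
      curvForm g φ q x y z w + curvForm g φ q x y z' w) ∧
    ∀ x y z w w', curvForm g φ q x y z (w + w') =
      curvForm g φ q x y z w + curvForm g φ q x y z w' := by
  refine ⟨?_, ?_, ?_, ?_⟩ <;> intros <;>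
    simp only [curvForm, Pi.add_apply, mul_add, add_mul, Finset.sum_add_distrib]

theorem curvForm_smul_left (φ : LocalChart n M) (q : Coords n) (r : ℝ) (x y z w : Fin n → ℝ) :
    curvForm g φ q (r • x) y z w = r * curvForm g φ q x y z w := by
  simp only [curvForm, Pi.smul_apply, smul_eq_mul, Finset.mul_sum]
  exact Finset.sum_congr rfl fun _ _ => Finset.sum_congr rfl fun _ _ =>
    Finset.sum_congr rfl fun _ _ => Finset.sum_congr rfl fun _ _ =>
    Finset.sum_congr rfl fun _ _ => by ring

theorem curvForm_sectional (hφ : φ ∈ smoothCharts n M) {q : Coords n} (hq : q ∈ φ.target)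
    {c : ℝ} (hc : c ≠ 0) (hg : HasConstantSectionalCurvature g c) (u v : Fin n → ℝ) :
    curvForm g φ q u v u v =
      c * (gForm g φ q u u * gForm g φ q v v - gForm g φ q u v ^ 2) := by
  by_cases hl : LinearIndependent ℝ ![u, v]
  · have h := hg φ hφ q hq u v hl
    rw [sectionalCurv_eq] at h
    rw [← h]
    -- The Gram determinant cannot vanish: division by zero would make the sectional curvature 0,
    -- whereas c ≠ 0. No Cauchy–Schwarz argument is needed.
    refine (div_mul_cancel₀ _ fun h0 => hc ?_).symm
    rw [← h, h0, div_zero]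
  -- For dependent vectors the curvature hypothesis says nothing, but both sides vanish.
  · have key : ∀ (r : ℝ) (w : Fin n → ℝ) , curvForm g φ q (r • w) w (r • w) w = 0 := by
      intro r w
      rw [curvForm_smul_left, curvForm_self g hφ hq, mul_zero]
    rw [LinearIndependent.pair_iff] at hl
    push Not at hl
    obtain ⟨s, t, hst, h0⟩ := hl
    by_cases hs : s = 0
    · have hv : v = 0 := by
        rw [hs, zero_smul, zero_add] at hst
        exact (smul_eq_zero.1 hst).resolve_left (h0 hs)
      simp [hv, curvForm, gForm]
    · have hu : u = (-t / s) • v := by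
        rw [div_eq_inv_mul, mul_smul, neg_smul, ← eq_neg_of_add_eq_zero_left hst, smul_smul,
          inv_mul_cancel₀ hs, one_smul]
      rw [hu, key, gForm_smul_left, gForm_smul_left, gForm_symm g φ q v, gForm_smul_left]
      ring

/-- The difference from the constant curvature model has all the curvature symmetries and vanishing
sectional values, so it is zero. -/
theorem curvForm_eq_of_constant (hφ : φ ∈ smoothCharts n M) {q : Coords n} (hq : q ∈ φ.target)
    {c : ℝ} (hc : c ≠ 0) (hg : HasConstantSectionalCurvature g c) (x y z w : Fin n → ℝ) :
    curvForm g φ q x y z w =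
      c * (gForm g φ q x z * gForm g φ q y w - gForm g φ q x w * gForm g φ q y z) := by
  obtain ⟨a1, a2, a3, a4⟩ := curvForm_add g φ q
  have ga : ∀ u v v', gForm g φ q u (v + v') = gForm g φ q u v + gForm g φ q u v' := by
    intro u v v'
    rw [gForm_symm, gForm_add_left, gForm_symm g φ q v, gForm_symm g φ q v']
  refine sub_eq_zero.1 (eq_zero_of_curvature_symmetries (B := fun x y z w => curvForm g φ q x y z w
      - c * (gForm g φ q x z * gForm g φ q y w - gForm g φ q x w * gForm g φ q y z))
    ?_ ?_ ?_ ?_ ?_ ?_ ?_ ?_ x y z w)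
  · intro x x' y z w
    simp only [a1, gForm_add_left]
    ring
  · intro x x' y z w
    simp only [a2, gForm_add_left]
    ring
  · intro x x' y z w
    simp only [a3, ga]
    ring
  · intro x x' y z w
    simp only [a4, ga]
    ring
  · intro x z w
    simp only [curvForm_self g hφ hq]
    ring
  · intro x y z
    have h := curvForm_swap g φ q x y z z
    linarith
  · intro x y z w
    have h := curvForm_bianchi g φ q x y z w
    simp only [gForm_symm g φ q z y, gForm_symm g φ q w y, gForm_symm g φ q w z]
    linear_combination h
  · intro u v
    simp only [curvForm_sectional g hφ hq hc hg, gForm_symm g φ q v u]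
    ring

/-- The components of the curvature of a metric of constant sectional curvature. -/
theorem curvZero_of_constant (hφ : φ ∈ smoothCharts n M) {z : PhaseCoords n} (hz : z.1 ∈ φ.target)
    {c : ℝ} (hc : c ≠ 0) (hg : HasConstantSectionalCurvature g c) (k i j : Fin n) :
    curvZero g φ k i j z = c * (z.2 i * gLow g φ k j z.1 - z.2 j * gLow g φ k i z.1) := by
  -- The vector g^{0a} is chosen because lowering its index gives p, which turns the curvature form
  -- into R^0.
  have h := curvForm_eq_of_constant g hφ hz hc hg (fun a => gZero g φ a z) (Pi.single k 1)
    (Pi.single i 1) (Pi.single j 1)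
  have hp : ∀ i, gForm g φ z.1 (fun a => gZero g φ a z) (Pi.single i 1) = z.2 i := by
    intro i
    rw [gForm_symm, gForm]
    simp [Pi.single_apply, sum_gLow_mul_gZero g hφ hz]
  rw [hp, hp, gForm_single, gForm_single, curvForm_eq_sum_curvZero] at h
  simp only [sum_gLow_mul_gZero g hφ hz] at h
  rw [← h]
  simp [Pi.single_apply]

end Curvature

end

section

/-! ### The Kähler parameters: positivity, smoothness, derivatives. -/

section Parameters

variable {A c : ℝ} {lam : ℝ → ℝ}

theorem kaehlerC₁_add (hA : A ≠ 0) {t : ℝ} (ht : t ≠ 0) :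
    kaehlerC₁ A lam t + 2 * t * kaehlerD₁ A c lam t = (2 * c - A ^ 2 * t * lam t ^ 2) / A := by
  rw [kaehlerC₁, kaehlerD₁]
  field_simp
  ring

/-- The bracket in d₂ is arranged so that this sum is a square over 2c - A²tλ². Positivity is then
visible, and the denominators of `H₂` become explicit. -/
theorem kaehlerC₂_add (hA : A ≠ 0) {t : ℝ} (ht : t ≠ 0)
    (hq : 2 * c - A ^ 2 * t * lam t ^ 2 ≠ 0) :
    kaehlerC₂ A t + 2 * t * kaehlerD₂ A c lam t =
      A * (lam t + 2 * t * deriv lam t) ^ 2 / (2 * c - A ^ 2 * t * lam t ^ 2) := by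
  rw [kaehlerC₂, kaehlerD₂]
  obtain ⟨q, hq'⟩ : ∃ q, q = 2 * c - A ^ 2 * t * lam t ^ 2 := ⟨_, rfl⟩
  rw [← hq'] at hq ⊢
  -- Eliminating c in favour of the denominator q makes q an independent variable of the identity.
  have hc : c = (q + A ^ 2 * t * lam t ^ 2) / 2 := by linarith
  rw [hc]
  field_simp
  ring

theorem IsKaehlerParam.contDiffOn_deriv (h : IsKaehlerParam A c lam) :
    ContDiffOn ℝ ∞ (deriv lam) (Ioi 0) :=
  h.smooth.deriv_of_isOpen isOpen_Ioi (by simp)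

theorem IsKaehlerParam.isMetricParam (h : IsKaehlerParam A c lam) :
    IsMetricParam (kaehlerC₁ A lam) (kaehlerC₂ A) (kaehlerD₁ A c lam) (kaehlerD₂ A c lam) where
  smooth_c₁ := (contDiffOn_const.mul contDiffOn_id).mul (h.smooth.pow 2)
  smooth_c₂ := contDiffOn_const.div (contDiffOn_const.mul contDiffOn_id) fun t ht =>
    mul_ne_zero h.pos_A.ne' (ne_of_gt ht)
  smooth_d₁ := (contDiffOn_const.sub ((contDiffOn_const.mul contDiffOn_id).mul
    (h.smooth.pow 2))).div (contDiffOn_const.mul contDiffOn_id) fun t ht =>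
    mul_ne_zero h.pos_A.ne' (ne_of_gt ht)
  smooth_d₂ := by
    have hs := h.smooth
    have hd := h.contDiffOn_deriv
    have ht : ContDiffOn ℝ ∞ (fun t : ℝ => t) (Ioi 0) := contDiffOn_id
    refine ContDiffOn.div (ContDiffOn.neg (contDiffOn_const.sub ((contDiffOn_const.mul ht).mul
      ((hs.pow 2).add (((contDiffOn_const.mul ht).mul hd).mul (hs.add (ht.mul hd)))))))
      ((contDiffOn_const.mul (ht.pow 2)).mul
        (contDiffOn_const.sub ((contDiffOn_const.mul ht).mul (hs.pow 2)))) fun t ht => ?_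
    exact mul_ne_zero (mul_ne_zero h.pos_A.ne' (pow_ne_zero 2 (ne_of_gt ht)))
      (h.pos_curv t ht).ne'
  pos_c₁ t ht := mul_pos (mul_pos h.pos_A ht) (pow_pos (h.pos_lam t ht) 2)
  pos_c₂ t ht := one_div_pos.2 (mul_pos h.pos_A ht)
  pos_d₁ t ht := by
    rw [kaehlerC₁_add h.pos_A.ne' (ne_of_gt ht)]
    exact div_pos (h.pos_curv t ht) h.pos_A
  pos_d₂ t ht := by
    rw [kaehlerC₂_add h.pos_A.ne' (ne_of_gt ht) (h.pos_curv t ht).ne']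
    exact div_pos (mul_pos h.pos_A (pow_pos (h.pos_deriv t ht) 2)) (h.pos_curv t ht)

theorem IsKaehlerParam.hasDerivAt (h : IsKaehlerParam A c lam) {t : ℝ} (ht : 0 < t) :
    HasDerivAt lam (deriv lam t) t :=
  (differentiableAt_of_contDiffOn_Ioi h.smooth ht).hasDerivAt

theorem IsKaehlerParam.hasDerivAt_deriv (h : IsKaehlerParam A c lam) {t : ℝ} (ht : 0 < t) :
    HasDerivAt (deriv lam) (deriv (deriv lam) t) t :=
  (differentiableAt_of_contDiffOn_Ioi h.contDiffOn_deriv ht).hasDerivAt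

theorem IsKaehlerParam.deriv_kaehlerC₁ (h : IsKaehlerParam A c lam) {t : ℝ} (ht : 0 < t) :
    deriv (kaehlerC₁ A lam) t = A * lam t ^ 2 + 2 * A * t * lam t * deriv lam t := by
  have h1 := (((hasDerivAt_id t).const_mul A).mul ((h.hasDerivAt ht).pow 2)).deriv
  refine Eq.trans h1 ?_
  simp
  ring

/-- Stated through c₂ itself, so that c₂ can remain an opaque symbol in the computation of Q. -/
theorem deriv_kaehlerC₂ (hA : A ≠ 0) {t : ℝ} (ht : t ≠ 0) :
    deriv (kaehlerC₂ A) t = -(kaehlerC₂ A t) / t := by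
  have h1 := ((hasDerivAt_const t (1 : ℝ)).div ((hasDerivAt_id t).const_mul A)
    (mul_ne_zero hA ht)).deriv
  refine Eq.trans h1 ?_
  rw [kaehlerC₂]
  simp
  field_simp

theorem IsKaehlerParam.deriv_kaehlerD₁ (h : IsKaehlerParam A c lam) {t : ℝ} (ht : 0 < t) :
    deriv (kaehlerD₁ A c lam) t = -c / (A * t ^ 2) - 2 * A * lam t * deriv lam t := by
  have hA := h.pos_A.ne'
  have ht' := ht.ne'
  have h1 := (((((hasDerivAt_id t).const_mul (A ^ 2)).mul ((h.hasDerivAt ht).pow 2)).const_sub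
    c).div ((hasDerivAt_id t).const_mul A) (mul_ne_zero hA ht.ne')).deriv
  refine Eq.trans h1 ?_
  simp
  field_simp
  ring

theorem IsKaehlerParam.deriv_kaehlerD₂ (h : IsKaehlerParam A c lam) {t : ℝ} (ht : 0 < t) :
    deriv (kaehlerD₂ A c lam) t =
      -((-A ^ 2 * (lam t ^ 2 + 2 * t * deriv lam t * (lam t + t * deriv lam t))
        - A ^ 2 * t * (4 * lam t * deriv lam t + 6 * t * deriv lam t ^ 2
          + 2 * t * deriv (deriv lam) t * (lam t + 2 * t * deriv lam t)))
          * (A * t ^ 2 * (2 * c - A ^ 2 * t * lam t ^ 2))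
        - (c - A ^ 2 * t * (lam t ^ 2 + 2 * t * deriv lam t * (lam t + t * deriv lam t)))
          * (2 * A * t * (2 * c - A ^ 2 * t * lam t ^ 2)
            - A ^ 3 * t ^ 2 * lam t * (lam t + 2 * t * deriv lam t))) /
        (A * t ^ 2 * (2 * c - A ^ 2 * t * lam t ^ 2)) ^ 2 := by
  have hi := hasDerivAt_id t
  have h0 := h.hasDerivAt ht
  have h1 := h.hasDerivAt_deriv ht
  have hD := mul_ne_zero (mul_ne_zero h.pos_A.ne' (pow_ne_zero 2 ht.ne')) (h.pos_curv t ht).ne'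
  have key := ((((hi.const_mul (A ^ 2)).mul ((h0.pow 2).add (((hi.const_mul 2).mul h1).mul
    (h0.add (hi.mul h1))))).const_sub c).neg.div (((hi.pow 2).const_mul A).mul
    (((hi.const_mul (A ^ 2)).mul (h0.pow 2)).const_sub (2 * c))) hD).deriv
  refine Eq.trans key ?_
  simp
  congr 1
  ring

end Parameters

variable {n : ℕ} {M : Type*} [TopologicalSpace M] [ChartedSpace (Coords n) M]

/-! ### Contractions with the inverse blocks, and Q, P, S in closed form. -/

section Explicit

variable [IsManifold (𝓡 n) ∞ M] (g : RiemMetric n M) {φ : LocalChart n M} {z : PhaseCoords n}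
  {c₁ c₂ d₁ d₂ : ℝ → ℝ}

variable (hc : IsMetricParam c₁ c₂ d₁ d₂) (hφ : φ ∈ smoothCharts n M) (hz : z ∈ phaseDomain φ)

include hc hφ hz

/-- `G₁` sends g^{0k} to (c₁ + 2 t d₁) p_k, so its inverse sends p back with the reciprocal factor.
-/
theorem sum_H₁_mul_momentum (h : Fin n) :
    ∑ k, H₁ g c₁ d₁ φ h k z * z.2 k = gZero g φ h z /
      (c₁ (energy g φ z) + 2 * energy g φ z * d₁ (energy g φ z)) := by
  have ht := energy_pos g hφ hz
  have hp := (hc.pos_c₁ _ ht).ne'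
  have hq := (hc.pos_d₁ _ ht).ne'
  have e1 := sum_gUp_mul_momentum g φ z h
  have e2 := sum_gZero_mul_momentum g φ z
  simp only [H₁, sub_mul, Finset.sum_sub_distrib, mul_assoc]
  simp only [← Finset.mul_sum, e1, e2]
  generalize hQ : c₁ (energy g φ z) + 2 * (energy g φ z * d₁ (energy g φ z)) = q
  have hQ' : c₁ (energy g φ z) + 2 * energy g φ z * d₁ (energy g φ z) = q := by
    rw [← hQ]; ring
  rw [hQ'] at hq
  field_simp
  linear_combination -gZero g φ h z * hQ'

theorem sum_H₂_mul_gZero (h : Fin n) :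
    ∑ k, H₂ g c₂ d₂ φ h k z * gZero g φ k z = z.2 h /
      (c₂ (energy g φ z) + 2 * energy g φ z * d₂ (energy g φ z)) := by
  have ht := energy_pos g hφ hz
  have hp := (hc.pos_c₂ _ ht).ne'
  have hq := (hc.pos_d₂ _ ht).ne'
  have e1 := sum_gLow_mul_gZero g hφ hz.1 h
  have e2 := sum_gZero_mul_momentum g φ z
  simp only [mul_comm (gZero g φ _ z)] at e2
  simp only [H₂, sub_mul, Finset.sum_sub_distrib, mul_assoc]
  simp only [← Finset.mul_sum, e1, e2]
  generalize hQ : c₂ (energy g φ z) + 2 * (energy g φ z * d₂ (energy g φ z)) = q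
  have hQ' : c₂ (energy g φ z) + 2 * energy g φ z * d₂ (energy g φ z) = q := by
    rw [← hQ]; ring
  rw [hQ'] at hq
  field_simp
  linear_combination -z.2 h * hQ'

theorem sum_H₁_mul_gLow (h j : Fin n) :
    ∑ k, H₁ g c₁ d₁ φ h k z * gLow g φ j k z.1 = 1 / c₁ (energy g φ z) * (if h = j then 1 else 0)
      - d₁ (energy g φ z) / (c₁ (energy g φ z) *
        (c₁ (energy g φ z) + 2 * energy g φ z * d₁ (energy g φ z))) * gZero g φ h z * z.2 j := by
  have e1 := gUp_mul_gLow g hφ hz.1 h j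
  have e2 := sum_gZero_mul_gLow g hφ hz.1 j
  simp only [gLow_symm g φ j _, H₁, sub_mul, Finset.sum_sub_distrib, mul_assoc]
  simp only [← Finset.mul_sum, e1, e2]

theorem sum_H₂_mul_gUp (h j : Fin n) :
    ∑ k, H₂ g c₂ d₂ φ h k z * gUp g φ j k z.1 = 1 / c₂ (energy g φ z) * (if j = h then 1 else 0)
      - d₂ (energy g φ z) / (c₂ (energy g φ z) *
        (c₂ (energy g φ z) + 2 * energy g φ z * d₂ (energy g φ z))) * z.2 h * gZero g φ j z := by
  have e1 := gLow_mul_gUp g hφ hz.1 h j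
  have e2 := sum_gUp_mul_momentum g φ z j
  simp only [gUp_symm g φ j _, mul_comm (gUp g φ _ _ _)] at e2
  simp only [gUp_symm g φ j _, H₂, sub_mul, Finset.sum_sub_distrib, mul_assoc]
  simp only [← Finset.mul_sum, e1, e2, eq_comm (a := h)]

theorem pderivP_G₁ (k i j : Fin n) : pderivP k (G₁ g c₁ d₁ φ i j) z =
      (gZero g φ k z * (deriv c₁ (energy g φ z) * gLow g φ i j z.1
          + deriv d₁ (energy g φ z) * z.2 i * z.2 j)
        + d₁ (energy g φ z) * ((if i = k then 1 else 0) * z.2 j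
          + z.2 i * (if j = k then 1 else 0))) :=
  (hasDirDeriv_G₁_vertVec g hc hφ hz k i j).2

theorem pderivP_G₂ (k i j : Fin n) : pderivP k (G₂ g c₂ d₂ φ i j) z =
      (gZero g φ k z * (deriv c₂ (energy g φ z) * gUp g φ i j z.1
          + deriv d₂ (energy g φ z) * gZero g φ i z * gZero g φ j z)
        + d₂ (energy g φ z) * (gUp g φ k i z.1 * gZero g φ j z
          + gZero g φ i z * gUp g φ k j z.1)) :=
  (hasDirDeriv_G₂_vertVec g hc hφ hz k i j).2

/-- Among the six terms with coefficient d₂, four cancel and the remaining two give 2 d₂ g^{ij}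
g^{0k}, the source of 2d₂ - c₂'. -/
theorem Qcoef_eq (i j h : Fin n) :
    Qcoef g c₂ d₂ φ i j h z = (1 / 2) *
      (deriv c₂ (energy g φ z) * (gZero g φ i z * ∑ k, H₂ g c₂ d₂ φ h k z * gUp g φ j k z.1
        + gZero g φ j z * ∑ k, H₂ g c₂ d₂ φ h k z * gUp g φ i k z.1)
      + (deriv d₂ (energy g φ z) * gZero g φ i z * gZero g φ j z
        + (2 * d₂ (energy g φ z) - deriv c₂ (energy g φ z)) * gUp g φ i j z.1)
        * ∑ k, H₂ g c₂ d₂ φ h k z * gZero g φ k z) := by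
  rw [Qcoef]
  simp only [pderivP_G₂ g hc hφ hz, Finset.mul_sum, ← Finset.sum_add_distrib]
  refine Finset.sum_congr rfl fun k _ => ?_
  rw [gUp_symm g φ j i, gUp_symm g φ k i, gUp_symm g φ k j]
  ring

/-- Contracting the constant curvature expression with g^{0l} gives p_j p_k - p_k p_j = 0, so d₂
drops out. -/
theorem sum_G₂_mul_curvZero_of_constant {c : ℝ} (hc0 : c ≠ 0)
    (hg : HasConstantSectionalCurvature g c) (i j k : Fin n) :
    ∑ l, G₂ g c₂ d₂ φ i l z * curvZero g φ l j k z =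
      c * c₂ (energy g φ z) * (z.2 j * (if i = k then 1 else 0)
        - z.2 k * (if i = j then 1 else 0)) := by
  have e : ∀ k, ∑ l, G₂ g c₂ d₂ φ i l z * gLow g φ l k z.1 =
      c₂ (energy g φ z) * (if i = k then 1 else 0)
        + d₂ (energy g φ z) * gZero g φ i z * z.2 k := by
    intro k
    simp only [G₂, add_mul, Finset.sum_add_distrib, mul_assoc]
    simp only [← Finset.mul_sum, gUp_mul_gLow g hφ hz.1, sum_gZero_mul_gLow g hφ hz.1]
  have e2 : ∑ l, G₂ g c₂ d₂ φ i l z * curvZero g φ l j k z =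
      c * (z.2 j * ∑ l, G₂ g c₂ d₂ φ i l z * gLow g φ l k z.1
        - z.2 k * ∑ l, G₂ g c₂ d₂ φ i l z * gLow g φ l j z.1) := by
    simp only [curvZero_of_constant g hφ hz.1 hc0 hg, Finset.mul_sum, ← Finset.sum_sub_distrib]
    exact Finset.sum_congr rfl fun l _ => by ring
  rw [e2, e, e]
  ring

theorem Pcoef_eq_of_constant {c : ℝ} (hc0 : c ≠ 0) (hg : HasConstantSectionalCurvature g c)
    (h i j : Fin n) :
    Pcoef g c₁ c₂ d₁ d₂ φ h i j z = (1 / 2) *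
      (gZero g φ i z * deriv c₁ (energy g φ z) * (∑ k, H₁ g c₁ d₁ φ h k z * gLow g φ j k z.1)
      + (gZero g φ i z * deriv d₁ (energy g φ z) * z.2 j
        + (d₁ (energy g φ z) + c * c₂ (energy g φ z)) * (if i = j then 1 else 0))
        * (∑ k, H₁ g c₁ d₁ φ h k z * z.2 k)
      + (d₁ (energy g φ z) - c * c₂ (energy g φ z)) * z.2 j * H₁ g c₁ d₁ φ h i z) := by
  have e : H₁ g c₁ d₁ φ h i z = ∑ k, H₁ g c₁ d₁ φ h k z * (if i = k then 1 else 0) := by simp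
  rw [Pcoef]
  simp only [pderivP_G₁ g hc hφ hz, sum_G₂_mul_curvZero_of_constant g hc hφ hz hc0 hg]
  rw [e]
  simp only [Finset.mul_sum, ← Finset.sum_add_distrib]
  refine Finset.sum_congr rfl fun k _ => ?_
  simp only [eq_comm (a := j) (b := i), eq_comm (a := k) (b := i)]
  ring

theorem Scoef_eq_of_constant {c : ℝ} (hc0 : c ≠ 0) (hg : HasConstantSectionalCurvature g c)
    (h i j : Fin n) :
    Scoef g c₁ c₂ d₁ d₂ φ h i j z = -(1 / 2) *
      ((deriv c₁ (energy g φ z) * gLow g φ i j z.1 + deriv d₁ (energy g φ z) * z.2 i * z.2 j)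
        * (∑ k, H₂ g c₂ d₂ φ h k z * gZero g φ k z)
      + d₁ (energy g φ z) * (H₂ g c₂ d₂ φ h i z * z.2 j + z.2 i * H₂ g c₂ d₂ φ h j z))
      + (1 / 2) * (c * (z.2 i * gLow g φ h j z.1 - z.2 j * gLow g φ h i z.1)) := by
  have e : ∀ i, H₂ g c₂ d₂ φ h i z = ∑ k, H₂ g c₂ d₂ φ h k z * (if i = k then 1 else 0) := by
    simp
  rw [Scoef, curvZero_of_constant g hφ hz.1 hc0 hg]
  simp only [pderivP_G₁ g hc hφ hz]
  congr 2
  rw [e i, e j]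
  simp only [Finset.mul_sum, Finset.sum_mul, ← Finset.sum_add_distrib]
  exact Finset.sum_congr rfl fun k _ => by ring

end Explicit

end

section

/-! ### The derivative of d₂. -/

section Coefficients

variable {A c : ℝ} {lam : ℝ → ℝ}

/-- Here d₂' is solved for in terms of the coefficient of g^{0i} g^{0j} p_h in Q. All occurrences of
λ'' and all long polynomials are thus confined to one fraction that the computation of Q need not
open. -/
theorem IsKaehlerParam.deriv_kaehlerD₂_eq (h : IsKaehlerParam A c lam) {t : ℝ} (ht : 0 < t) :
    deriv (kaehlerD₂ A c lam) t =
      2 * (kaehlerC₂ A t + 2 * t * kaehlerD₂ A c lam t) *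
        ((c * lam t + 8 * c * t * deriv lam t
          - 2 * A ^ 2 * t ^ 2 * lam t * deriv lam t * (lam t - t * deriv lam t)
          + 2 * t ^ 2 * deriv (deriv lam) t * (2 * c - A ^ 2 * t * lam t ^ 2)) /
          (2 * t ^ 2 * (2 * c - A ^ 2 * t * lam t ^ 2) * (lam t + 2 * t * deriv lam t)))
        - 2 * kaehlerD₂ A c lam t / t := by
  have hA := h.pos_A.ne'
  have hq := (h.pos_curv t ht).ne'
  have hm := (h.pos_deriv t ht).ne'
  rw [h.deriv_kaehlerD₂ ht, kaehlerC₂_add hA ht.ne' hq, kaehlerD₂]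
  generalize deriv (deriv lam) t = l''
  generalize deriv lam t = l' at *
  generalize lam t = l at *
  obtain ⟨q, hq'⟩ : ∃ q, q = 2 * c - A ^ 2 * t * l ^ 2 := ⟨_, rfl⟩
  obtain ⟨m, hm'⟩ : ∃ m, m = l + 2 * t * l' := ⟨_, rfl⟩
  -- The denominators q and m become independent variables; c and λ are eliminated instead.
  have hc : c = (q + A ^ 2 * t * l ^ 2) / 2 := by linarith
  have hl : l = m - 2 * t * l' := by linarith
  rw [← hq', ← hm']
  rw [← hq'] at hq
  rw [← hm'] at hm
  rw [hc]
  field_simp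
  rw [hl]
  ring

end Coefficients

variable {n : ℕ} {M : Type*} [TopologicalSpace M] [ChartedSpace (Coords n) M]

/-! ### The coefficients for the Kähler metrics. -/

section Kaehler

variable [IsManifold (𝓡 n) ∞ M] (g : RiemMetric n M) {φ : LocalChart n M} {z : PhaseCoords n}
  {A c : ℝ} {lam : ℝ → ℝ}

variable (hK : IsKaehlerParam A c lam) (hφ : φ ∈ smoothCharts n M) (hz : z ∈ phaseDomain φ)

include hK hφ hz

/-- Only the vertical block is involved, so no curvature enters. With c₂' = -c₂/t and d₂' in the
adapted form, λ disappears into an opaque coefficient `C`. -/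
theorem Qcoef_kaehler (i j h : Fin n) :
    let t := energy g φ z
    let l := lam t
    let l' := deriv lam t
    let l'' := deriv (deriv lam) t
    Qcoef g (kaehlerC₂ A) (kaehlerD₂ A c lam) φ i j h z =
      1 / (2 * t) * gUp g φ i j z.1 * z.2 h
        - 1 / (2 * t) * ((if i = h then 1 else 0) * gZero g φ j z
          + (if j = h then 1 else 0) * gZero g φ i z)
        + (c * l + 8 * c * t * l' - 2 * A ^ 2 * t ^ 2 * l * l' * (l - t * l')
            + 2 * t ^ 2 * l'' * (2 * c - A ^ 2 * t * l ^ 2)) /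
          (2 * t ^ 2 * (2 * c - A ^ 2 * t * l ^ 2) * (l + 2 * t * l'))
          * gZero g φ i z * gZero g φ j z * z.2 h := by
  intro t l l' l''
  have hc := hK.isMetricParam
  have ht : 0 < t := energy_pos g hφ hz
  rw [Qcoef_eq g hc hφ hz, sum_H₂_mul_gUp g hc hφ hz, sum_H₂_mul_gUp g hc hφ hz,
    sum_H₂_mul_gZero g hc hφ hz]
  change (1 / 2) * (deriv (kaehlerC₂ A) t * (_ * (1 / kaehlerC₂ A t * _ - kaehlerD₂ A c lam t /
    (kaehlerC₂ A t * (kaehlerC₂ A t + 2 * t * kaehlerD₂ A c lam t)) * _ * _) +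
    _ * (1 / kaehlerC₂ A t * _ - kaehlerD₂ A c lam t /
    (kaehlerC₂ A t * (kaehlerC₂ A t + 2 * t * kaehlerD₂ A c lam t)) * _ * _)) +
    (deriv (kaehlerD₂ A c lam) t * _ * _ + (2 * kaehlerD₂ A c lam t - deriv (kaehlerC₂ A) t) * _)
    * (_ / (kaehlerC₂ A t + 2 * t * kaehlerD₂ A c lam t))) = _
  rw [hK.deriv_kaehlerD₂_eq ht, deriv_kaehlerC₂ hK.pos_A.ne' ht.ne']
  have h1 := (hc.pos_c₂ t ht).ne'
  have h2 := (hc.pos_d₂ t ht).ne'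
  change _ = _ - _ + (c * lam t + 8 * c * t * deriv lam t
          - 2 * A ^ 2 * t ^ 2 * lam t * deriv lam t * (lam t - t * deriv lam t)
          + 2 * t ^ 2 * deriv (deriv lam) t * (2 * c - A ^ 2 * t * lam t ^ 2)) /
          (2 * t ^ 2 * (2 * c - A ^ 2 * t * lam t ^ 2) * (lam t + 2 * t * deriv lam t)) * _ * _ * _
  generalize (c * lam t + 8 * c * t * deriv lam t
          - 2 * A ^ 2 * t ^ 2 * lam t * deriv lam t * (lam t - t * deriv lam t)
          + 2 * t ^ 2 * deriv (deriv lam) t * (2 * c - A ^ 2 * t * lam t ^ 2)) /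
          (2 * t ^ 2 * (2 * c - A ^ 2 * t * lam t ^ 2) * (lam t + 2 * t * deriv lam t)) = C
  generalize kaehlerD₂ A c lam t = d at *
  obtain ⟨q, hq⟩ : ∃ q, q = kaehlerC₂ A t + 2 * t * d := ⟨_, rfl⟩
  rw [← hq] at h2 ⊢
  generalize kaehlerC₂ A t = e at *
  -- Eliminating d₂ through q = c₂ + 2 t d₂ leaves monomial denominators.
  have hd : d = (q - e) / (2 * t) := by
    field_simp
    linarith
  have ht' := ht.ne'
  generalize (if i = h then (1 : ℝ) else 0) = δ₁
  generalize (if j = h then (1 : ℝ) else 0) = δ₂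
  rw [hd]
  field_simp
  ring

variable (hc0 : c ≠ 0) (hg : HasConstantSectionalCurvature g c)

include hc0 hg

/-- Since c c₂ = c/(At), the combination d₁ - c c₂ equals -Aλ² and cancels 1/c₁ up to the factor
-1/t; this accounts for the g^{hi} p_j term. -/
theorem Pcoef_kaehler (h i j : Fin n) :
    let t := energy g φ z
    let l := lam t
    let l' := deriv lam t
    Pcoef g (kaehlerC₁ A lam) (kaehlerC₂ A) (kaehlerD₁ A c lam) (kaehlerD₂ A c lam) φ h i j z =
      -(1 / (2 * t)) * gUp g φ h i z.1 * z.2 j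
        + 1 / (2 * t) * (if i = j then 1 else 0) * gZero g φ h z
        + (l + 2 * t * l') / (2 * t * l) * (if h = j then 1 else 0) * gZero g φ i z
        - c * (l + 2 * t * l') / (2 * t ^ 2 * l * (2 * c - A ^ 2 * t * l ^ 2))
          * gZero g φ h z * gZero g φ i z * z.2 j := by
  intro t l l'
  have hc := hK.isMetricParam
  have ht : 0 < t := energy_pos g hφ hz
  have hA := hK.pos_A.ne'
  have ht' := ht.ne'
  have hq : 2 * c - A ^ 2 * t * l ^ 2 ≠ 0 := (hK.pos_curv t ht).ne'
  have hl : l ≠ 0 := (hK.pos_lam t ht).ne'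
  have e1 := hK.deriv_kaehlerC₁ ht
  have e2 := hK.deriv_kaehlerD₁ ht
  have e3 : kaehlerC₁ A lam t + 2 * t * kaehlerD₁ A c lam t = _ := kaehlerC₁_add hA ht'
  rw [Pcoef_eq_of_constant g hc hφ hz hc0 hg, sum_H₁_mul_gLow g hc hφ hz,
    sum_H₁_mul_momentum g hc hφ hz, H₁]
  simp only [show energy g φ z = t from rfl, e1, e2, e3]
  simp only [kaehlerC₁, kaehlerC₂, kaehlerD₁, show lam t = l from rfl,
    show deriv lam t = l' from rfl]
  obtain ⟨q, hq'⟩ : ∃ q, q = 2 * c - A ^ 2 * t * l ^ 2 := ⟨_, rfl⟩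
  rw [← hq'] at hq ⊢
  generalize (if i = j then (1 : ℝ) else 0) = δ₁
  generalize (if h = j then (1 : ℝ) else 0) = δ₂
  clear_value t l l'
  have hc' : c = (q + A ^ 2 * t * l ^ 2) / 2 := by linarith
  rw [hc']
  field_simp
  ring

theorem Scoef_kaehler (h i j : Fin n) :
    let t := energy g φ z
    let l := lam t
    let l' := deriv lam t
    Scoef g (kaehlerC₁ A lam) (kaehlerC₂ A) (kaehlerD₁ A c lam) (kaehlerD₂ A c lam) φ h i j z =
      -(l * (2 * c - A ^ 2 * t * l ^ 2) / (2 * (l + 2 * t * l'))) * gLow g φ i j z.1 * z.2 h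
        - (2 * c - A ^ 2 * t * l ^ 2) / 2 * gLow g φ h i z.1 * z.2 j
        + A ^ 2 * t * l ^ 2 / 2 * gLow g φ h j z.1 * z.2 i
        + (3 * c * l + 2 * c * t * l' - 2 * A ^ 2 * t * l ^ 2 * (l + t * l')) /
          (2 * t * (l + 2 * t * l')) * z.2 h * z.2 i * z.2 j := by
  intro t l l'
  have hc := hK.isMetricParam
  have ht : 0 < t := energy_pos g hφ hz
  have hA := hK.pos_A.ne'
  have ht' := ht.ne'
  have hq : 2 * c - A ^ 2 * t * l ^ 2 ≠ 0 := (hK.pos_curv t ht).ne'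
  have hm : l + 2 * t * l' ≠ 0 := (hK.pos_deriv t ht).ne'
  have e1 := hK.deriv_kaehlerC₁ ht
  have e2 := hK.deriv_kaehlerD₁ ht
  have e3 := kaehlerC₂_add (c := c) (lam := lam) hA ht' hq
  -- Expressing d₂ through c₂ + 2 t d₂ replaces its long numerator by a square, so only the
  -- denominators q and m occur.
  have e4 : kaehlerD₂ A c lam t = (A * (lam t + 2 * t * deriv lam t) ^ 2 /
      (2 * c - A ^ 2 * t * lam t ^ 2) - kaehlerC₂ A t) / (2 * t) := by
    rw [← e3]
    field_simp
    ring
  rw [Scoef_eq_of_constant g hc hφ hz hc0 hg, sum_H₂_mul_gZero g hc hφ hz, H₂, H₂]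
  simp only [show energy g φ z = t from rfl, e1, e2, e4]
  simp only [kaehlerC₂, kaehlerD₁, show lam t = l from rfl,
    show deriv lam t = l' from rfl]
  obtain ⟨q, hq'⟩ : ∃ q, q = 2 * c - A ^ 2 * t * l ^ 2 := ⟨_, rfl⟩
  obtain ⟨m, hm'⟩ : ∃ m, m = l + 2 * t * l' := ⟨_, rfl⟩
  rw [← hq', ← hm']
  rw [← hq'] at hq
  rw [← hm'] at hm
  clear_value t l l'
  have hc' : c = (q + A ^ 2 * t * l ^ 2) / 2 := by linarith
  have hl : l = m - 2 * t * l' := by linarith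
  rw [hc']
  field_simp
  rw [hl]
  ring

end Kaehler

end

end CotangentLift

end

theorem theorem8 {n : ℕ} {M : Type*} [TopologicalSpace M]
    [ChartedSpace (EuclideanSpace ℝ (Fin n)) M] [IsManifold (𝓡 n) ∞ M]
    (g : ContMDiffRiemannianMetric (𝓡 n) ∞ (EuclideanSpace ℝ (Fin n))
      (fun x : M => TangentSpace (𝓡 n) x)) :
    -- the Levi-Civita connection of a natural metric of diagonal type, for arbitrary `(M, g)`
    (∀ c₁ c₂ d₁ d₂ : ℝ → ℝ, IsMetricParam c₁ c₂ d₁ d₂ →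
      -- `Q^{ij}_h`, `P^{hi}_j`, `S_{hij}` are M-tensor fields on `T*₀M`
      IsMTensorField 2 1 (fun (φ : LocalChart n M) I J => Qcoef g c₂ d₂ φ (I 0) (I 1) (J 0)) ∧
      IsMTensorField 2 1
        (fun (φ : LocalChart n M) I J => Pcoef g c₁ c₂ d₁ d₂ φ (I 0) (I 1) (J 0)) ∧
      IsMTensorField 0 3
        (fun (φ : LocalChart n M) _ J => Scoef g c₁ c₂ d₁ d₂ φ (J 0) (J 1) (J 2)) ∧
      -- the expression of the connection in the adapted frame of each induced chart
      ∀ nabla, IsLeviCivitaOn (cotModel n) (nonzeroCotangent n M)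
          (diagMetric g c₁ c₂ d₁ d₂) nabla →
        ∀ φ ∈ smoothCharts n M, ∀ ξ ∈ nonzeroCotangent n M, ξ.proj ∈ φ.source →
          ∀ i j : Fin n,
            nabla (frameP φ j) ξ (frameP φ i ξ) =
              ∑ h, Qcoef g c₂ d₂ φ i j h (inducedChart φ ξ) • frameP φ h ξ ∧
            nabla (frameP φ j) ξ (frameQ g φ i ξ) =
              -(∑ h, christoffel g φ j i h (φ ξ.proj) • frameP φ h ξ)
                + ∑ h, Pcoef g c₁ c₂ d₁ d₂ φ h j i (inducedChart φ ξ) • frameQ g φ h ξ ∧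
            nabla (frameQ g φ j) ξ (frameP φ i ξ) =
              ∑ h, Pcoef g c₁ c₂ d₁ d₂ φ h i j (inducedChart φ ξ) • frameQ g φ h ξ ∧
            nabla (frameQ g φ j) ξ (frameQ g φ i ξ) =
              (∑ h, christoffel g φ h i j (φ ξ.proj) • frameQ g φ h ξ)
                + ∑ h, Scoef g c₁ c₂ d₁ d₂ φ h i j (inducedChart φ ξ) • frameP φ h ξ) ∧
    -- the explicit form for constant positive curvature and the Kähler metrics
    (∀ (A c : ℝ) (lam : ℝ → ℝ), 0 < c → HasConstantSectionalCurvature g c →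
      IsKaehlerParam A c lam →
      IsMetricParam (kaehlerC₁ A lam) (kaehlerC₂ A) (kaehlerD₁ A c lam) (kaehlerD₂ A c lam) ∧
      ∀ φ ∈ smoothCharts n M, ∀ z ∈ phaseDomain φ, ∀ h i j : Fin n,
        let t := energy g φ z
        let l := lam t
        let l' := deriv lam t
        let l'' := deriv (deriv lam) t
        let p := fun a : Fin n => z.2 a
        let g₀ := fun a : Fin n => gZero g φ a z
        let δ := fun a b : Fin n => if a = b then (1 : ℝ) else 0
        Qcoef g (kaehlerC₂ A) (kaehlerD₂ A c lam) φ i j h z =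
          1 / (2 * t) * gUp g φ i j z.1 * p h - 1 / (2 * t) * (δ i h * g₀ j + δ j h * g₀ i)
            + (c * l + 8 * c * t * l' - 2 * A ^ 2 * t ^ 2 * l * l' * (l - t * l')
                + 2 * t ^ 2 * l'' * (2 * c - A ^ 2 * t * l ^ 2)) /
              (2 * t ^ 2 * (2 * c - A ^ 2 * t * l ^ 2) * (l + 2 * t * l')) * g₀ i * g₀ j * p h ∧
        Pcoef g (kaehlerC₁ A lam) (kaehlerC₂ A) (kaehlerD₁ A c lam) (kaehlerD₂ A c lam) φ h i j z =
          -(1 / (2 * t)) * gUp g φ h i z.1 * p j + 1 / (2 * t) * δ i j * g₀ h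
            + (l + 2 * t * l') / (2 * t * l) * δ h j * g₀ i
            - c * (l + 2 * t * l') / (2 * t ^ 2 * l * (2 * c - A ^ 2 * t * l ^ 2))
              * g₀ h * g₀ i * p j ∧
        Scoef g (kaehlerC₁ A lam) (kaehlerC₂ A) (kaehlerD₁ A c lam) (kaehlerD₂ A c lam) φ h i j z =
          -(l * (2 * c - A ^ 2 * t * l ^ 2) / (2 * (l + 2 * t * l'))) * gLow g φ i j z.1 * p h
            - (2 * c - A ^ 2 * t * l ^ 2) / 2 * gLow g φ h i z.1 * p j
            + A ^ 2 * t * l ^ 2 / 2 * gLow g φ h j z.1 * p i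
            + (3 * c * l + 2 * c * t * l' - 2 * A ^ 2 * t * l ^ 2 * (l + t * l')) /
              (2 * t * (l + 2 * t * l')) * p h * p i * p j) := by
  refine ⟨fun c₁ c₂ d₁ d₂ hc => ⟨isMTensorField_Qcoef g hc, isMTensorField_Pcoef g hc,
    isMTensorField_Scoef g hc, fun nabla hN φ hφ ξ hξ hx i j =>
    ⟨nabla_frameP_frameP g hc hφ hx hξ hN i j, nabla_frameQ_frameP g hc hφ hx hξ hN i j,
      nabla_frameP_frameQ g hc hφ hx hξ hN i j, nabla_frameQ_frameQ g hc hφ hx hξ hN i j⟩⟩,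
    fun A c lam hc0 hg hK => ⟨hK.isMetricParam, fun φ hφ z hz h i j =>
      ⟨Qcoef_kaehler g hK hφ hz i j h, Pcoef_kaehler g hK hφ hz hc0.ne' hg h i j,
        Scoef_kaehler g hK hφ hz hc0.ne' hg h i j⟩⟩⟩
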